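/- For $n\ge 2$, $r>0$ and $\gamma>0$ let $X$ be a Poisson process of hyperplanes in $\mathbb{R}^n$ with intensity measure $$\Theta(\,\cdot\,)=\frac{\gamma}{\omega_n}\int_{\mathbb{S}^{n-1}}\int_{\mathbb{R}}\mathbf 1\{H(u,t)\in\,\cdot\,\}\,|t|^{r-1}\,dt\,\mathcal{H}^{n-1}(du),\qquad H(u,t)=\{x\in\mathbb{R}^n:\langle x,u\rangle=t\},$$ where $\omega_s=2\pi^{s/2}/\Gamma(s/2)$ for real $s>0$. Let $Z_0=\bigcap_{H\in X}H^-$ be its zero cell, where $H^-$ is the closed half-space bounded by $H$ that contains the origin. Let $V_n$ and $V_{n-1}$ be the intrinsic volumes of order $n$ and $n-1$ (volume and half of the surface area), and for a random convex body $K\subset\mathbb{R}^n$ put $$\mathcal{I}_n(K)=\frac{(\mathbb{E}V_{n-1}(K))^{n/(n-1)}}{\mathbb{E}V_n(K)}.$$ A function $\varphi$ is a gauge function for a sequence $K_n\subset\mathbb{R}^n$ of random convex bodies if $\lim_{n\to\infty}\varphi(n)\,\mathcal{I}_n(K_n)=1$. Let $b>0$ and $\alpha\in\mathbb{R}$. For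 each $n\ge2$ let $Z_0$ be the zero cell in $\mathbb{R}^n$ with distance exponent $r=b\,n^\alpha$ and an arbitrary intensity $\gamma=\gamma_n>0$. Then $V_{n-1}(Z_0)$ and $V_n(Z_0)$ are integrable for every $n\ge 2$, and a gauge function for the zero cells $Z_0$ is $$\varphi(n)=\begin{cases} \dfrac{b}{\sqrt{e}}\,n^{\alpha-1}\left(1-\dfrac1n\right)^{-n^{1-\alpha}/b} & \text{if } \alpha<0,\\[1.5ex] 2\,e^{\frac1b-\frac12}\,\dfrac{\omega_b}{\omega_{b+1}}\,n^{-1} & \text{if } \alpha=0,\\[1.5ex] 2\sqrt{\dfrac{b}{2\pi e}}\;n^{-(1-\alpha/2)} & \text{if } 0<\alpha<1,\\[1.5ex] 2\sqrt{\dfrac{b}{(b+1)\,2\pi e}}\;n^{-1/2} & \text{if } \alpha=1,\\[1.5ex] \dfrac{2}{\sqrt{2\pi e}}\;n^{-1/2} & \text{if } \alpha>1. \end{cases}$$ Moreover, $\varphi(n)\to\infty$ as $n\to\infty$ if $\alpha<0$, whereas $\varphi(n)\to0$ if $\alpha\ge0$. The function $n\mapsto\frac{2}{\sqrt{2\pi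 e}}\,n^{-1/2}$ is a gauge function for the (deterministic) Euclidean unit balls $\mathbb{B}^n$; thus for $\alpha>1$ the gauge function of the zero cells coincides with that of the ball. -/

import Mathlib

open MeasureTheory ProbabilityTheory Filter Topology Set

noncomputable section

namespace PoissonPolyhedra

/-- Euclidean space `ℝⁿ` with its Euclidean norm and Lebesgue measure. -/
abbrev Euc (n : ℕ) : Type := EuclideanSpace ℝ (Fin n)

/-- `ω_s = 2 π^(s/2) / Γ(s/2)`; for an integer `s ≥ 1` the surface area of the unit sphere of
`ℝˢ`. -/
def omega (s : ℝ) : ℝ := 2 * Real.pi ^ (s / 2) / Real.Gamma (s / 2)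

/-- `κ_s = π^(s/2) / Γ(s/2 + 1)`; for an integer `s` the volume of the unit ball of `ℝˢ`. -/
def kappa (s : ℝ) : ℝ := Real.pi ^ (s / 2) / Real.Gamma (s / 2 + 1)

/-- The intrinsic volume `V_j(K)`. By Steiner's formula, for a convex body `K ⊆ ℝⁿ` the volume of
the parallel set `K_s = {x | d(x, K) ≤ s}`, `s ≥ 0`, is the polynomial
`∑ j ≤ n, s^(n-j) κ_(n-j) V_j(K)`, so `κ_(n-j) V_j(K)` is its coefficient of degree `n - j`, read
off here as a Taylor coefficient at `0` (of the function on `[0, ∞)`). For `j = n` this is the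
volume of `K`, and for `j = n - 1` it is half of the surface area of a `K` with interior points. -/
def intrinsicVolume {n : ℕ} (j : ℕ) (K : Set (Euc n)) : ℝ :=
  iteratedDerivWithin (n - j) (fun s : ℝ => volume.real (Metric.cthickening s K)) (Ici 0) 0 /
    ((n - j).factorial * kappa ((n - j : ℕ) : ℝ))

/-- The space `A(n, n-1)` of hyperplanes `{x | ⟨x, u⟩ = t}` of `ℝⁿ`, `‖u‖ = 1`, `t ∈ ℝ`. -/
def Hyperplane (n : ℕ) : Type :=
  {H : Set (Euc n) // ∃ (u : Metric.sphere (0 : Euc n) 1) (t : ℝ),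
    H = {x : Euc n | inner ℝ x (u : Euc n) = t}}

/-- The hyperplane `H(u, t) = {x | ⟨x, u⟩ = t}`. -/
def hyperplane {n : ℕ} (u : Metric.sphere (0 : Euc n) 1) (t : ℝ) : Hyperplane n :=
  ⟨{x : Euc n | inner ℝ x (u : Euc n) = t}, u, t, rfl⟩

/-- A set of hyperplanes is measurable if and only if the set of its parameters
`(u, t) ∈ 𝕊ⁿ⁻¹ × ℝ` is Borel. The canonical topology of the space of hyperplanes is the quotient
topology under the two-to-one map `(u, t) ↦ H(u, t)`, so this is its Borel `σ`-field. -/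
instance instMeasurableSpaceHyperplane (n : ℕ) : MeasurableSpace (Hyperplane n) :=
  MeasurableSpace.map
    (fun p : Metric.sphere (0 : Euc n) 1 × ℝ => hyperplane p.1 p.2) inferInstance

/-- The measure `Θ = (γ / ω_n) ∫_{𝕊ⁿ⁻¹} ∫_ℝ 1{H(u, t) ∈ ·} |t|^(r-1) dt 𝓗ⁿ⁻¹(du)` on the space of
hyperplanes, with distance exponent `r` and intensity `γ`; `volume.toSphere` is the surface
measure of the unit sphere. -/
def Theta (n : ℕ) (r γ : ℝ) : Measure (Hyperplane n) :=
  ENNReal.ofReal (γ / omega n) •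
    Measure.map (fun p : Metric.sphere (0 : Euc n) 1 × ℝ => hyperplane p.1 p.2)
      ((volume : Measure (Euc n)).toSphere.prod
        ((volume : Measure ℝ).withDensity fun t => ENNReal.ofReal (|t| ^ (r - 1))))

/-- A Poisson process `X = ∑ δ_{H_i}` (the `H_i` being pairwise distinct) of hyperplanes with
intensity measure `Λ`, given as the random set `X ω` of its hyperplanes: the number of hyperplanes
of `X` in a measurable set `A` is a random variable, it is Poisson distributed with mean `Λ A` if
this is finite, and these numbers are independent for disjoint sets. -/
structure IsPoissonHyperplaneProcess {n : ℕ} {Ω : Type*} [MeasurableSpace Ω] (P : Measure Ω)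
    (X : Ω → Set (Hyperplane n)) (Λ : Measure (Hyperplane n)) : Prop where
  measurable_count : ∀ A : Set (Hyperplane n), MeasurableSet A →
    Measurable fun ω => (X ω ∩ A).encard
  law_count : ∀ A : Set (Hyperplane n), MeasurableSet A → Λ A ≠ ⊤ →
    Measure.map (fun ω => (X ω ∩ A).encard) P =
      Measure.map (fun k : ℕ => (k : ℕ∞)) (poissonMeasure (Λ A).toNNReal)
  indep_count : ∀ (m : ℕ) (A : Fin m → Set (Hyperplane n)), (∀ i, MeasurableSet (A i)) →
    Pairwise (Function.onFun Disjoint A) → iIndepFun (fun i ω => (X ω ∩ A i).encard) P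

/-- The closed half-space `H⁻` bounded by `H` that contains the origin: `{x | ⟨x, u⟩ ≤ t}` if
`H = H(u, t)` with `t > 0`. (If `0 ∈ H`, which for the processes below happens with probability
zero, both closed half-spaces contain the origin; then this is their intersection.) -/
def halfspace {n : ℕ} (H : Hyperplane n) : Set (Euc n) :=
  {x | ∀ (u : Metric.sphere (0 : Euc n) 1) (t : ℝ), 0 ≤ t → H = hyperplane u t →
    inner ℝ x (u : Euc n) ≤ t}

/-- The zero cell `⋂ H⁻` of a system `S` of hyperplanes, the intersection being over `H ∈ S`. -/
def zeroCell {n : ℕ} (S : Set (Hyperplane n)) : Set (Euc n) := ⋂ H ∈ S, halfspace H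

/-- The isoperimetric ratio `(𝔼 V_{n-1}(K))^(n/(n-1)) / 𝔼 V_n(K)` of a random set `K` in `ℝⁿ`. -/
def isoperimetricRatio {n : ℕ} {Ω : Type*} [MeasurableSpace Ω] (P : Measure Ω)
    (K : Ω → Set (Euc n)) : ℝ :=
  (∫ ω, intrinsicVolume (n - 1) (K ω) ∂P) ^ ((n : ℝ) / ((n : ℝ) - 1)) /
    ∫ ω, intrinsicVolume n (K ω) ∂P

/-- `φ` is a gauge function for the sequence `K n` of random sets in `ℝⁿ`. -/
def IsGaugeFunction {Ω : ℕ → Type*} [∀ n, MeasurableSpace (Ω n)] (P : ∀ n, Measure (Ω n))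
    (K : ∀ n, Ω n → Set (Euc n)) (φ : ℕ → ℝ) : Prop :=
  Tendsto (fun n => φ n * isoperimetricRatio (P n) (K n)) atTop (𝓝 1)

/-- The explicit gauge function for the zero cell with distance exponent `b n^α`. -/
def gauge (b α : ℝ) (n : ℕ) : ℝ :=
  if α < 0 then
    b / √(Real.exp 1) * (n : ℝ) ^ (α - 1) * (1 - 1 / (n : ℝ)) ^ (-((n : ℝ) ^ (1 - α) / b))
  else if α = 0 then
    2 * Real.exp (1 / b - 1 / 2) * (omega b / omega (b + 1)) * (n : ℝ)⁻¹
  else if α < 1 then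
    2 * √(b / (2 * Real.pi * Real.exp 1)) * (n : ℝ) ^ (-(1 - α / 2))
  else if α = 1 then
    2 * √(b / ((b + 1) * (2 * Real.exp 1 * Real.pi))) * (n : ℝ) ^ (-(1 / 2 : ℝ))
  else
    2 / √(2 * Real.pi * Real.exp 1) * (n : ℝ) ^ (-(1 / 2 : ℝ))

/-- The explicit gauge function for the Euclidean unit ball. -/
def ballGauge (n : ℕ) : ℝ :=
  2 / √(2 * Real.pi * Real.exp 1) * (n : ℝ) ^ (-(1 / 2 : ℝ))

end PoissonPolyhedra

end

/-! ## Stirling's formula and the isoperimetric ratio of the ball -/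

namespace PoissonPolyhedra

/-! The isoperimetric ratio has a closed form for every n ≥ 2, and Stirling's formula expands it.

Volume. In polar coordinates V_n(Z_0) = (1/n) ∫ ρ(v)^n dv, where ρ is the radial function. The event
ρ(v) ≥ a says that no hyperplane is crossed before a•v, so a void probability gives P(ρ(v) ≥ a) =
exp(-λ a^r) with λ = `totalRate` (`measureReal_le_rad`). This Weibull law has moments E ρ^m =
λ^(-m/r) Γ(m/r + 1).

Surface area. V_{n-1} is half the one-sided derivative at 0 of the volume of the parallel body. In
almost every direction v the ray leaves the cell through exactly one bounding hyperplane, with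
normal u say. For small s the parallel body then reaches precisely as far as the cell with all
half-spaces shifted outwards by s, namely to ρ + s g with g = 1/⟨v, u⟩
(`rad_cthickening_eventuallyEq`). Dominated convergence yields 2 V_{n-1} = ∫ ρ^(n-1) g dv
(`hasDerivWithinAt_volume_cthickening`). On the time scale a^r, the half-spaces with 1/⟨v, u⟩ > y
and the remaining ones act as two competing exponential clocks. Hence ρ and g are independent
(`measureReal_lt_growthRate_le_rad`), and E g is a quotient of one-sided moments of the surface
measure of the sphere, which are Gamma functions (`lintegral_sphere_posRpow`).

Ratio. In (E V_{n-1})^(n/(n-1)) / E V_n the powers of λ cancel, and γ disappears with them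
(`isoperimetricRatio_zeroCell`). The logarithm of what remains is a sum of three terms
(`log_zeroCellRatio`): that of the ratio of the ball, which is asymptotic to √(πen/2); the logarithm
of E g, times n/(n-1); and a comparison of Γ at (n-1)/r + 1 and n/r + 1. For r = b n^α the second
term depends on whether r tends to 0, is constant or tends to ∞, and on n/r. The third is
asymptotically (n/r) log(1 - 1/n) if α < 1: it diverges for α < 0, tends to -1/b for α = 0 and
vanishes in the limit for 0 < α < 1, as the third term also does for α ≥ 1. The divergence for α < 0
is what makes the gauge function grow. -/

lemma log_Gamma_add_one {x : ℝ} (hx : 0 < x) :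
    Real.log (Real.Gamma (x + 1)) = Real.log (Real.Gamma x) + Real.log x := by
  rw [Real.Gamma_add_one hx.ne', Real.log_mul hx.ne' (Real.Gamma_pos_of_pos hx).ne', add_comm]

/-- Stirling's formula along the natural numbers, in logarithmic form. -/
lemma tendsto_log_factorial_sub : Tendsto (fun m : ℕ => Real.log (Real.Gamma ((m : ℝ) + 1)) -
    (((m : ℝ) + 1 / 2) * Real.log m - m)) atTop (𝓝 (Real.log (2 * Real.pi) / 2)) := by
  have h := (Real.continuousAt_log (by positivity : √Real.pi ≠ 0)).tendsto.comp
    Stirling.tendsto_stirlingSeq_sqrt_pi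
  have h2 : Real.log (2 * Real.pi) / 2 = Real.log √Real.pi + Real.log 2 / 2 := by
    rw [Real.log_sqrt Real.pi_pos.le, Real.log_mul (by norm_num) Real.pi_pos.ne']; ring
  rw [h2]
  refine (h.add_const (Real.log 2 / 2)).congr' ?_
  filter_upwards [eventually_gt_atTop 0] with m hm
  have hm' : (0 : ℝ) < m := by exact_mod_cast hm
  simp only [Function.comp]
  rw [Stirling.log_stirlingSeq_formula, Real.Gamma_nat_eq_factorial,
    Real.log_mul (by norm_num) hm'.ne', Real.log_div hm'.ne' (Real.exp_pos 1).ne', Real.log_exp]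
  ring

/-- Comparison of the remainder in Stirling's formula at `m + θ` and at `m`. -/
lemma abs_stirling_remainder_sub_le {m : ℕ} (hm : 1 ≤ m) {θ : ℝ} (h0 : 0 ≤ θ) (h1 : θ < 1) :
    |(Real.log (Real.Gamma ((m + θ) + 1)) - ((m + θ + 1 / 2) * Real.log (m + θ) - (m + θ))) -
      (Real.log (Real.Gamma ((m : ℝ) + 1)) - (((m : ℝ) + 1 / 2) * Real.log m - m))| ≤ 2 / m := by
  have hm' : (1 : ℝ) ≤ m := by exact_mod_cast hm
  have hm0 : (0 : ℝ) < m := by linarith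
  rcases h0.eq_or_lt with rfl | h0
  · simp only [add_zero, sub_self, abs_zero]; positivity
  have hf : ∀ {y : ℝ}, 0 < y → (Real.log ∘ Real.Gamma) (y + 1) =
      (Real.log ∘ Real.Gamma) y + Real.log y := fun hy => log_Gamma_add_one hy
  -- Log-convexity traps log Γ(m+1+θ) - log Γ(m+1) between θ log m and θ log(m+1); the rest compares
  -- these with the increment of the Stirling terms.
  have hu := Real.BohrMollerup.f_add_nat_le Real.convexOn_log_Gamma hf
    (n := m + 1) (by omega) h0 h1.le
  have hl := Real.BohrMollerup.f_add_nat_ge Real.convexOn_log_Gamma hf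
    (n := m + 1) (by omega) h0
  simp only [Function.comp, Nat.cast_add, Nat.cast_one, add_sub_cancel_right] at hu hl
  rw [show (m : ℝ) + 1 + θ = m + θ + 1 by ring] at hu hl
  have e1 : Real.log (m + θ) = Real.log m + Real.log (1 + θ / m) := by
    rw [← Real.log_mul hm0.ne' (by positivity)]; congr 1; field_simp
  have e2 : Real.log ((m : ℝ) + 1) = Real.log m + Real.log (1 + 1 / m) := by
    rw [← Real.log_mul hm0.ne' (by positivity)]; congr 1; field_simp
  have u1 : Real.log (1 + θ / m) ≤ θ / m := by
    have := Real.log_le_sub_one_of_pos (show 0 < 1 + θ / m by positivity); linarith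
  have u2 : Real.log (1 + 1 / (m : ℝ)) ≤ 1 / m := by
    have := Real.log_le_sub_one_of_pos (show 0 < 1 + 1 / (m : ℝ) by positivity); linarith
  have l1 : θ / (m + θ) ≤ Real.log (1 + θ / m) := by
    have := Real.one_sub_inv_le_log_of_pos (show 0 < 1 + θ / m by positivity)
    have e : 1 - (1 + θ / m)⁻¹ = θ / (m + θ) := by field_simp; ring
    linarith
  have l1' : θ ≤ (m + θ + 1 / 2) * Real.log (1 + θ / m) := by
    calc θ = (m + θ) * (θ / (m + θ)) := by field_simp
      _ ≤ (m + θ + 1 / 2) * Real.log (1 + θ / m) := by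
        exact mul_le_mul (by linarith) l1 (by positivity) (by positivity)
  have u1' : (m + θ + 1 / 2) * Real.log (1 + θ / m) ≤ θ + 2 / m := by
    calc (m + θ + 1 / 2) * Real.log (1 + θ / m) ≤ (m + θ + 1 / 2) * (θ / m) := by gcongr
      _ = θ + (θ + 1 / 2) * θ / m := by field_simp; ring
      _ ≤ θ + 2 / m := by gcongr; nlinarith
  have u2' : θ * Real.log (1 + 1 / (m : ℝ)) ≤ 2 / m := by
    calc θ * Real.log (1 + 1 / (m : ℝ)) ≤ 1 * (1 / m) := by
          apply mul_le_mul h1.le u2 (Real.log_nonneg (by simp)) zero_le_one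
      _ ≤ 2 / m := by rw [one_mul]; gcongr; norm_num
  rw [e2] at hu
  rw [e1, abs_le]
  constructor <;> nlinarith

/-- Stirling's formula for the Gamma function, in logarithmic form. -/
lemma tendsto_log_Gamma_sub : Tendsto (fun x : ℝ => Real.log (Real.Gamma (x + 1)) -
    ((x + 1 / 2) * Real.log x - x)) atTop (𝓝 (Real.log (2 * Real.pi) / 2)) := by
  have h1 := tendsto_log_factorial_sub.comp (tendsto_nat_floor_atTop (α := ℝ))
  have h2 : Tendsto (fun x : ℝ => (2 : ℝ) / (⌊x⌋₊ : ℝ)) atTop (𝓝 0) :=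
    (tendsto_const_nhds.div_atTop tendsto_natCast_atTop_atTop).comp
      (tendsto_nat_floor_atTop (α := ℝ))
  have h3 : Tendsto (fun x : ℝ => (Real.log (Real.Gamma (x + 1)) -
      ((x + 1 / 2) * Real.log x - x)) - (Real.log (Real.Gamma ((⌊x⌋₊ : ℝ) + 1)) -
      (((⌊x⌋₊ : ℝ) + 1 / 2) * Real.log ⌊x⌋₊ - ⌊x⌋₊))) atTop (𝓝 0) := by
    refine squeeze_zero_norm' ?_ h2
    filter_upwards [eventually_ge_atTop 1] with x hx
    have := abs_stirling_remainder_sub_le (m := ⌊x⌋₊) (Nat.one_le_floor_iff x |>.2 hx)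
      (θ := x - ⌊x⌋₊) (by linarith [Nat.floor_le (show 0 ≤ x by linarith)])
      (by linarith [Nat.lt_floor_add_one x])
    rwa [add_sub_cancel] at this
  simpa using h3.add h1

/-- Midpoint log-convexity of Γ suffices: at the midpoint of x and x + 1 it gives the upper bound,
at the midpoint of x - 1/2 and x + 1/2 the lower one. -/
lemma tendsto_log_Gamma_add_half_sub : Tendsto (fun x : ℝ => Real.log (Real.Gamma (x + 1 / 2)) -
    Real.log (Real.Gamma x) - Real.log x / 2) atTop (𝓝 0) := by
  have key : ∀ y : ℝ, 0 < y → 2 * Real.log (Real.Gamma (y + 1 / 2)) ≤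
      Real.log (Real.Gamma y) + Real.log (Real.Gamma (y + 1)) := by
    intro y hy
    have := Real.convexOn_log_Gamma.2 (show y ∈ Ioi (0 : ℝ) from hy)
      (show y + 1 ∈ Ioi (0 : ℝ) by simp; linarith) (show (0 : ℝ) ≤ 1 / 2 by norm_num)
      (show (0 : ℝ) ≤ 1 / 2 by norm_num) (by norm_num)
    simp only [smul_eq_mul, Function.comp] at this
    rw [show 1 / 2 * y + 1 / 2 * (y + 1) = y + 1 / 2 by ring] at this
    linarith
  have hlim : Tendsto (fun x : ℝ => Real.log (1 - 1 / (2 * x)) / 2) atTop (𝓝 0) := by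
    have h1 : Tendsto (fun x : ℝ => 1 - 1 / (2 * x)) atTop (𝓝 1) := by
      have : Tendsto (fun x : ℝ => 1 / (2 * x)) atTop (𝓝 0) :=
        tendsto_const_nhds.div_atTop (tendsto_id.const_mul_atTop two_pos)
      simpa using this.const_sub 1
    simpa using ((Real.continuousAt_log one_ne_zero).tendsto.comp h1).div_const 2
  refine tendsto_of_tendsto_of_tendsto_of_le_of_le' hlim tendsto_const_nhds ?_ ?_
  · filter_upwards [eventually_gt_atTop 1] with x hx
    have h := key (x - 1 / 2) (by linarith)
    have e := log_Gamma_add_one (show 0 < x - 1 / 2 by linarith)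
    rw [show x - 1 / 2 + 1 / 2 = x by ring] at h
    rw [show x - 1 / 2 + 1 = x + 1 / 2 by ring] at h e
    have e2 : Real.log (x - 1 / 2) = Real.log x + Real.log (1 - 1 / (2 * x)) := by
      have : 0 < 1 - 1 / (2 * x) := by
        rw [sub_pos, div_lt_one (by linarith)]; linarith
      rw [← Real.log_mul (by linarith) this.ne']; congr 1; field_simp
    linarith
  · filter_upwards [eventually_gt_atTop 0] with x hx
    have h := key x hx
    have e := log_Gamma_add_one hx
    linarith

lemma tendsto_log_div_natCast : Tendsto (fun n : ℕ => Real.log n / n) atTop (𝓝 0) :=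
  (Real.isLittleO_log_id_atTop.tendsto_div_nhds_zero).comp tendsto_natCast_atTop_atTop

lemma tendsto_log_div_natCast_sub_one :
    Tendsto (fun n : ℕ => Real.log n / ((n : ℝ) - 1)) atTop (𝓝 0) := by
  have h : Tendsto (fun n : ℕ => 2 * (Real.log n / n)) atTop (𝓝 0) := by
    simpa using tendsto_log_div_natCast.const_mul 2
  refine squeeze_zero' ?_ ?_ h
  · filter_upwards [eventually_ge_atTop 2] with n hn
    have : (2 : ℝ) ≤ n := by exact_mod_cast hn
    exact div_nonneg (Real.log_nonneg (by linarith)) (by linarith)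
  · filter_upwards [eventually_ge_atTop 2] with n hn
    have : (2 : ℝ) ≤ n := by exact_mod_cast hn
    rw [← mul_div_assoc, div_le_div_iff₀ (by linarith) (by linarith)]
    have := Real.log_nonneg (show (1 : ℝ) ≤ n by linarith)
    nlinarith

lemma tendsto_inv_natCast_sub_one : Tendsto (fun n : ℕ => 1 / ((n : ℝ) - 1)) atTop (𝓝 0) :=
  tendsto_const_nhds.div_atTop
    (tendsto_atTop_add_const_right _ (-1 : ℝ) tendsto_natCast_atTop_atTop)

lemma tendsto_natCast_div_sub_one : Tendsto (fun n : ℕ => (n : ℝ) / ((n : ℝ) - 1)) atTop (𝓝 1) := by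
  have := tendsto_inv_natCast_sub_one.const_add 1
  rw [add_zero] at this
  refine this.congr' ?_
  filter_upwards [eventually_ge_atTop 2] with n hn
  have : (2 : ℝ) ≤ n := by exact_mod_cast hn
  have : (n : ℝ) - 1 ≠ 0 := by linarith
  field_simp; ring

lemma kappa_pos {s : ℝ} (hs : 0 ≤ s) : 0 < kappa s := by
  have := Real.Gamma_pos_of_pos (show 0 < s / 2 + 1 by positivity)
  unfold kappa; positivity

/-- The isoperimetric ratio of the ball, in logarithmic form. -/
lemma tendsto_log_ball_ratio : Tendsto (fun n : ℕ => (n : ℝ) / ((n : ℝ) - 1) *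
    (Real.log n - Real.log 2 + Real.log (kappa n)) - Real.log (kappa n) -
      (Real.log n + Real.log Real.pi - Real.log 2 + 1) / 2) atTop (𝓝 0) := by
  have hhalf : Tendsto (fun n : ℕ => (n : ℝ) / 2) atTop atTop :=
    tendsto_natCast_atTop_atTop.atTop_div_const two_pos
  have hS := tendsto_log_Gamma_sub.comp hhalf
  -- After inserting Stirling's formula the multiples of log n cancel exactly, so `h3` enters with
  -- coefficient 0. Left over are the Stirling remainder and (log π + 1)/2, both divided by n - 1.
  have h1 := (hS.mul tendsto_inv_natCast_sub_one).const_mul (-1)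
  have h2 := (tendsto_inv_natCast_sub_one.const_mul ((Real.log Real.pi + 1)/2))
  have h3 : Tendsto (fun n : ℕ => (0 : ℝ) * (Real.log n / ((n : ℝ) - 1))) atTop (𝓝 (0 * 0)) :=
    tendsto_log_div_natCast_sub_one.const_mul 0
  have := (h1.add h2).add h3
  simp only [mul_zero, add_zero] at this
  refine this.congr' ?_
  filter_upwards [eventually_ge_atTop 2] with n hn
  have hn' : (2 : ℝ) ≤ n := by exact_mod_cast hn
  have hk : Real.log (kappa n) = (n : ℝ) / 2 * Real.log Real.pi -
      Real.log (Real.Gamma ((n : ℝ) / 2 + 1)) := by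
    rw [kappa, Real.log_div (by positivity)
      (Real.Gamma_pos_of_pos (show (0 : ℝ) < (n : ℝ) / 2 + 1 by positivity)).ne',
      Real.log_rpow Real.pi_pos]
  have hl : Real.log ((n : ℝ) / 2) = Real.log n - Real.log 2 :=
    Real.log_div (by linarith) two_ne_zero
  simp only [Function.comp]
  rw [hk, hl]
  have : (n : ℝ) - 1 ≠ 0 := by linarith
  field_simp
  ring

end PoissonPolyhedra

/-! ## The isoperimetric ratio of the zero cell, in closed form -/

namespace PoissonPolyhedra

/-- The isoperimetric ratio of the zero cell in `ℝⁿ` with distance exponent `r`. -/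
noncomputable def zeroCellRatio (n : ℕ) (r : ℝ) : ℝ :=
  (n * kappa n / 2 * Real.Gamma (((n : ℝ) - 1) / r + 1) *
    (Real.Gamma (r / 2) * Real.Gamma ((n + r) / 2) /
      (Real.Gamma ((r + 1) / 2) * Real.Gamma ((n + r - 1) / 2)))) ^ ((n : ℝ) / ((n : ℝ) - 1)) /
    (kappa n * Real.Gamma (n / r + 1))

/-- The logarithm of the expected growth rate in a fixed direction, in the Gamma form of
`sphereMoment_sub_one_div`. The grouping separates the pair that depends on r alone from the pair
that also sees the dimension. -/
noncomputable def logMeanSlope (n : ℕ) (r : ℝ) : ℝ :=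
  (Real.log (Real.Gamma (r / 2)) - Real.log (Real.Gamma ((r + 1) / 2))) +
    (Real.log (Real.Gamma ((n + r) / 2)) - Real.log (Real.Gamma ((n + r - 1) / 2)))

/-- The three summands have different asymptotics and are treated separately: the contribution of
the ball, that of the expected growth rate, and that of the Weibull moments of orders n - 1 and n.
-/
lemma log_zeroCellRatio {n : ℕ} (hn : 2 ≤ n) {r : ℝ} (hr : 0 < r) :
    0 < zeroCellRatio n r ∧ Real.log (zeroCellRatio n r) =
    ((n : ℝ) / ((n : ℝ) - 1) * (Real.log n - Real.log 2 + Real.log (kappa n)) -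
        Real.log (kappa n)) + (n : ℝ) / ((n : ℝ) - 1) * logMeanSlope n r +
      ((n : ℝ) / ((n : ℝ) - 1) * Real.log (Real.Gamma (((n : ℝ) - 1) / r + 1)) -
        Real.log (Real.Gamma (n / r + 1))) := by
  have hn' : (2 : ℝ) ≤ n := by exact_mod_cast hn
  have hk : 0 < kappa n := kappa_pos (by positivity)
  have g1 : 0 < Real.Gamma (((n : ℝ) - 1) / r + 1) := Real.Gamma_pos_of_pos
    (by have : 0 < ((n : ℝ) - 1) / r := div_pos (by linarith) hr
        linarith)
  have g2 : 0 < Real.Gamma (r / 2) := Real.Gamma_pos_of_pos (by positivity)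
  have g3 : 0 < Real.Gamma ((n + r) / 2) := Real.Gamma_pos_of_pos (by positivity)
  have g4 : 0 < Real.Gamma ((r + 1) / 2) := Real.Gamma_pos_of_pos (by positivity)
  have g5 : 0 < Real.Gamma ((n + r - 1) / 2) := Real.Gamma_pos_of_pos (by linarith)
  have g6 : 0 < Real.Gamma (n / r + 1) := Real.Gamma_pos_of_pos (by positivity)
  have hb : 0 < n * kappa n / 2 * Real.Gamma (((n : ℝ) - 1) / r + 1) *
    (Real.Gamma (r / 2) * Real.Gamma ((n + r) / 2) /
      (Real.Gamma ((r + 1) / 2) * Real.Gamma ((n + r - 1) / 2))) := by positivity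
  refine ⟨div_pos (Real.rpow_pos_of_pos hb _) (by positivity), ?_⟩
  rw [zeroCellRatio, Real.log_div (Real.rpow_pos_of_pos hb _).ne' (by positivity),
    Real.log_rpow hb, Real.log_mul (by positivity) (by positivity),
    Real.log_mul (by positivity) (by positivity), Real.log_div (by positivity) (by positivity),
    Real.log_mul (by positivity) (by positivity), Real.log_div (by positivity) (by positivity),
    Real.log_mul (by positivity) (by positivity), Real.log_mul (by positivity) (by positivity),
    Real.log_mul (by positivity) (by positivity), logMeanSlope]
  ring

lemma log_gamma_ratio_of_mul {b : ℝ} (hb : 0 < b) (α : ℝ) {n : ℕ} (hn : 2 ≤ n) :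
    Real.log (b * (n : ℝ) ^ α) = Real.log b + α * Real.log n := by
  have hn' : (0 : ℝ) < n := by positivity
  rw [Real.log_mul hb.ne' (by positivity), Real.log_rpow hn']

/-- The part of `logMeanSlope` that depends on the dimension. -/
lemma tendsto_log_Gamma_half_dim {r : ℕ → ℝ} (hr : ∀ n, 0 ≤ r n) :
    Tendsto (fun n : ℕ => Real.log (Real.Gamma ((n + r n) / 2)) -
      Real.log (Real.Gamma ((n + r n - 1) / 2)) - Real.log ((n + r n) / 2) / 2) atTop (𝓝 0) := by
  have hy : Tendsto (fun n : ℕ => (n + r n - 1) / 2) atTop atTop := by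
    refine Tendsto.atTop_div_const two_pos ?_
    refine tendsto_atTop_mono (fun n => ?_)
      (tendsto_atTop_add_const_right _ (-1 : ℝ) tendsto_natCast_atTop_atTop)
    linarith [hr n]
  have h1 := tendsto_log_Gamma_add_half_sub.comp hy
  have h2 : Tendsto (fun n : ℕ => Real.log (1 + (1 / 2) / ((n + r n - 1) / 2)) / 2)
      atTop (𝓝 0) := by
    have h3 : Tendsto (fun n : ℕ => 1 + (1 / 2) / ((n + r n - 1) / 2)) atTop (𝓝 1) := by
      simpa using ((tendsto_const_nhds (x := (1 : ℝ) / 2)).div_atTop hy).const_add 1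
    simpa using ((Real.continuousAt_log one_ne_zero).tendsto.comp h3).div_const 2
  have := h1.sub h2
  rw [sub_zero] at this
  refine this.congr' ?_
  filter_upwards [hy.eventually_gt_atTop 0] with n hn
  have e : Real.log ((n + r n) / 2) = Real.log ((n + r n - 1) / 2) +
      Real.log (1 + (1 / 2) / ((n + r n - 1) / 2)) := by
    rw [← Real.log_mul hn.ne' (by positivity), mul_one_add, mul_div_cancel₀ _ hn.ne']
    congr 1; ring
  simp only [Function.comp]
  rw [show (n + r n - 1) / 2 + 1 / 2 = (n + r n) / 2 by ring, e]
  ring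

lemma tendsto_log_one_add {f : ℕ → ℝ} (hf : Tendsto f atTop (𝓝 0)) :
    Tendsto (fun n => Real.log (1 + f n)) atTop (𝓝 0) := by
  have h3 : Tendsto (fun n : ℕ => 1 + f n) atTop (𝓝 1) := by
    simpa using hf.const_add 1
  simpa [Function.comp_def] using (Real.continuousAt_log one_ne_zero).tendsto.comp h3

lemma continuousAt_Gamma_of_pos {x : ℝ} (hx : 0 < x) : ContinuousAt Real.Gamma x :=
  (Real.differentiableAt_Gamma fun m h => by
    have : (0 : ℝ) ≤ m := m.cast_nonneg
    linarith).continuousAt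

lemma tendsto_natCast_rpow_neg {a : ℝ} (ha : a < 0) :
    Tendsto (fun n : ℕ => (n : ℝ) ^ a) atTop (𝓝 0) := by
  have := (tendsto_rpow_neg_atTop (neg_pos.2 ha)).comp (tendsto_natCast_atTop_atTop (R := ℝ))
  simpa [Function.comp_def] using this

lemma tendsto_natCast_rpow_pos {a : ℝ} (ha : 0 < a) :
    Tendsto (fun n : ℕ => (n : ℝ) ^ a) atTop atTop :=
  (tendsto_rpow_atTop ha).comp tendsto_natCast_atTop_atTop

lemma log_half_add {n : ℕ} (hn : 2 ≤ n) {r : ℝ} (hr : 0 ≤ r) :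
    Real.log ((n + r) / 2) = Real.log n - Real.log 2 + Real.log (1 + r / n) := by
  have hn' : (0 : ℝ) < n := by positivity
  rw [← Real.log_div hn'.ne' two_ne_zero, ← Real.log_mul (by positivity) (by positivity)]
  congr 1
  field_simp

/-- `logMeanSlope` for a distance exponent with `r / n → 0`. -/
lemma tendsto_logMeanSlope_of_small {r : ℕ → ℝ} (hr : ∀ n, 0 ≤ r n)
    (h : Tendsto (fun n => r n / n) atTop (𝓝 0)) {q : ℕ → ℝ}
    (hq : Tendsto (fun n => Real.log (Real.Gamma (r n / 2)) -
      Real.log (Real.Gamma ((r n + 1) / 2)) - q n) atTop (𝓝 0)) :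
    Tendsto (fun n => logMeanSlope n (r n) - ((Real.log n - Real.log 2) / 2 + q n))
      atTop (𝓝 0) := by
  have := (hq.add (tendsto_log_Gamma_half_dim hr)).add ((tendsto_log_one_add h).div_const 2)
  simp only [add_zero, zero_div] at this
  refine this.congr' ?_
  filter_upwards [eventually_ge_atTop 2] with n hn
  rw [log_half_add hn (hr n), logMeanSlope]
  ring

lemma tendsto_rpow_mul_div {b : ℝ} {α : ℝ} (hα : α < 1) :
    Tendsto (fun n : ℕ => b * (n : ℝ) ^ α / n) atTop (𝓝 0) := by
  have := (tendsto_natCast_rpow_neg (a := α - 1) (by linarith)).const_mul b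
  rw [mul_zero] at this
  refine this.congr' ?_
  filter_upwards [eventually_ge_atTop 1] with n hn
  have hn' : (0 : ℝ) < n := by positivity
  rw [Real.rpow_sub_one hn'.ne', mul_div_assoc]

/-- Here r → 0, so Γ(r/2) = Γ(r/2 + 1)/(r/2) behaves like 2/r, while Γ((r+1)/2) → √π. -/
lemma tendsto_logMeanSlope_neg {b : ℝ} (hb : 0 < b) {α : ℝ} (hα : α < 0) :
    Tendsto (fun n : ℕ => logMeanSlope n (b * (n : ℝ) ^ α) - ((Real.log n - Real.log 2) / 2 +
      (Real.log 2 - (Real.log b + α * Real.log n) - Real.log Real.pi / 2))) atTop (𝓝 0) := by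
  refine tendsto_logMeanSlope_of_small (fun n => by positivity)
    (tendsto_rpow_mul_div (by linarith)) ?_
  have hr : Tendsto (fun n : ℕ => b * (n : ℝ) ^ α) atTop (𝓝 0) := by
    simpa using (tendsto_natCast_rpow_neg hα).const_mul b
  have h1 : Tendsto (fun n : ℕ => Real.log (Real.Gamma (b * (n : ℝ) ^ α / 2 + 1)))
      atTop (𝓝 0) := by
    have hc : ContinuousAt (fun x => Real.log (Real.Gamma x)) 1 :=
      (continuousAt_Gamma_of_pos one_pos).log (by simp)
    have : Tendsto (fun n : ℕ => b * (n : ℝ) ^ α / 2 + 1) atTop (𝓝 1) := by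
      simpa using (hr.div_const 2).add_const 1
    simpa [Function.comp_def] using hc.tendsto.comp this
  have h2 : Tendsto (fun n : ℕ => Real.log (Real.Gamma ((b * (n : ℝ) ^ α + 1) / 2)))
      atTop (𝓝 (Real.log Real.pi / 2)) := by
    have hc : ContinuousAt (fun x => Real.log (Real.Gamma x)) (1 / 2) :=
      (continuousAt_Gamma_of_pos (by norm_num)).log
        (Real.Gamma_pos_of_pos (by norm_num)).ne'
    have : Tendsto (fun n : ℕ => (b * (n : ℝ) ^ α + 1) / 2) atTop (𝓝 (1 / 2)) := by
      simpa using (hr.add_const 1).div_const 2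
    have := hc.tendsto.comp this
    rwa [Real.Gamma_one_half_eq, Real.log_sqrt Real.pi_pos.le] at this
  have := (h1.sub h2).add_const (Real.log Real.pi / 2)
  simp only [zero_sub, neg_add_cancel] at this
  refine this.congr' ?_
  filter_upwards [eventually_ge_atTop 2] with n hn
  have hn' : (0 : ℝ) < n := by positivity
  have hpos : 0 < b * (n : ℝ) ^ α := by positivity
  rw [log_Gamma_add_one (half_pos hpos), Real.log_div hpos.ne' two_ne_zero,
    log_gamma_ratio_of_mul hb α hn]
  ring

lemma tendsto_logMeanSlope_zero {b : ℝ} (hb : 0 < b) :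
    Tendsto (fun n : ℕ => logMeanSlope n (b * (n : ℝ) ^ (0 : ℝ)) -
      ((Real.log n - Real.log 2) / 2 + (Real.log (Real.Gamma (b / 2)) -
      Real.log (Real.Gamma ((b + 1) / 2))))) atTop (𝓝 0) := by
  refine tendsto_logMeanSlope_of_small (fun n => by positivity)
    (tendsto_rpow_mul_div (by linarith)) ?_
  simp

lemma tendsto_log_Gamma_half_exponent {r : ℕ → ℝ} (hr : Tendsto r atTop atTop) :
    Tendsto (fun n => Real.log (Real.Gamma (r n / 2)) -
      Real.log (Real.Gamma ((r n + 1) / 2)) - -(Real.log (r n / 2) / 2)) atTop (𝓝 0) := by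
  have := (tendsto_log_Gamma_add_half_sub.comp (hr.atTop_div_const two_pos)).neg
  rw [neg_zero] at this
  refine this.congr fun n => ?_
  simp only [Function.comp]
  rw [show r n / 2 + 1 / 2 = (r n + 1) / 2 by ring]
  ring

lemma tendsto_logMeanSlope_mid {b : ℝ} (hb : 0 < b) {α : ℝ} (h0 : 0 < α) (h1 : α < 1) :
    Tendsto (fun n : ℕ => logMeanSlope n (b * (n : ℝ) ^ α) - ((Real.log n - Real.log 2) / 2 +
      (-(Real.log (b * (n : ℝ) ^ α / 2) / 2)))) atTop (𝓝 0) :=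
  tendsto_logMeanSlope_of_small (fun n => by positivity) (tendsto_rpow_mul_div (by linarith))
    (tendsto_log_Gamma_half_exponent ((tendsto_natCast_rpow_pos h0).const_mul_atTop hb))

/-- `logMeanSlope` for a distance exponent tending to infinity. -/
lemma tendsto_logMeanSlope_large {r : ℕ → ℝ} (hr : ∀ n, 0 ≤ r n) (hr' : Tendsto r atTop atTop) :
    Tendsto (fun n : ℕ => logMeanSlope n (r n) - Real.log (1 + n / r n) / 2) atTop (𝓝 0) := by
  have := (tendsto_log_Gamma_half_exponent hr').add (tendsto_log_Gamma_half_dim hr)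
  rw [add_zero] at this
  refine this.congr' ?_
  filter_upwards [hr'.eventually_gt_atTop 0] with n hn
  have e : Real.log ((n + r n) / 2) = Real.log (r n / 2) + Real.log (1 + n / r n) := by
    rw [← Real.log_mul (by positivity) (by positivity)]
    congr 1; field_simp; ring
  rw [logMeanSlope, e]
  ring

/-- The quotient of Gamma functions in the isoperimetric ratio if `n / r → ∞`. -/
lemma tendsto_log_Gamma_quotient_large {z : ℕ → ℝ} (hz : Tendsto z atTop atTop)
    (hlog : Tendsto (fun n : ℕ => Real.log (z n) / ((n : ℝ) - 1)) atTop (𝓝 0)) :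
    Tendsto (fun n : ℕ => (n : ℝ) / ((n : ℝ) - 1) *
      Real.log (Real.Gamma (z n * (1 - 1 / n) + 1)) - Real.log (Real.Gamma (z n + 1)) -
      z n * Real.log (1 - 1 / n)) atTop (𝓝 0) := by
  have hS := tendsto_log_Gamma_sub.comp hz
  have h1n : Tendsto (fun n : ℕ => 1 - 1 / (n : ℝ)) atTop (𝓝 1) := by
    simpa using tendsto_one_div_atTop_nhds_zero_nat.const_sub (1 : ℝ)
  have hS' := tendsto_log_Gamma_sub.comp (hz.atTop_mul_pos one_pos h1n)
  have hlog1 : Tendsto (fun n : ℕ => Real.log (1 - 1 / (n : ℝ))) atTop (𝓝 0) := by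
    simpa [Function.comp_def] using (Real.continuousAt_log one_ne_zero).tendsto.comp h1n
  -- Since n/(n-1) · z(1 - 1/n) = z, the leading Stirling terms combine to z log(1 - 1/n). The exact
  -- surplus is log z / (2(n-1)) plus n/(n-1) · log(1 - 1/n)/2, and both tend to 0.
  have h := (((tendsto_natCast_div_sub_one.mul hS').sub hS).add (hlog.div_const 2)).add
    ((tendsto_natCast_div_sub_one.mul hlog1).div_const 2)
  simp only [one_mul, sub_self, zero_add, zero_div, mul_zero] at h
  refine h.congr' ?_
  filter_upwards [eventually_ge_atTop 2, hz.eventually_gt_atTop 0] with n hn hzn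
  have hn' : (2 : ℝ) ≤ n := by exact_mod_cast hn
  have hpos : 0 < 1 - 1 / (n : ℝ) := by
    rw [sub_pos, div_lt_one (by linarith)]; linarith
  have h1 : (n : ℝ) - 1 ≠ 0 := by linarith
  have h2 : (n : ℝ) ≠ 0 := by linarith
  simp only [Function.comp]
  rw [Real.log_mul hzn.ne' hpos.ne']
  generalize Real.log (1 - 1 / (n : ℝ)) = L
  field_simp
  ring

/-- No Stirling is needed: both arguments tend to l + 1, where log Γ is continuous, and the
prefactor tends to 1. -/
lemma tendsto_log_Gamma_quotient_bounded {z : ℕ → ℝ} {l : ℝ} (hl : 0 ≤ l)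
    (hz : Tendsto z atTop (𝓝 l)) :
    Tendsto (fun n : ℕ => (n : ℝ) / ((n : ℝ) - 1) *
      Real.log (Real.Gamma (z n * (1 - 1 / n) + 1)) - Real.log (Real.Gamma (z n + 1)))
      atTop (𝓝 0) := by
  have hc : ContinuousAt (fun x => Real.log (Real.Gamma x)) (l + 1) :=
    (continuousAt_Gamma_of_pos (by linarith)).log
      (Real.Gamma_pos_of_pos (by linarith)).ne'
  have h1n : Tendsto (fun n : ℕ => 1 - 1 / (n : ℝ)) atTop (𝓝 1) := by
    simpa using tendsto_one_div_atTop_nhds_zero_nat.const_sub (1 : ℝ)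
  have h1 : Tendsto (fun n : ℕ => z n * (1 - 1 / n) + 1) atTop (𝓝 (l + 1)) := by
    simpa using (hz.mul h1n).add_const 1
  have := (tendsto_natCast_div_sub_one.mul (hc.tendsto.comp h1)).sub
    (hc.tendsto.comp (hz.add_const 1))
  simpa [Function.comp_def] using this

end PoissonPolyhedra

/-! ## Asymptotics of the isoperimetric ratio -/

namespace PoissonPolyhedra

lemma natCast_div_mul_rpow {b : ℝ} (α : ℝ) {n : ℕ} (hn : 0 < n) :
    (n : ℝ) / (b * (n : ℝ) ^ α) = (n : ℝ) ^ (1 - α) / b := by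
  have hn' : (0 : ℝ) < n := by positivity
  rw [Real.rpow_sub hn', Real.rpow_one, div_div, mul_comm b]

/-- Assembly of the asymptotics of the isoperimetric ratio from those of its three factors. -/
lemma tendsto_mul_zeroCellRatio {b : ℝ} (hb : 0 < b) {α : ℝ} {e g φ : ℕ → ℝ}
    (he : Tendsto (fun n : ℕ => logMeanSlope n (b * (n : ℝ) ^ α) - e n) atTop (𝓝 0))
    (he' : Tendsto (fun n : ℕ => e n / ((n : ℝ) - 1)) atTop (𝓝 0))
    (hg : Tendsto (fun n : ℕ => (n : ℝ) / ((n : ℝ) - 1) *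
      Real.log (Real.Gamma (n / (b * (n : ℝ) ^ α) * (1 - 1 / n) + 1)) -
      Real.log (Real.Gamma (n / (b * (n : ℝ) ^ α) + 1)) - g n) atTop (𝓝 0))
    (hφ0 : ∀ᶠ n in atTop, 0 < φ n)
    (hφ : Tendsto (fun n : ℕ => Real.log (φ n) +
      (Real.log n + Real.log Real.pi - Real.log 2 + 1) / 2 + e n + g n) atTop (𝓝 0)) :
    Tendsto (fun n : ℕ => φ n * zeroCellRatio n (b * (n : ℝ) ^ α)) atTop (𝓝 1) := by
  have h := (((tendsto_log_ball_ratio.add ((tendsto_natCast_div_sub_one.mul he).add he')).add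
    hg).add hφ).rexp
  simp only [mul_zero, add_zero, Real.exp_zero] at h
  refine h.congr' ?_
  filter_upwards [eventually_ge_atTop 2, hφ0] with n hn hpos
  have hn' : (2 : ℝ) ≤ n := by exact_mod_cast hn
  obtain ⟨hI, hlog⟩ := log_zeroCellRatio hn (show 0 < b * (n : ℝ) ^ α by positivity)
  rw [← Real.exp_log (mul_pos hpos hI), Real.log_mul hpos.ne' hI.ne', hlog]
  have h1 : (n : ℝ) - 1 ≠ 0 := by linarith
  have e1 : n / (b * (n : ℝ) ^ α) * (1 - 1 / n) = ((n : ℝ) - 1) / (b * (n : ℝ) ^ α) := by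
    have : (n : ℝ) ≠ 0 := by linarith
    field_simp
  -- Replacing the prefactor n/(n-1) of the approximation e by 1 costs e/(n-1); this is the purpose
  -- of `he'`.
  have e2 : (n : ℝ) / ((n : ℝ) - 1) * (logMeanSlope n (b * (n : ℝ) ^ α) - e n) +
      e n / ((n : ℝ) - 1) = (n : ℝ) / ((n : ℝ) - 1) * logMeanSlope n (b * (n : ℝ) ^ α) - e n := by
    field_simp; ring
  rw [e1, e2]
  congr 1
  ring

lemma tendsto_const_add_log_div (c d : ℝ) :
    Tendsto (fun n : ℕ => (c + d * Real.log n) / ((n : ℝ) - 1)) atTop (𝓝 0) := by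
  have := (tendsto_inv_natCast_sub_one.const_mul c).add
    (tendsto_log_div_natCast_sub_one.const_mul d)
  rw [mul_zero, mul_zero, add_zero] at this
  exact this.congr fun n => by ring

lemma tendsto_natCast_div_rpow_atTop {b : ℝ} (hb : 0 < b) {α : ℝ} (hα : α < 1) :
    Tendsto (fun n : ℕ => (n : ℝ) / (b * (n : ℝ) ^ α)) atTop atTop := by
  refine ((tendsto_natCast_rpow_pos (show 0 < 1 - α by linarith)).atTop_div_const hb).congr' ?_
  filter_upwards [eventually_gt_atTop 0] with n hn
  rw [natCast_div_mul_rpow α hn]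

lemma tendsto_log_Gamma_quotient_lt_one {b : ℝ} (hb : 0 < b) {α : ℝ} (hα : α < 1) :
    Tendsto (fun n : ℕ => (n : ℝ) / ((n : ℝ) - 1) *
      Real.log (Real.Gamma (n / (b * (n : ℝ) ^ α) * (1 - 1 / n) + 1)) -
      Real.log (Real.Gamma (n / (b * (n : ℝ) ^ α) + 1)) -
      n / (b * (n : ℝ) ^ α) * Real.log (1 - 1 / n)) atTop (𝓝 0) := by
  refine tendsto_log_Gamma_quotient_large (tendsto_natCast_div_rpow_atTop hb hα) ?_
  refine (tendsto_const_add_log_div (-Real.log b) (1 - α)).congr' ?_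
  filter_upwards [eventually_ge_atTop 2] with n hn
  have hn' : (0 : ℝ) < n := by positivity
  rw [Real.log_div hn'.ne' (by positivity), log_gamma_ratio_of_mul hb α hn]
  ring

lemma log_gauge_neg {b : ℝ} (hb : 0 < b) {α : ℝ} (hα : α < 0) {n : ℕ} (hn : 2 ≤ n) :
    0 < gauge b α n ∧ Real.log (gauge b α n) = Real.log b - 1 / 2 + (α - 1) * Real.log n -
      n / (b * (n : ℝ) ^ α) * Real.log (1 - 1 / n) := by
  have hn' : (2 : ℝ) ≤ n := by exact_mod_cast hn
  have hpos : 0 < 1 - 1 / (n : ℝ) := by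
    rw [sub_pos, div_lt_one (by linarith)]; linarith
  rw [gauge, if_pos hα]
  refine ⟨by positivity, ?_⟩
  rw [Real.log_mul (by positivity) (Real.rpow_pos_of_pos hpos _).ne',
    Real.log_mul (by positivity) (by positivity), Real.log_div hb.ne' (by positivity),
    Real.log_sqrt (Real.exp_pos 1).le, Real.log_exp, Real.log_rpow hpos,
    Real.log_rpow (by linarith), natCast_div_mul_rpow α (by omega)]
  ring

lemma tendsto_mul_log_one_sub : Tendsto (fun n : ℕ => (n : ℝ) * Real.log (1 - 1 / n))
    atTop (𝓝 (-1)) := by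
  have := (Real.tendsto_mul_log_one_add_div_atTop (-1)).comp
    (tendsto_natCast_atTop_atTop (R := ℝ))
  refine this.congr fun n => ?_
  simp only [Function.comp]
  rw [neg_div, ← sub_eq_add_neg]

lemma log_two_mul_sqrt_div {x y : ℝ} (hx : 0 < x) (hy : 0 < y) :
    Real.log (2 * √(x / y)) = Real.log 2 + (Real.log x - Real.log y) / 2 := by
  rw [Real.log_mul two_ne_zero (by positivity), Real.log_sqrt (by positivity),
    Real.log_div hx.ne' hy.ne']

/-- The value is exactly the negative of the main term in `tendsto_log_ball_ratio`. -/
lemma log_ballGauge {n : ℕ} (hn : 0 < n) : 0 < ballGauge n ∧ Real.log (ballGauge n) =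
    -((Real.log n + Real.log Real.pi - Real.log 2 + 1) / 2) := by
  have hn' : (0 : ℝ) < n := by positivity
  rw [ballGauge]
  refine ⟨by positivity, ?_⟩
  rw [Real.log_mul (by positivity) (by positivity), Real.log_div (by positivity) (by positivity),
    Real.log_sqrt (by positivity), Real.log_mul (by positivity) (by positivity),
    Real.log_mul (by positivity) (by positivity), Real.log_exp, Real.log_rpow hn']
  ring

lemma gauge_eq_ballGauge (b : ℝ) {α : ℝ} (hα : 1 < α) : gauge b α = ballGauge := by
  funext n
  rw [gauge, ballGauge, if_neg (by linarith), if_neg (by linarith), if_neg (by linarith),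
    if_neg (by linarith)]

theorem tendsto_gauge_mul_zeroCellRatio {b : ℝ} (hb : 0 < b) (α : ℝ) :
    Tendsto (fun n : ℕ => gauge b α n * zeroCellRatio n (b * (n : ℝ) ^ α)) atTop (𝓝 1) := by
  have hlog1 : Tendsto (fun n : ℕ => Real.log (1 - 1 / (n : ℝ))) atTop (𝓝 0) := by
    have := tendsto_log_one_add (f := fun n => -(1 / (n : ℝ)))
      (by simpa using (tendsto_one_div_atTop_nhds_zero_nat (𝕜 := ℝ)).neg)
    simpa [sub_eq_add_neg] using this
  rcases lt_trichotomy α 0 with hα | rfl | hα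
  · refine tendsto_mul_zeroCellRatio hb (tendsto_logMeanSlope_neg hb hα) ?_
      (tendsto_log_Gamma_quotient_lt_one hb (by linarith)) ?_ ?_
    · refine (tendsto_const_add_log_div (Real.log 2 / 2 - Real.log b - Real.log Real.pi / 2)
        (1 / 2 - α)).congr fun n => ?_
      ring
    · filter_upwards [eventually_ge_atTop 2] with n hn using (log_gauge_neg hb hα hn).1
    -- The sum of logarithms vanishes identically, because the gauge function keeps the factor (1 -
    -- 1/n)^(-n/r) unexpanded. Its logarithm is asymptotic to n^(-α)/b and hence unbounded.
    · refine tendsto_const_nhds.congr' ?_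
      filter_upwards [eventually_ge_atTop 2] with n hn
      rw [(log_gauge_neg hb hα hn).2]
      ring
  · have g1 : 0 < Real.Gamma (b / 2) := Real.Gamma_pos_of_pos (by positivity)
    have g2 : 0 < Real.Gamma ((b + 1) / 2) := Real.Gamma_pos_of_pos (by positivity)
    have hg : ∀ n : ℕ, 2 ≤ n → 0 < gauge b 0 n ∧ Real.log (gauge b 0 n) =
        Real.log 2 + (1 / b - 1 / 2) + (Real.log (Real.Gamma ((b + 1) / 2)) -
          Real.log (Real.Gamma (b / 2)) - Real.log Real.pi / 2) - Real.log n := by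
      intro n hn
      have hn' : (0 : ℝ) < n := by positivity
      rw [gauge, if_neg (lt_irrefl _), if_pos rfl, omega, omega]
      refine ⟨by positivity, ?_⟩
      rw [Real.log_mul (by positivity) (by positivity),
        Real.log_mul (by positivity) (by positivity),
        Real.log_mul (by positivity) (by positivity), Real.log_exp,
        Real.log_div (by positivity) (by positivity), Real.log_div (by positivity) g1.ne',
        Real.log_div (by positivity) g2.ne', Real.log_mul two_ne_zero (by positivity),
        Real.log_mul two_ne_zero (by positivity), Real.log_rpow Real.pi_pos,
        Real.log_rpow Real.pi_pos, Real.log_inv]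
      ring
    refine tendsto_mul_zeroCellRatio hb (tendsto_logMeanSlope_zero hb) ?_
      (tendsto_log_Gamma_quotient_lt_one hb (by linarith)) ?_ ?_
    · refine (tendsto_const_add_log_div (-Real.log 2 / 2 + (Real.log (Real.Gamma (b / 2)) -
        Real.log (Real.Gamma ((b + 1) / 2)))) (1 / 2)).congr fun n => ?_
      ring
    · filter_upwards [eventually_ge_atTop 2] with n hn using (hg n hn).1
    -- Now (n/b) log(1 - 1/n) → -1/b, which accounts for the constant e^(1/b) in the gauge function.
    · have := (tendsto_mul_log_one_sub.div_const b).const_add (1 / b)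
      rw [show 1 / b + -1 / b = 0 by ring] at this
      refine this.congr' ?_
      filter_upwards [eventually_ge_atTop 2] with n hn
      rw [(hg n hn).2, Real.rpow_zero]
      ring
  rcases lt_trichotomy α 1 with h1 | rfl | h1
  · have hg : ∀ n : ℕ, 2 ≤ n → 0 < gauge b α n ∧ Real.log (gauge b α n) =
        Real.log 2 + (Real.log b - (Real.log 2 + Real.log Real.pi + 1)) / 2 -
          (1 - α / 2) * Real.log n := by
      intro n hn
      have hn' : (0 : ℝ) < n := by positivity
      rw [gauge, if_neg hα.le.not_gt, if_neg hα.ne', if_pos h1]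
      refine ⟨by positivity, ?_⟩
      rw [Real.log_mul (by positivity) (by positivity), log_two_mul_sqrt_div hb (by positivity),
        Real.log_mul (by positivity) (by positivity),
        Real.log_mul (by positivity) (by positivity), Real.log_exp, Real.log_rpow hn']
      ring
    refine tendsto_mul_zeroCellRatio hb (tendsto_logMeanSlope_mid hb hα h1) ?_
      (tendsto_log_Gamma_quotient_lt_one hb h1) ?_ ?_
    · refine (tendsto_const_add_log_div (-Real.log b / 2) ((1 - α) / 2)).congr' ?_
      filter_upwards [eventually_ge_atTop 2] with n hn
      rw [Real.log_div (by positivity) two_ne_zero, log_gamma_ratio_of_mul hb α hn]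
      ring
    · filter_upwards [eventually_ge_atTop 2] with n hn using (hg n hn).1
    -- The Gamma comparison is n log(1 - 1/n) · n^(-α) / b, which tends to 0 because α > 0.
    · have := (tendsto_mul_log_one_sub.mul (tendsto_natCast_rpow_neg
        (show -α < 0 by linarith))).div_const b
      rw [mul_zero, zero_div] at this
      refine this.congr' ?_
      filter_upwards [eventually_ge_atTop 2] with n hn
      have hn' : (0 : ℝ) < n := by positivity
      rw [(hg n hn).2, Real.log_div (by positivity) two_ne_zero, log_gamma_ratio_of_mul hb α hn,
        Real.rpow_neg hn'.le]
      field_simp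
      ring
  · have hz : ∀ᶠ n : ℕ in atTop, (n : ℝ) / (b * (n : ℝ) ^ (1 : ℝ)) = 1 / b := by
      filter_upwards [eventually_ge_atTop 2] with n hn
      have hn' : (0 : ℝ) < n := by positivity
      rw [Real.rpow_one]
      field_simp
    have hz' : Tendsto (fun n : ℕ => (n : ℝ) / (b * (n : ℝ) ^ (1 : ℝ))) atTop (𝓝 (1 / b)) :=
      tendsto_const_nhds.congr' (by filter_upwards [hz] with n hn using hn.symm)
    -- For α = 1 the ratio n/r is the constant 1/b, so the mean slope contributes √((b+1)/b) and the
    -- Gamma comparison nothing.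
    have hL : Tendsto (fun n : ℕ => Real.log (1 + (n : ℝ) / (b * (n : ℝ) ^ (1 : ℝ))) / 2) atTop
        (𝓝 (Real.log (1 + 1 / b) / 2)) :=
      ((Real.continuousAt_log (by positivity)).tendsto.comp (hz'.const_add 1)).div_const 2
    have hg : ∀ n : ℕ, 2 ≤ n → 0 < gauge b 1 n ∧ Real.log (gauge b 1 n) =
        -((Real.log n + Real.log Real.pi - Real.log 2 + 1) / 2) -
          Real.log (1 + 1 / b) / 2 := by
      intro n hn
      have hn' : (0 : ℝ) < n := by positivity
      have e : Real.log (1 + 1 / b) = Real.log (b + 1) - Real.log b := by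
        rw [← Real.log_div (by positivity) hb.ne']; congr 1; field_simp
      rw [gauge, if_neg (by norm_num), if_neg (by norm_num), if_neg (by norm_num), if_pos rfl]
      refine ⟨by positivity, ?_⟩
      rw [Real.log_mul (by positivity) (by positivity), log_two_mul_sqrt_div hb (by positivity),
        Real.log_mul (by positivity) (by positivity),
        Real.log_mul (by positivity) (by positivity),
        Real.log_mul (by positivity) (by positivity), Real.log_exp, Real.log_rpow hn', e]
      ring
    refine tendsto_mul_zeroCellRatio (g := fun _ => 0) hb
      (tendsto_logMeanSlope_large (fun n => by positivity)
      ((tendsto_natCast_rpow_pos one_pos).const_mul_atTop hb)) ?_ ?_ ?_ ?_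
    · have := hL.mul tendsto_inv_natCast_sub_one
      rw [mul_zero] at this
      exact this.congr fun n => by ring
    · simpa using tendsto_log_Gamma_quotient_bounded (by positivity) hz'
    · filter_upwards [eventually_ge_atTop 2] with n hn using (hg n hn).1
    · refine tendsto_const_nhds.congr' ?_
      filter_upwards [eventually_ge_atTop 2, hz] with n hn hzn
      rw [(hg n hn).2, hzn]
      ring
  · have hz : Tendsto (fun n : ℕ => (n : ℝ) / (b * (n : ℝ) ^ α)) atTop (𝓝 0) := by
      have := (tendsto_natCast_rpow_neg (show 1 - α < 0 by linarith)).div_const b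
      rw [zero_div] at this
      refine this.congr' ?_
      filter_upwards [eventually_gt_atTop 0] with n hn
      rw [natCast_div_mul_rpow α hn]
    -- For α > 1 the mean slope tends to 1, as for a ball centred at the origin; only the term of
    -- the ball survives.
    have hL : Tendsto (fun n : ℕ => Real.log (1 + (n : ℝ) / (b * (n : ℝ) ^ α)) / 2) atTop
        (𝓝 0) := by
      simpa using (tendsto_log_one_add hz).div_const 2
    rw [gauge_eq_ballGauge b h1]
    refine tendsto_mul_zeroCellRatio (g := fun _ => 0) hb
      (tendsto_logMeanSlope_large (fun n => by positivity)
      ((tendsto_natCast_rpow_pos hα).const_mul_atTop hb)) ?_ ?_ ?_ ?_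
    · have := hL.mul tendsto_inv_natCast_sub_one
      rw [mul_zero] at this
      exact this.congr fun n => by ring
    · simpa using tendsto_log_Gamma_quotient_bounded le_rfl hz
    · filter_upwards [eventually_ge_atTop 2] with n hn using (log_ballGauge (by omega)).1
    · refine hL.congr' ?_
      filter_upwards [eventually_ge_atTop 2] with n hn
      rw [(log_ballGauge (by omega)).2]
      ring

theorem tendsto_ballGauge_mul : Tendsto (fun n : ℕ => ballGauge n *
    ((n * kappa n / 2) ^ ((n : ℝ) / ((n : ℝ) - 1)) / kappa n)) atTop (𝓝 1) := by
  have h := tendsto_log_ball_ratio.rexp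
  rw [Real.exp_zero] at h
  refine h.congr' ?_
  filter_upwards [eventually_ge_atTop 2] with n hn
  have hn' : (0 : ℝ) < n := by positivity
  have hk : 0 < kappa n := kappa_pos (by positivity)
  obtain ⟨hp, hl⟩ := log_ballGauge (show 0 < n by omega)
  have hp2 : 0 < (n * kappa n / 2) ^ ((n : ℝ) / ((n : ℝ) - 1)) / kappa n :=
    div_pos (Real.rpow_pos_of_pos (by positivity) _) hk
  rw [← Real.exp_log (mul_pos hp hp2), Real.log_mul hp.ne' hp2.ne', hl,
    Real.log_div (Real.rpow_pos_of_pos (by positivity) _).ne' hk.ne',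
    Real.log_rpow (by positivity), Real.log_div (by positivity) two_ne_zero,
    Real.log_mul hn'.ne' hk.ne']
  congr 1
  ring

/-! ### Limits of the gauge function -/

/-- From log(1 - 1/n) ≤ -1/n the logarithm of the gauge function is at least a constant plus (α - 1)
log n + n^(-α)/b, and the positive power beats the logarithm. -/
theorem tendsto_gauge_atTop {b : ℝ} (hb : 0 < b) {α : ℝ} (hα : α < 0) :
    Tendsto (gauge b α) atTop atTop := by
  have h1 : Tendsto (fun n : ℕ => Real.log b - 1 / 2 + (α - 1) * Real.log n +
      (n : ℝ) ^ (-α) / b) atTop atTop := by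
    have h0 : Tendsto (fun n : ℕ => (α - 1) * (Real.log n / (n : ℝ) ^ (-α)) + 1 / b) atTop
        (𝓝 (1 / b)) := by
      have := ((isLittleO_log_rpow_atTop (neg_pos.2 hα)).tendsto_div_nhds_zero.comp
        (tendsto_natCast_atTop_atTop (R := ℝ))).const_mul (α - 1)
      simpa [Function.comp_def] using this.add_const (1 / b)
    refine (tendsto_atTop_add_const_left _ (Real.log b - 1 / 2)
      (h0.pos_mul_atTop (by positivity)
        (tendsto_natCast_rpow_pos (neg_pos.2 hα)))).congr' ?_
    filter_upwards [eventually_ge_atTop 2] with n hn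
    have hn' : (0 : ℝ) < n := by positivity
    have : (0 : ℝ) < (n : ℝ) ^ (-α) := by positivity
    field_simp
    ring
  refine tendsto_atTop_mono' _ ?_ (Real.tendsto_exp_atTop.comp h1)
  filter_upwards [eventually_ge_atTop 2] with n hn
  have hn' : (2 : ℝ) ≤ n := by exact_mod_cast hn
  obtain ⟨hp, hl⟩ := log_gauge_neg hb hα hn
  rw [← Real.exp_log hp, hl, Function.comp, Real.exp_le_exp]
  have h2 : Real.log (1 - 1 / (n : ℝ)) ≤ -(1 / n) := by
    have := Real.log_le_sub_one_of_pos (show 0 < 1 - 1 / (n : ℝ) by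
      rw [sub_pos, div_lt_one (by linarith)]; linarith)
    linarith
  have h3 : (n : ℝ) / (b * (n : ℝ) ^ α) * Real.log (1 - 1 / n) ≤
      (n : ℝ) / (b * (n : ℝ) ^ α) * -(1 / n) :=
    mul_le_mul_of_nonneg_left h2 (by positivity)
  have h4 : (n : ℝ) / (b * (n : ℝ) ^ α) * -(1 / n) = -((n : ℝ) ^ (-α) / b) := by
    rw [Real.rpow_neg (by linarith)]; field_simp
  linarith

theorem tendsto_gauge_zero (b : ℝ) {α : ℝ} (hα : 0 ≤ α) :
    Tendsto (gauge b α) atTop (𝓝 0) := by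
  have key : ∀ c p : ℝ, p < 0 → Tendsto (fun n : ℕ => c * (n : ℝ) ^ p) atTop (𝓝 0) := by
    intro c p hp
    simpa using (tendsto_natCast_rpow_neg hp).const_mul c
  unfold gauge
  rw [funext fun n : ℕ => if_neg hα.not_gt]
  split_ifs with h0 h1 h2
  · simpa [Real.rpow_neg_one] using
      key (2 * Real.exp (1 / b - 1 / 2) * (omega b / omega (b + 1))) (-1) (by norm_num)
  · exact key _ _ (by linarith)
  · exact key _ _ (by norm_num)
  · exact key _ _ (by norm_num)

end PoissonPolyhedra

/-! ## One-sided moments of the surface measure of the sphere -/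

namespace PoissonPolyhedra

/-- Integration in polar coordinates. -/
lemma lintegral_polar {n : ℕ} (hn : 1 ≤ n) {g : Euc n → ENNReal} (hg : Measurable g) :
    ∫⁻ x, g x = ∫⁻ u : Metric.sphere (0 : Euc n) 1, (∫⁻ a in Ioi (0 : ℝ),
      ENNReal.ofReal (a ^ (n - 1)) * g (a • (u : Euc n))) ∂(volume : Measure (Euc n)).toSphere := by
  have : Nontrivial (Euc n) := by
    have : Nonempty (Fin n) := ⟨⟨0, hn⟩⟩
    infer_instance
  have hmp := (volume : Measure (Euc n)).measurePreserving_homeomorphUnitSphereProd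
  have h1 : ∫⁻ x, g x =
      ∫⁻ x : ({0}ᶜ : Set (Euc n)), g x ∂((volume : Measure (Euc n)).comap Subtype.val) := by
    rw [lintegral_subtype_comap (measurableSet_singleton _).compl, restrict_compl_singleton]
  have hm : Measurable fun p : Metric.sphere (0 : Euc n) 1 × Ioi (0 : ℝ) =>
      g ((p.2 : ℝ) • (p.1 : Euc n)) := hg.comp (by fun_prop)
  have h2 : ∫⁻ x : ({0}ᶜ : Set (Euc n)), g x ∂((volume : Measure (Euc n)).comap Subtype.val) =
      ∫⁻ p : Metric.sphere (0 : Euc n) 1 × Ioi (0 : ℝ), g ((p.2 : ℝ) • (p.1 : Euc n))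
        ∂((volume : Measure (Euc n)).toSphere.prod (.volumeIoiPow (n - 1))) := by
    have e := hmp.lintegral_comp hm
    rw [finrank_euclideanSpace_fin] at e
    rw [← e]
    refine lintegral_congr fun x => ?_
    have hx : ‖(x : Euc n)‖ ≠ 0 := norm_ne_zero_iff.2 x.2
    simp [smul_smul, mul_inv_cancel₀ hx]
  rw [h1, h2, lintegral_prod _ hm.aemeasurable]
  refine lintegral_congr fun u => ?_
  have hd : Measurable fun r : Ioi (0 : ℝ) => ENNReal.ofReal ((r : ℝ) ^ (n - 1)) := by fun_prop
  have hgu : Measurable fun r : Ioi (0 : ℝ) => g ((r : ℝ) • (u : Euc n)) := hg.comp (by fun_prop)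
  rw [Measure.volumeIoiPow, lintegral_withDensity_eq_lintegral_mul _ hd hgu]
  exact lintegral_subtype_comap measurableSet_Ioi
    (fun a : ℝ => ENNReal.ofReal (a ^ (n - 1)) * g (a • (u : Euc n)))

/-- The function `x ↦ x₊ ^ p`, with values in `[0, ∞]`. -/
noncomputable def posRpow (p x : ℝ) : ENNReal :=
  (Ioi (0 : ℝ)).indicator (fun x => ENNReal.ofReal (x ^ p)) x

lemma measurable_posRpow (p : ℝ) : Measurable (posRpow p) :=
  Measurable.indicator (by fun_prop) measurableSet_Ioi

lemma posRpow_of_pos (p : ℝ) {x : ℝ} (hx : 0 < x) : posRpow p x = ENNReal.ofReal (x ^ p) :=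
  indicator_of_mem (mem_Ioi.2 hx) _

lemma posRpow_of_nonpos (p : ℝ) {x : ℝ} (hx : x ≤ 0) : posRpow p x = 0 :=
  indicator_of_notMem (by simpa using hx) _

lemma posRpow_mul (p : ℝ) {a : ℝ} (ha : 0 < a) (x : ℝ) :
    posRpow p (a * x) = ENNReal.ofReal (a ^ p) * posRpow p x := by
  rcases lt_or_ge 0 x with hx | hx
  · rw [posRpow_of_pos p hx, posRpow_of_pos p (mul_pos ha hx),
      ← ENNReal.ofReal_mul (by positivity), Real.mul_rpow ha.le hx.le]
  · rw [posRpow_of_nonpos p hx, posRpow_of_nonpos p (mul_nonpos_of_nonneg_of_nonpos ha.le hx),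
      mul_zero]

/-- The integral of a non-integrable function is 0 by convention, whereas the known value of this
one is positive. -/
lemma integrableOn_rpow_mul_exp_neg_mul_rpow {p q b : ℝ} (hp : 0 < p) (hq : -1 < q) (hb : 0 < b) :
    IntegrableOn (fun x : ℝ => x ^ q * Real.exp (-b * x ^ p)) (Ioi 0) := by
  have h := integral_rpow_mul_exp_neg_mul_rpow hp hq hb
  by_contra hc
  rw [integral_undef hc] at h
  revert h
  have := Real.Gamma_pos_of_pos (show 0 < (q + 1) / p from div_pos (by linarith) hp)
  exact (show 0 < b ^ (-(q + 1) / p) * (1 / p) * Real.Gamma ((q + 1) / p) by positivity).ne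

lemma lintegral_rpow_mul_exp_neg_mul_rpow {p q b : ℝ} (hp : 0 < p) (hq : -1 < q) (hb : 0 < b) :
    ∫⁻ x in Ioi (0 : ℝ), ENNReal.ofReal (x ^ q * Real.exp (-b * x ^ p)) =
      ENNReal.ofReal (b ^ (-(q + 1) / p) * (1 / p) * Real.Gamma ((q + 1) / p)) := by
  rw [← integral_rpow_mul_exp_neg_mul_rpow hp hq hb,
    ofReal_integral_eq_lintegral_ofReal (integrableOn_rpow_mul_exp_neg_mul_rpow hp hq hb)]
  filter_upwards [ae_restrict_mem measurableSet_Ioi] with x hx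
  have : (0 : ℝ) < x := hx
  simp only [Pi.zero_apply]
  positivity

/-- A one-sided moment of a Gaussian integral over `ℝⁿ` in a coordinate direction. -/
lemma lintegral_posRpow_coord_mul_exp {n : ℕ} (i : Fin n) {p : ℝ} (hp : -1 < p) :
    ∫⁻ x : Euc n, posRpow p (x i) * ENNReal.ofReal (Real.exp (-‖x‖ ^ 2)) =
      ENNReal.ofReal (Real.Gamma ((p + 1) / 2) / 2 * Real.pi ^ (((n : ℝ) - 1) / 2)) := by
  -- The Gaussian density factorises over the coordinates, and only the i-th factor carries the
  -- one-sided power.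
  let g : Fin n → ℝ → ℝ := fun j => if j = i then
    (Ioi (0 : ℝ)).indicator (fun t => t ^ p * Real.exp (-1 * t ^ (2 : ℝ)))
    else fun t => Real.exp (-1 * t ^ 2)
  have hgi : ∀ j, Integrable (g j) := by
    intro j
    by_cases h : j = i
    · simp only [g, if_pos h]
      rw [integrable_indicator_iff measurableSet_Ioi]
      exact integrableOn_rpow_mul_exp_neg_mul_rpow two_pos hp one_pos
    · simp only [g, if_neg h]
      exact integrable_exp_neg_mul_sq one_pos
  have hgn : ∀ j t, 0 ≤ g j t := by
    intro j t
    by_cases h : j = i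
    · simp only [g, if_pos h]
      refine indicator_nonneg (fun t ht => ?_) _
      have : (0 : ℝ) < t := ht
      positivity
    · simp only [g, if_neg h]; positivity
  have e1 : ∫⁻ x : Euc n, posRpow p (x i) * ENNReal.ofReal (Real.exp (-‖x‖ ^ 2)) =
      ∫⁻ x : Fin n → ℝ, ENNReal.ofReal (∏ j, g j (x j)) := by
    rw [← (EuclideanSpace.volume_preserving_symm_measurableEquiv_toLp (Fin n)).lintegral_comp_emb
      (MeasurableEquiv.measurableEmbedding _)]
    refine lintegral_congr fun x => ?_
    have hx : Real.exp (-‖x‖ ^ 2) = ∏ j, Real.exp (-1 * (x j) ^ 2) := by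
      rw [← Real.exp_sum, EuclideanSpace.norm_sq_eq]
      simp
    have hr : ∀ j, j ∈ (Finset.univ.erase i) → g j (x j) = Real.exp (-1 * (x j) ^ 2) := by
      intro j hj
      simp only [g, if_neg (Finset.ne_of_mem_erase hj)]
    change _ = ENNReal.ofReal (∏ j, g j (x j))
    rw [hx, ← Finset.mul_prod_erase _ _ (Finset.mem_univ i),
      ← Finset.mul_prod_erase Finset.univ (fun j => g j (x j)) (Finset.mem_univ i),
      Finset.prod_congr rfl hr]
    rcases lt_or_ge 0 (x i) with h | h
    · rw [posRpow_of_pos p h, ← ENNReal.ofReal_mul (by positivity)]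
      simp [g, h, mul_assoc]
    · rw [posRpow_of_nonpos p h]
      simp [g, h.not_gt]
  have hgI : Integrable (fun x : Fin n → ℝ => ∏ j, g j (x j)) := Integrable.fintype_prod hgi
  rw [e1, ← ofReal_integral_eq_lintegral_ofReal hgI
    (Eventually.of_forall fun x => Finset.prod_nonneg fun j _ => hgn j _),
    integral_fintype_prod_volume_eq_prod]
  congr 1
  rw [← Finset.mul_prod_erase _ _ (Finset.mem_univ i)]
  congr 1
  · simp only [g, if_true]
    rw [integral_indicator measurableSet_Ioi, integral_rpow_mul_exp_neg_mul_rpow two_pos hp one_pos]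
    rw [Real.one_rpow]; ring
  · have hr : ∀ j, j ∈ (Finset.univ.erase i) → ∫ t, g j t = √Real.pi := by
      intro j hj
      simp only [g, if_neg (Finset.ne_of_mem_erase hj)]
      rw [integral_gaussian, div_one]
    rw [Finset.prod_congr rfl hr, Finset.prod_const, Finset.card_erase_of_mem (Finset.mem_univ i),
      Finset.card_univ, Fintype.card_fin, Real.sqrt_eq_rpow, ← Real.rpow_natCast,
      ← Real.rpow_mul Real.pi_pos.le, Nat.cast_sub (by have := i.2; omega)]
    congr 1
    push_cast
    ring

lemma exists_orthonormalBasis_apply {n : ℕ} (v : Metric.sphere (0 : Euc n) 1) (i : Fin n) :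
    ∃ b : OrthonormalBasis (Fin n) ℝ (Euc n), b i = v := by
  have ho : Orthonormal ℝ (({i} : Set (Fin n)).domRestrict fun _ => (v : Euc n)) := by
    refine ⟨fun _ => norm_eq_of_mem_sphere v, fun a b hab => ?_⟩
    exact absurd (Subtype.ext (a.2.trans b.2.symm)) hab
  obtain ⟨b, hb⟩ := ho.exists_orthonormalBasis_extension_of_card_eq (by simp)
  exact ⟨b, hb i rfl⟩

/-- Rotation invariance: an orthonormal basis containing v turns the inner product into a
coordinate. -/
lemma lintegral_posRpow_inner_mul_exp {n : ℕ} (hn : 1 ≤ n) (v : Metric.sphere (0 : Euc n) 1)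
    {p : ℝ} (hp : -1 < p) :
    ∫⁻ x : Euc n, posRpow p (inner ℝ x (v : Euc n)) * ENNReal.ofReal (Real.exp (-‖x‖ ^ 2)) =
      ENNReal.ofReal (Real.Gamma ((p + 1) / 2) / 2 * Real.pi ^ (((n : ℝ) - 1) / 2)) := by
  obtain ⟨b, hb⟩ := exists_orthonormalBasis_apply v ⟨0, hn⟩
  have h := b.measurePreserving_repr.lintegral_comp_emb
    b.repr.toHomeomorph.measurableEmbedding fun x =>
      posRpow p (x ⟨0, hn⟩) * ENNReal.ofReal (Real.exp (-‖x‖ ^ 2))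
  rw [← lintegral_posRpow_coord_mul_exp (⟨0, hn⟩ : Fin n) hp, ← h]
  refine lintegral_congr fun x => ?_
  rw [b.repr.norm_map, b.repr_apply_apply, hb, real_inner_comm]

/-- The one-sided moments of the surface measure of the sphere. -/
noncomputable def sphereMoment (n : ℕ) (p : ℝ) : ℝ :=
  Real.Gamma ((p + 1) / 2) * Real.pi ^ (((n : ℝ) - 1) / 2) / Real.Gamma ((n + p) / 2)

lemma sphereMoment_pos {n : ℕ} (hn : 1 ≤ n) {p : ℝ} (hp : -1 < p) : 0 < sphereMoment n p := by
  have hn' : (1 : ℝ) ≤ n := by exact_mod_cast hn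
  have h1 := Real.Gamma_pos_of_pos (show 0 < (p + 1) / 2 by linarith)
  have h2 := Real.Gamma_pos_of_pos (show 0 < (n + p) / 2 by linarith)
  unfold sphereMoment
  positivity

/-- The Gaussian moment of `lintegral_posRpow_inner_mul_exp` is computed a second time in polar
coordinates. By homogeneity it is the moment over the sphere times the radial integral Γ((n+p)/2)/2.
-/
theorem lintegral_sphere_posRpow {n : ℕ} (hn : 1 ≤ n) (v : Metric.sphere (0 : Euc n) 1)
    {p : ℝ} (hp : -1 < p) :
    ∫⁻ u : Metric.sphere (0 : Euc n) 1, posRpow p (inner ℝ (u : Euc n) (v : Euc n))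
      ∂(volume : Measure (Euc n)).toSphere = ENNReal.ofReal (sphereMoment n p) := by
  have hn' : (1 : ℝ) ≤ n := by exact_mod_cast hn
  have hm : Measurable fun x : Euc n =>
      posRpow p (inner ℝ x (v : Euc n)) * ENNReal.ofReal (Real.exp (-‖x‖ ^ 2)) :=
    ((measurable_posRpow p).comp (by fun_prop)).mul (by fun_prop)
  have h := lintegral_posRpow_inner_mul_exp hn v hp
  rw [lintegral_polar hn hm] at h
  have e : ∀ u : Metric.sphere (0 : Euc n) 1, (∫⁻ a in Ioi (0 : ℝ),
      ENNReal.ofReal (a ^ (n - 1)) * (posRpow p (inner ℝ (a • (u : Euc n)) (v : Euc n)) *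
        ENNReal.ofReal (Real.exp (-‖a • (u : Euc n)‖ ^ 2)))) =
      ENNReal.ofReal (Real.Gamma ((n + p) / 2) / 2) *
        posRpow p (inner ℝ (u : Euc n) (v : Euc n)) := by
    intro u
    have hI := lintegral_rpow_mul_exp_neg_mul_rpow (q := n - 1 + p) two_pos (by linarith) one_pos
    rw [Real.one_rpow, one_mul, show (n : ℝ) - 1 + p + 1 = n + p by ring] at hI
    rw [show Real.Gamma ((n + p) / 2) / 2 = 1 / 2 * Real.Gamma ((n + p) / 2) by ring, ← hI,
      mul_comm, ← lintegral_const_mul _ (by fun_prop)]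
    refine setLIntegral_congr_fun measurableSet_Ioi fun a ha => ?_
    have ha' : (0 : ℝ) < a := ha
    rw [real_inner_smul_left, posRpow_mul p ha', norm_smul, norm_eq_of_mem_sphere, mul_one,
      Real.norm_of_nonneg ha'.le, ← Real.rpow_natCast a (n - 1), Nat.cast_sub hn, Nat.cast_one,
      Real.rpow_add ha', ENNReal.ofReal_mul (by positivity), ENNReal.ofReal_mul (by positivity),
      Real.rpow_two, neg_one_mul]
    ring
  have hmu : Measurable fun u : Metric.sphere (0 : Euc n) 1 =>
      posRpow p (inner ℝ (u : Euc n) (v : Euc n)) := (measurable_posRpow p).comp (by fun_prop)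
  rw [lintegral_congr e, lintegral_const_mul _ hmu] at h
  have hG := Real.Gamma_pos_of_pos (show 0 < ((n : ℝ) + p) / 2 by linarith)
  have h0 : ENNReal.ofReal (Real.Gamma ((n + p) / 2) / 2) ≠ 0 := by
    rw [ne_eq, ENNReal.ofReal_eq_zero, not_le]; positivity
  rw [← ENNReal.mul_right_inj h0 ENNReal.ofReal_ne_top, h, ← ENNReal.ofReal_mul (by positivity),
    sphereMoment]
  congr 1
  field_simp

end PoissonPolyhedra

/-! ## Radial functions, and cells of systems of half-spaces -/

namespace PoissonPolyhedra

/-- The length of the intersection of `K` with the ray in direction `v`. -/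
noncomputable def rad {n : ℕ} (K : Set (Euc n)) (v : Metric.sphere (0 : Euc n) 1) : ℝ :=
  (volume {a : ℝ | 0 < a ∧ a • (v : Euc n) ∈ K}).toReal

lemma rad_nonneg {n : ℕ} (K : Set (Euc n)) (v : Metric.sphere (0 : Euc n) 1) : 0 ≤ rad K v :=
  ENNReal.toReal_nonneg

lemma rad_eq_of_subset {n : ℕ} {K : Set (Euc n)} {v : Metric.sphere (0 : Euc n) 1} {R : ℝ}
    (hR : 0 ≤ R) (h1 : ∀ a, 0 < a → a < R → a • (v : Euc n) ∈ K)
    (h2 : ∀ a, 0 < a → a • (v : Euc n) ∈ K → a ≤ R) : rad K v = R := by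
  have : volume {a : ℝ | 0 < a ∧ a • (v : Euc n) ∈ K} = ENNReal.ofReal R := by
    refine le_antisymm ?_ ?_
    · refine (measure_mono (t := Ioc 0 R) fun a ha => ⟨ha.1, h2 a ha.1 ha.2⟩).trans ?_
      simp
    · refine le_trans ?_ (measure_mono (s := Ioo 0 R) fun a ha => ⟨ha.1, h1 a ha.1 ha.2⟩)
      simp
  rw [rad, this, ENNReal.toReal_ofReal hR]

/-- Defining the radius as a length makes it the measure of a section of a measurable set. -/
lemma measurable_rad {n : ℕ} {K : Set (Euc n)} (hK : MeasurableSet K) : Measurable (rad K) := by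
  refine ENNReal.measurable_toReal.comp ?_
  have hs : MeasurableSet {p : Metric.sphere (0 : Euc n) 1 × ℝ | 0 < p.2 ∧
      p.2 • (p.1 : Euc n) ∈ K} :=
    (measurableSet_lt measurable_const measurable_snd).inter
      ((show Measurable fun p : Metric.sphere (0 : Euc n) 1 × ℝ => p.2 • (p.1 : Euc n) by
        fun_prop) hK)
  exact measurable_measure_prodMk_left hs

/-- Along each ray, a bounded star-shaped set is an interval of length `rad K v`. -/
lemma rad_section {n : ℕ} {K : Set (Euc n)} (hs : StarConvex ℝ 0 K) {R : ℝ}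
    (hR : ∀ x ∈ K, ‖x‖ ≤ R) (v : Metric.sphere (0 : Euc n) 1) :
    (∀ a, 0 < a → a < rad K v → a • (v : Euc n) ∈ K) ∧
      (∀ a, 0 < a → a • (v : Euc n) ∈ K → a ≤ rad K v) := by
  set S : Set ℝ := {a : ℝ | 0 < a ∧ a • (v : Euc n) ∈ K} with hS
  have hbdd : BddAbove S := by
    refine ⟨R, fun a ha => ?_⟩
    have := hR _ ha.2
    rwa [norm_smul, norm_eq_of_mem_sphere, mul_one, Real.norm_of_nonneg ha.1.le] at this
  have hdown : ∀ a b, 0 < a → a ≤ b → b ∈ S → a ∈ S := by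
    intro a b ha hab hb
    refine ⟨ha, ?_⟩
    have := hs.smul_mem hb.2 (t := a / b) (by have := hb.1; positivity)
      ((div_le_one hb.1).2 hab)
    rwa [smul_smul, div_mul_cancel₀ _ hb.1.ne'] at this
  have hsup : 0 ≤ sSup S := Real.sSup_nonneg fun a ha => ha.1.le
  have h1 : ∀ a, 0 < a → a < sSup S → a • (v : Euc n) ∈ K := by
    intro a ha has
    have hne : S.Nonempty := by
      by_contra h
      rw [not_nonempty_iff_eq_empty.1 h, Real.sSup_empty] at has
      linarith
    obtain ⟨b, hb, hab⟩ := exists_lt_of_lt_csSup hne has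
    exact (hdown a b ha hab.le hb).2
  have h2 : ∀ a, 0 < a → a • (v : Euc n) ∈ K → a ≤ sSup S := fun a ha hK =>
    le_csSup hbdd ⟨ha, hK⟩
  rw [rad_eq_of_subset hsup h1 h2]
  exact ⟨h1, h2⟩

lemma rad_le {n : ℕ} {K : Set (Euc n)} {v : Metric.sphere (0 : Euc n) 1} {R : ℝ} (hR : 0 ≤ R)
    (h : ∀ a, 0 < a → a • (v : Euc n) ∈ K → a ≤ R) : rad K v ≤ R := by
  have h1 : volume {a : ℝ | 0 < a ∧ a • (v : Euc n) ∈ K} ≤ ENNReal.ofReal R := by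
    refine (measure_mono (t := Ioc 0 R) fun a ha => ⟨ha.1, h a ha.1 ha.2⟩).trans ?_
    simp
  exact (ENNReal.toReal_mono ENNReal.ofReal_ne_top h1).trans (ENNReal.toReal_ofReal hR).le

theorem volume_eq_lintegral_rad {n : ℕ} (hn : 1 ≤ n) {K : Set (Euc n)} (hK : MeasurableSet K)
    (hs : StarConvex ℝ 0 K) {R : ℝ} (hR : ∀ x ∈ K, ‖x‖ ≤ R) :
    volume K = ∫⁻ v, ENNReal.ofReal (rad K v ^ n / n) ∂(volume : Measure (Euc n)).toSphere := by
  have h := lintegral_polar hn (measurable_one.indicator hK : Measurable (K.indicator 1))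
  rw [lintegral_indicator_one hK] at h
  rw [h]
  refine lintegral_congr fun v => ?_
  obtain ⟨h1, h2⟩ := rad_section hs hR v
  have h0 := rad_nonneg K v
  have e : ∫⁻ a in Ioi (0 : ℝ), ENNReal.ofReal (a ^ (n - 1)) *
      K.indicator (1 : Euc n → ENNReal) (a • (v : Euc n)) =
      ∫⁻ a in Ioi (0 : ℝ), (Ioc 0 (rad K v)).indicator
        (fun a => ENNReal.ofReal (a ^ (n - 1))) a := by
    refine lintegral_congr_ae ?_
    -- Whether the end point of the interval belongs to K is unknown, but it is a null set on the
    -- ray.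
    have hne : ∀ᵐ a ∂(volume.restrict (Ioi (0 : ℝ))), a ≠ rad K v :=
      ae_restrict_of_ae (Measure.ae_ne volume _)
    filter_upwards [hne, ae_restrict_mem measurableSet_Ioi] with a ha ha0
    by_cases hlt : a < rad K v
    · rw [indicator_of_mem (h1 a ha0 hlt), indicator_of_mem (show a ∈ Ioc 0 _ from ⟨ha0, hlt.le⟩)]
      simp
    · have hgt : rad K v < a := lt_of_le_of_ne (not_lt.1 hlt) ha.symm
      rw [indicator_of_notMem (fun h => hgt.not_ge (h2 a ha0 h)),
        indicator_of_notMem (fun h : a ∈ Ioc 0 _ => hgt.not_ge h.2), mul_zero]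
  rw [e, lintegral_indicator measurableSet_Ioc, Measure.restrict_restrict measurableSet_Ioc,
    inter_eq_left.2 Ioc_subset_Ioi_self, ← ofReal_integral_eq_lintegral_ofReal
    (intervalIntegral.intervalIntegrable_pow _).1, ← intervalIntegral.integral_of_le h0,
    integral_pow]
  · congr 1
    rw [Nat.sub_add_cancel hn, zero_pow (by omega), Nat.cast_sub hn]
    simp
  · filter_upwards [ae_restrict_mem measurableSet_Ioc] with a ha
    exact pow_nonneg ha.1.le _

/-- The intersection of the half-spaces `{x | ⟨x, u⟩ ≤ t + s}` over `(u, t) ∈ T`. -/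
def cell {n : ℕ} (T : Set (Metric.sphere (0 : Euc n) 1 × ℝ)) (s : ℝ) : Set (Euc n) :=
  {x | ∀ p ∈ T, inner ℝ x (p.1 : Euc n) ≤ p.2 + s}

/-- The systems of half-spaces that generate bounded cells and are locally finite. -/
structure IsRegularSystem {n : ℕ} (T : Set (Metric.sphere (0 : Euc n) 1 × ℝ)) : Prop where
  pos : ∀ p ∈ T, 0 < p.2
  finite : ∀ R : ℝ, {p ∈ T | p.2 ≤ R}.Finite
  bounded : ∃ R : ℝ, ∀ x ∈ cell T 0, ‖x‖ ≤ R

variable {n : ℕ} {T : Set (Metric.sphere (0 : Euc n) 1 × ℝ)}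

lemma isClosed_cell (T : Set (Metric.sphere (0 : Euc n) 1 × ℝ)) (s : ℝ) : IsClosed (cell T s) := by
  have : cell T s = ⋂ p ∈ T, {x : Euc n | inner ℝ x (p.1 : Euc n) ≤ p.2 + s} := by
    ext x; simp [cell]
  rw [this]
  exact isClosed_biInter fun p _ => isClosed_le (by fun_prop) (by fun_prop)

lemma convex_cell (T : Set (Metric.sphere (0 : Euc n) 1 × ℝ)) (s : ℝ) : Convex ℝ (cell T s) := by
  intro x hx y hy a b ha hb hab p hp
  rw [inner_add_left, real_inner_smul_left, real_inner_smul_left]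
  have h1 := mul_le_mul_of_nonneg_left (hx p hp) ha
  have h2 := mul_le_mul_of_nonneg_left (hy p hp) hb
  have h3 : a * (p.2 + s) + b * (p.2 + s) = p.2 + s := by rw [← add_mul, hab, one_mul]
  linarith

lemma inner_le_norm_of_sphere (x : Euc n) (u : Metric.sphere (0 : Euc n) 1) :
    inner ℝ x (u : Euc n) ≤ ‖x‖ := by
  have := real_inner_le_norm x (u : Euc n)
  rwa [norm_eq_of_mem_sphere, mul_one] at this

lemma inner_sphere_le_one (v u : Metric.sphere (0 : Euc n) 1) :
    inner ℝ (v : Euc n) (u : Euc n) ≤ 1 := by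
  simpa using inner_le_norm_of_sphere (v : Euc n) u

/-- The functional ⟨·, u⟩ is 1-Lipschitz. The reverse inclusion fails in general, for instance near
vertices; `rad_cthickening_eventuallyEq` recovers what is needed of it. -/
lemma cthickening_cell_subset (T : Set (Metric.sphere (0 : Euc n) 1 × ℝ)) {s : ℝ} (hs : 0 ≤ s) :
    Metric.cthickening s (cell T 0) ⊆ cell T s := by
  have key : ∀ δ, s < δ → Metric.cthickening s (cell T 0) ⊆ cell T δ := by
    intro δ hδ y hy p hp
    obtain ⟨x, hx, hxy⟩ := Metric.mem_thickening_iff.1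
      (Metric.cthickening_subset_thickening' (hs.trans_lt hδ) hδ _ hy)
    have h1 := hx p hp
    have h2 := inner_le_norm_of_sphere (y - x) p.1
    rw [inner_sub_left] at h2
    rw [dist_eq_norm] at hxy
    linarith
  intro y hy p hp
  refine le_of_forall_gt_imp_ge_of_dense fun c hc => ?_
  have := key (c - p.2) (by linarith) hy p hp
  linarith

namespace IsRegularSystem

/-- By local finiteness the smallest distance at most 1 is attained, if there is one. The cell thus
contains a ball about the origin. -/
lemma exists_pos_le (hT : IsRegularSystem T) : ∃ ε : ℝ, 0 < ε ∧ ∀ p ∈ T, ε ≤ p.2 := by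
  rcases {p ∈ T | p.2 ≤ 1}.eq_empty_or_nonempty with h | h
  · refine ⟨1, one_pos, fun p hp => ?_⟩
    by_contra hlt
    exact (h ▸ (⟨hp, (not_le.1 hlt).le⟩ : p ∈ {p ∈ T | p.2 ≤ 1}) :
      p ∈ (∅ : Set (Metric.sphere (0 : Euc n) 1 × ℝ)))
  · obtain ⟨q, hq, hmin⟩ := exists_min_image _ (fun p => p.2) (hT.finite 1) h
    refine ⟨q.2, hT.pos q hq.1, fun p hp => ?_⟩
    rcases le_or_gt p.2 1 with h1 | h1
    · exact hmin p ⟨hp, h1⟩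
    · exact hq.2.trans h1.le

lemma zero_mem_cell (hT : IsRegularSystem T) {s : ℝ} (hs : 0 ≤ s) : (0 : Euc n) ∈ cell T s := by
  intro p hp
  rw [inner_zero_left]
  linarith [hT.pos p hp]

lemma starConvex_cell (hT : IsRegularSystem T) {s : ℝ} (hs : 0 ≤ s) :
    StarConvex ℝ 0 (cell T s) :=
  (convex_cell T s).starConvex (hT.zero_mem_cell hs)

/-- The shifted cells are controlled by dilates of the cell. -/
lemma smul_mem_cell {ε : ℝ} (hε : 0 < ε) (h : ∀ p ∈ T, ε ≤ p.2) {s : ℝ} (hs : 0 ≤ s) {x : Euc n}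
    (hx : x ∈ cell T s) : (1 + s / ε)⁻¹ • x ∈ cell T 0 := by
  intro p hp
  rw [real_inner_smul_left, inv_mul_le_iff₀ (by positivity), add_zero]
  have h1 := hx p hp
  have h2 : s ≤ s / ε * p.2 := by
    rw [div_mul_eq_mul_div, le_div_iff₀ hε]
    exact mul_le_mul_of_nonneg_left (h p hp) hs
  linarith

lemma bounded_cell (hT : IsRegularSystem T) {s : ℝ} (hs : 0 ≤ s) :
    ∃ R : ℝ, ∀ x ∈ cell T s, ‖x‖ ≤ R := by
  obtain ⟨ε, hε, h⟩ := hT.exists_pos_le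
  obtain ⟨R, hR⟩ := hT.bounded
  refine ⟨(1 + s / ε) * R, fun x hx => ?_⟩
  have := hR _ (smul_mem_cell hε h hs hx)
  rw [norm_smul, norm_inv, Real.norm_of_nonneg (by positivity),
    inv_mul_le_iff₀ (by positivity)] at this
  exact this

/-- Otherwise the whole ray in direction v would lie in the bounded cell. -/
lemma exists_inner_pos (hT : IsRegularSystem T) (v : Metric.sphere (0 : Euc n) 1) :
    ∃ p ∈ T, 0 < inner ℝ (v : Euc n) (p.1 : Euc n) := by
  by_contra! h
  obtain ⟨R, hR⟩ := hT.bounded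
  have := hR ((|R| + 1) • (v : Euc n)) fun p hp => by
    rw [real_inner_smul_left]
    have := mul_nonpos_of_nonneg_of_nonpos (show 0 ≤ |R| + 1 by positivity) (h p hp)
    linarith [hT.pos p hp]
  rw [norm_smul, norm_eq_of_mem_sphere, mul_one, Real.norm_of_nonneg (by positivity)] at this
  linarith [le_abs_self R]

/-- The first half-space that is left by a ray, with ties broken in favour of larger `⟨v, u⟩`. -/
lemma exists_first_exit (hT : IsRegularSystem T) (v : Metric.sphere (0 : Euc n) 1) :
    ∃ p ∈ T, 0 < inner ℝ (v : Euc n) (p.1 : Euc n) ∧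
      ∀ q ∈ T, 0 < inner ℝ (v : Euc n) (q.1 : Euc n) →
        p.2 / inner ℝ (v : Euc n) (p.1 : Euc n) < q.2 / inner ℝ (v : Euc n) (q.1 : Euc n) ∨
        (p.2 / inner ℝ (v : Euc n) (p.1 : Euc n) = q.2 / inner ℝ (v : Euc n) (q.1 : Euc n) ∧
          1 / inner ℝ (v : Euc n) (p.1 : Euc n) ≤ 1 / inner ℝ (v : Euc n) (q.1 : Euc n)) := by
  obtain ⟨q₀, hq₀, hv₀⟩ := hT.exists_inner_pos v
  have hdiv : ∀ q ∈ T, 0 < inner ℝ (v : Euc n) (q.1 : Euc n) →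
      q.2 ≤ q.2 / inner ℝ (v : Euc n) (q.1 : Euc n) := fun q hq h =>
    le_div_self (hT.pos q hq).le h (inner_sphere_le_one v q.1)
  set R := q₀.2 / inner ℝ (v : Euc n) (q₀.1 : Euc n) with hR
  -- Since ⟨v, u⟩ ≤ 1, a half-space at distance beyond R is left only after R, so finitely many
  -- candidates remain and a lexicographic minimum exists.
  have hfin : {q ∈ T | q.2 ≤ R ∧ 0 < inner ℝ (v : Euc n) (q.1 : Euc n)}.Finite :=
    (hT.finite R).subset fun q hq => ⟨hq.1, hq.2.1⟩
  obtain ⟨p, hp, hmin⟩ := exists_min_image _ (fun q : Metric.sphere (0 : Euc n) 1 × ℝ =>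
    toLex (q.2 / inner ℝ (v : Euc n) (q.1 : Euc n), 1 / inner ℝ (v : Euc n) (q.1 : Euc n))) hfin
    ⟨q₀, hq₀, hdiv q₀ hq₀ hv₀, hv₀⟩
  have hmin' := fun q hq => Prod.Lex.toLex_le_toLex.1 (hmin q hq)
  refine ⟨p, hp.1, hp.2.2, fun q hq hvq => ?_⟩
  rcases le_or_gt q.2 R with h | h
  · exact hmin' q ⟨hq, h, hvq⟩
  · left
    have h1 : p.2 / inner ℝ (v : Euc n) (p.1 : Euc n) ≤ R := by
      rcases hmin' q₀ ⟨hq₀, hdiv q₀ hq₀ hv₀, hv₀⟩ with h | h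
      · exact h.le
      · exact h.1.le
    exact h1.trans_lt (h.trans_le (hdiv q hq hvq))

/-- A property of all half-spaces holds for small shifts, if it does for each single one and
for all far away ones. -/
lemma eventually_forall (hT : IsRegularSystem T) {l : Filter ℝ}
    {Q : ℝ → Metric.sphere (0 : Euc n) 1 × ℝ → Prop} (R : ℝ)
    (hfar : ∀ᶠ s in l, ∀ p ∈ T, R < p.2 → Q s p) (h : ∀ p ∈ T, ∀ᶠ s in l, Q s p) :
    ∀ᶠ s in l, ∀ p ∈ T, Q s p := by
  have h1 : ∀ᶠ s in l, ∀ p ∈ {p ∈ T | p.2 ≤ R}, Q s p :=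
    (eventually_all_finite (hT.finite R)).2 fun p hp => h p hp.1
  filter_upwards [h1, hfar] with s hs1 hs2 p hp
  rcases le_or_gt p.2 R with h | h
  · exact hs1 p ⟨hp, h⟩
  · exact hs2 p hp h

/-- The half-space left first is still left first after a small shift: strict inequalities persist
by continuity, ties were resolved in favour of the slowest growth, and far half-spaces cannot
interfere because ⟨v, u⟩ ≤ 1. -/
lemma rad_cell_eventuallyEq (hT : IsRegularSystem T) {v : Metric.sphere (0 : Euc n) 1}
    {p : Metric.sphere (0 : Euc n) 1 × ℝ} (hp : p ∈ T)
    (hv : 0 < inner ℝ (v : Euc n) (p.1 : Euc n))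
    (hmin : ∀ q ∈ T, 0 < inner ℝ (v : Euc n) (q.1 : Euc n) →
        p.2 / inner ℝ (v : Euc n) (p.1 : Euc n) < q.2 / inner ℝ (v : Euc n) (q.1 : Euc n) ∨
        (p.2 / inner ℝ (v : Euc n) (p.1 : Euc n) = q.2 / inner ℝ (v : Euc n) (q.1 : Euc n) ∧
          1 / inner ℝ (v : Euc n) (p.1 : Euc n) ≤ 1 / inner ℝ (v : Euc n) (q.1 : Euc n))) :
    ∀ᶠ s in 𝓝[≥] (0 : ℝ), rad (cell T s) v = (p.2 + s) / inner ℝ (v : Euc n) (p.1 : Euc n) := by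
  have hp0 := hT.pos p hp
  have h01 : ∀ᶠ s in 𝓝[≥] (0 : ℝ), s ∈ Icc (0 : ℝ) 1 := Icc_mem_nhdsGE one_pos
  have key : ∀ᶠ s in 𝓝[≥] (0 : ℝ), ∀ q ∈ T, 0 < inner ℝ (v : Euc n) (q.1 : Euc n) →
      (p.2 + s) / inner ℝ (v : Euc n) (p.1 : Euc n) ≤
        (q.2 + s) / inner ℝ (v : Euc n) (q.1 : Euc n) := by
    refine hT.eventually_forall ((p.2 + 1) / inner ℝ (v : Euc n) (p.1 : Euc n)) ?_ ?_
    · filter_upwards [h01] with s hs q hq hR hvq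
      calc (p.2 + s) / inner ℝ (v : Euc n) (p.1 : Euc n)
          ≤ (p.2 + 1) / inner ℝ (v : Euc n) (p.1 : Euc n) := by gcongr; exact hs.2
        _ ≤ q.2 + s := by linarith [hs.1]
        _ ≤ (q.2 + s) / inner ℝ (v : Euc n) (q.1 : Euc n) :=
          le_div_self (by linarith [hT.pos q hq, hs.1]) hvq (inner_sphere_le_one v q.1)
    · intro q hq
      by_cases hvq : 0 < inner ℝ (v : Euc n) (q.1 : Euc n)
      swap
      · exact Eventually.of_forall fun s h => absurd h hvq
      rcases hmin q hq hvq with h | h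
      · have hc : ContinuousAt (fun s : ℝ => (q.2 + s) / inner ℝ (v : Euc n) (q.1 : Euc n) -
            (p.2 + s) / inner ℝ (v : Euc n) (p.1 : Euc n)) 0 := by fun_prop
        have := hc.eventually (lt_mem_nhds (a := 0) (by simpa using h))
        filter_upwards [nhdsWithin_le_nhds this] with s hs _
        linarith
      · filter_upwards [h01] with s hs _
        have h2 := mul_le_mul_of_nonneg_left h.2 hs.1
        rw [add_div, add_div, h.1, div_eq_mul_one_div s, div_eq_mul_one_div s]
        linarith
  filter_upwards [key, h01] with s hs hs0
  refine rad_eq_of_subset (div_nonneg (by linarith [hs0.1]) hv.le) ?_ ?_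
  · intro a ha has q hq
    rw [real_inner_smul_left]
    rcases lt_or_ge 0 (inner ℝ (v : Euc n) (q.1 : Euc n)) with h | h
    · exact (le_div_iff₀ h).1 (has.le.trans (hs q hq h))
    · have := mul_nonpos_of_nonneg_of_nonpos ha.le h
      linarith [hs0.1, hT.pos q hq]
  · intro a ha h
    have := h p hp
    rw [real_inner_smul_left] at this
    exact (le_div_iff₀ hv).2 this

end IsRegularSystem

end PoissonPolyhedra

/-! ## The surface area of a cell -/

namespace PoissonPolyhedra

variable {n : ℕ} {T : Set (Metric.sphere (0 : Euc n) 1 × ℝ)}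

/-- The rate at which the cell grows in direction `v` if all half-spaces are shifted outwards. -/
noncomputable def growthRate (T : Set (Metric.sphere (0 : Euc n) 1 × ℝ))
    (v : Metric.sphere (0 : Euc n) 1) : ℝ :=
  derivWithin (fun s => rad (cell T s) v) (Ici 0) 0

open scoped Pointwise in
/-- A great subsphere has measure zero. -/
lemma toSphere_inner_eq_zero {w : Euc n} (hw : w ≠ 0) :
    (volume : Measure (Euc n)).toSphere
      {v : Metric.sphere (0 : Euc n) 1 | inner ℝ (v : Euc n) w = 0} = 0 := by
  have hm : MeasurableSet {v : Metric.sphere (0 : Euc n) 1 | inner ℝ (v : Euc n) w = 0} :=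
    (isClosed_eq (by fun_prop) (by fun_prop)).measurableSet
  rw [Measure.toSphere_apply' _ hm]
  have hsub : Ioo (0 : ℝ) 1 • ((↑) '' {v : Metric.sphere (0 : Euc n) 1 |
      inner ℝ (v : Euc n) w = 0} : Set (Euc n)) ⊆
        (((ℝ ∙ w)ᗮ : Submodule ℝ (Euc n)) : Set (Euc n)) := by
    rintro _ ⟨a, _, _, ⟨v, hv, rfl⟩, rfl⟩
    rw [SetLike.mem_coe, Submodule.mem_orthogonal_singleton_iff_inner_left]
    simp only [real_inner_smul_left]
    rw [show inner ℝ (v : Euc n) w = 0 from hv, mul_zero]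
  have h0 : volume (((ℝ ∙ w)ᗮ : Submodule ℝ (Euc n)) : Set (Euc n)) = 0 := by
    refine Measure.addHaar_submodule _ _ fun htop => hw ?_
    have : w ∈ (ℝ ∙ w)ᗮ := htop ▸ Submodule.mem_top
    rw [Submodule.mem_orthogonal_singleton_iff_inner_left] at this
    exact inner_self_eq_zero.1 this
  rw [measure_mono_null hsub h0, mul_zero]

lemma mem_cthickening_of_sub_smul_mem {x : Euc n} {u : Metric.sphere (0 : Euc n) 1} {s : ℝ}
    (hs : 0 ≤ s) {K : Set (Euc n)} (h : x - s • (u : Euc n) ∈ K) :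
    x ∈ Metric.cthickening s K := by
  refine Metric.mem_cthickening_of_dist_le x _ s K h ?_
  rw [dist_eq_norm, sub_sub_cancel, norm_smul, norm_eq_of_mem_sphere, mul_one,
    Real.norm_of_nonneg hs]

namespace IsRegularSystem

/-- Radius and growth rate of the cell in a given direction. -/
lemma exists_rad_growthRate (hT : IsRegularSystem T) (v : Metric.sphere (0 : Euc n) 1) :
    ∃ p ∈ T, 0 < inner ℝ (v : Euc n) (p.1 : Euc n) ∧
      (∀ q ∈ T, 0 < inner ℝ (v : Euc n) (q.1 : Euc n) →
        p.2 / inner ℝ (v : Euc n) (p.1 : Euc n) < q.2 / inner ℝ (v : Euc n) (q.1 : Euc n) ∨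
        (p.2 / inner ℝ (v : Euc n) (p.1 : Euc n) = q.2 / inner ℝ (v : Euc n) (q.1 : Euc n) ∧
          1 / inner ℝ (v : Euc n) (p.1 : Euc n) ≤ 1 / inner ℝ (v : Euc n) (q.1 : Euc n))) ∧
      rad (cell T 0) v = p.2 / inner ℝ (v : Euc n) (p.1 : Euc n) ∧
      growthRate T v = 1 / inner ℝ (v : Euc n) (p.1 : Euc n) ∧
      ∀ᶠ s in 𝓝[≥] (0 : ℝ), rad (cell T s) v =
        rad (cell T 0) v + s * growthRate T v := by
  obtain ⟨p, hp, hv, hmin⟩ := hT.exists_first_exit v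
  have he := hT.rad_cell_eventuallyEq hp hv hmin
  have h0 : rad (cell T 0) v = p.2 / inner ℝ (v : Euc n) (p.1 : Euc n) := by
    simpa using he.self_of_nhdsWithin self_mem_Ici
  have hg : growthRate T v = 1 / inner ℝ (v : Euc n) (p.1 : Euc n) := by
    have hd : HasDerivWithinAt (fun s : ℝ => (p.2 + s) / inner ℝ (v : Euc n) (p.1 : Euc n))
        (1 / inner ℝ (v : Euc n) (p.1 : Euc n)) (Ici 0) 0 :=
      (((hasDerivAt_id (0 : ℝ)).const_add p.2).div_const _).hasDerivWithinAt
    exact (hd.congr_of_eventuallyEq he (by simp [h0])).derivWithin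
      (uniqueDiffOn_Ici 0 0 self_mem_Ici)
  refine ⟨p, hp, hv, hmin, h0, hg, ?_⟩
  filter_upwards [he] with s hs
  rw [hs, h0, hg]
  ring

lemma growthRate_pos (hT : IsRegularSystem T) (v : Metric.sphere (0 : Euc n) 1) :
    0 < growthRate T v := by
  obtain ⟨p, hp, hv, -, -, hg, -⟩ := hT.exists_rad_growthRate v
  rw [hg]; positivity

lemma countable (hT : IsRegularSystem T) : T.Countable := by
  have : T = ⋃ k : ℕ, {p ∈ T | p.2 ≤ k} := by
    ext p
    simp only [mem_iUnion, mem_ofPred_eq, exists_and_left]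
    exact ⟨fun h => ⟨h, exists_nat_ge _⟩, fun h => h.1⟩
  rw [this]
  exact countable_iUnion fun k => (hT.finite k).countable

/-- A tie forces v to be orthogonal to the nonzero vector q.2 • p.1 - p.2 • q.1, hence into a great
subsphere, and there are countably many pairs. The cross-multiplied form avoids divisions by inner
products that may vanish. -/
lemma ae_ratio_ne (hT : IsRegularSystem T) :
    ∀ᵐ v : Metric.sphere (0 : Euc n) 1 ∂(volume : Measure (Euc n)).toSphere,
    ∀ p ∈ T, ∀ q ∈ T, q ≠ p → q.2 * inner ℝ (v : Euc n) (p.1 : Euc n) ≠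
      p.2 * inner ℝ (v : Euc n) (q.1 : Euc n) := by
  refine (ae_ball_iff hT.countable).2 fun p hp => (ae_ball_iff hT.countable).2 fun q hq => ?_
  by_cases hqp : q = p
  · exact Eventually.of_forall fun v h => absurd hqp h
  have hw : q.2 • (p.1 : Euc n) - p.2 • (q.1 : Euc n) ≠ 0 := by
    intro h
    have h1 : q.2 • (p.1 : Euc n) = p.2 • (q.1 : Euc n) := sub_eq_zero.1 h
    have h2 : q.2 = p.2 := by
      have := congrArg norm h1
      rwa [norm_smul, norm_smul, norm_eq_of_mem_sphere, norm_eq_of_mem_sphere, mul_one, mul_one,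
        Real.norm_of_nonneg (hT.pos q hq).le, Real.norm_of_nonneg (hT.pos p hp).le] at this
    rw [h2] at h1
    have h3 := smul_right_injective (Euc n) (hT.pos p hp).ne' h1
    exact hqp (Prod.ext (Subtype.ext h3.symm) h2)
  rw [ae_iff]
  refine measure_mono_null (fun v hv => ?_) (toSphere_inner_eq_zero hw)
  simp only [mem_ofPred_eq, Classical.not_imp, not_not] at hv
  rw [mem_ofPred_eq, inner_sub_right, real_inner_smul_right, real_inner_smul_right, hv.2, sub_self]

/-- In almost every direction, parallel body and shifted cell agree for small distances. -/
lemma rad_cthickening_eventuallyEq (hT : IsRegularSystem T) {v : Metric.sphere (0 : Euc n) 1}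
    (hv : ∀ p ∈ T, ∀ q ∈ T, q ≠ p → q.2 * inner ℝ (v : Euc n) (p.1 : Euc n) ≠
      p.2 * inner ℝ (v : Euc n) (q.1 : Euc n)) :
    ∀ᶠ s in 𝓝[≥] (0 : ℝ), rad (Metric.cthickening s (cell T 0)) v =
      rad (cell T 0) v + s * growthRate T v := by
  obtain ⟨p, hp, hvp, hmin, h0, hg, he⟩ := hT.exists_rad_growthRate v
  have hp0 := hT.pos p hp
  set c := inner ℝ (v : Euc n) (p.1 : Euc n) with hc
  have h01 : ∀ᶠ s in 𝓝[≥] (0 : ℝ), s ∈ Icc (0 : ℝ) 1 := Icc_mem_nhdsGE one_pos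
  -- The end point of the shifted cell on the ray is moved back by s along the normal of p. It then
  -- satisfies the constraint of p with equality and, for small s, all others, since these are
  -- strict at s = 0 without ties. So it has distance at most s from the cell.
  have hmem : ∀ᶠ s in 𝓝[≥] (0 : ℝ), ∀ q ∈ T,
      inner ℝ (((p.2 + s) / c) • (v : Euc n) - s • (p.1 : Euc n)) (q.1 : Euc n) ≤ q.2 + 0 := by
    refine hT.eventually_forall ((p.2 + 1) / c + 1) ?_ ?_
    · filter_upwards [h01] with s hs q hq hR
      have h1 := inner_le_norm_of_sphere (((p.2 + s) / c) • (v : Euc n) - s • (p.1 : Euc n)) q.1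
      have h2 := norm_sub_le (((p.2 + s) / c) • (v : Euc n)) (s • (p.1 : Euc n))
      rw [norm_smul, norm_smul, norm_eq_of_mem_sphere, norm_eq_of_mem_sphere, mul_one, mul_one,
        Real.norm_of_nonneg hs.1, Real.norm_of_nonneg (div_nonneg (by linarith [hs.1]) hvp.le)]
        at h2
      have h3 : (p.2 + s) / c ≤ (p.2 + 1) / c := by gcongr; exact hs.2
      linarith [hs.2]
    · intro q hq
      by_cases hqp : q = p
      · subst hqp
        filter_upwards with s
        rw [inner_sub_left, real_inner_smul_left, real_inner_smul_left, ← hc,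
          div_mul_cancel₀ _ hvp.ne', real_inner_self_eq_norm_sq, norm_eq_of_mem_sphere]
        linarith
      · have hlt : p.2 / c * inner ℝ (v : Euc n) (q.1 : Euc n) < q.2 := by
          rcases lt_or_ge 0 (inner ℝ (v : Euc n) (q.1 : Euc n)) with h | h
          · rcases hmin q hq h with h' | h'
            · exact (lt_div_iff₀ h).1 h'
            · refine absurd ?_ (hv p hp q hq hqp)
              have := (div_eq_div_iff hvp.ne' h.ne').1 h'.1
              linarith
          · have := mul_nonpos_of_nonneg_of_nonpos (show 0 ≤ p.2 / c by positivity) h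
            linarith [hT.pos q hq]
        have hcont : ContinuousAt (fun s : ℝ =>
            inner ℝ (((p.2 + s) / c) • (v : Euc n) - s • (p.1 : Euc n)) (q.1 : Euc n)) 0 := by
          fun_prop
        have := hcont.preimage_mem_nhds (Iio_mem_nhds (a := q.2) (by
          simpa [real_inner_smul_left] using hlt))
        filter_upwards [nhdsWithin_le_nhds this] with s hs
        rw [add_zero]
        exact le_of_lt hs
  filter_upwards [hmem, h01, he] with s hs hs0 hes
  obtain ⟨R, hR⟩ := hT.bounded_cell hs0.1
  have hsub := cthickening_cell_subset T hs0.1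
  have hstar : StarConvex ℝ 0 (Metric.cthickening s (cell T 0)) :=
    ((convex_cell T 0).cthickening s).starConvex
      (Metric.self_subset_cthickening _ (hT.zero_mem_cell le_rfl))
  have hx := mem_cthickening_of_sub_smul_mem hs0.1
    (show ((p.2 + s) / c) • (v : Euc n) - s • (p.1 : Euc n) ∈ cell T 0 from hs)
  have hpos : 0 < (p.2 + s) / c := div_pos (by linarith [hs0.1]) hvp
  have e : rad (cell T 0) v + s * growthRate T v = (p.2 + s) / c := by rw [h0, hg]; ring
  refine le_antisymm ?_ ?_
  · rw [← hes]
    exact rad_le (rad_nonneg _ _) fun a ha h =>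
      (rad_section (hT.starConvex_cell hs0.1) hR v).2 a ha (hsub h)
  · rw [e]
    exact (rad_section hstar (fun x hx => hR x (hsub hx)) v).2 _ hpos hx

/-- A uniform bound for the difference quotients of the radii. -/
lemma exists_rad_cthickening_bound (hT : IsRegularSystem T) : ∃ R C : ℝ, 0 ≤ R ∧ 0 ≤ C ∧
    ∀ v s, s ∈ Icc (0 : ℝ) 1 → rad (cell T 0) v ≤ rad (Metric.cthickening s (cell T 0)) v ∧
      rad (Metric.cthickening s (cell T 0)) v ≤ rad (cell T 0) v + s * C ∧
      rad (Metric.cthickening s (cell T 0)) v ≤ R := by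
  obtain ⟨ε, hε, hε'⟩ := hT.exists_pos_le
  obtain ⟨R, hR⟩ := hT.bounded
  have hR0 : 0 ≤ R := (norm_nonneg _).trans (hR 0 (hT.zero_mem_cell le_rfl))
  have hradR : ∀ v, rad (cell T 0) v ≤ R := fun v => rad_le hR0 fun a ha h => by
    have := hR _ h
    rwa [norm_smul, norm_eq_of_mem_sphere, mul_one, Real.norm_of_nonneg ha.le] at this
  -- The parallel body lies in the (1 + s/ε)-dilate of the cell, whose radii are at most R; this
  -- gives the Lipschitz constant R/ε.
  refine ⟨R + R / ε, R / ε, by positivity, by positivity, fun v s hs => ?_⟩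
  have hsec := rad_section (hT.starConvex_cell le_rfl) hR v
  obtain ⟨R', hR'⟩ := hT.bounded_cell hs.1
  have hsub := cthickening_cell_subset T hs.1
  have hstar : StarConvex ℝ 0 (Metric.cthickening s (cell T 0)) :=
    ((convex_cell T 0).cthickening s).starConvex
      (Metric.self_subset_cthickening _ (hT.zero_mem_cell le_rfl))
  have hsec' := rad_section hstar (fun x hx => hR' x (hsub hx)) v
  have h2 : rad (Metric.cthickening s (cell T 0)) v ≤ rad (cell T 0) v + s * (R / ε) := by
    refine rad_le (add_nonneg (rad_nonneg _ _) (mul_nonneg hs.1 (by positivity))) fun a ha h => ?_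
    have h1 := smul_mem_cell hε hε' hs.1 (hsub h)
    rw [smul_smul] at h1
    have hpos : 0 < 1 + s / ε := by have := div_nonneg hs.1 hε.le; linarith
    have h3 := hsec.2 _ (by positivity) h1
    rw [inv_mul_le_iff₀ hpos] at h3
    have h4 : s / ε * rad (cell T 0) v ≤ s * (R / ε) := by
      rw [div_mul_eq_mul_div, mul_div_assoc]
      have := hs.1
      gcongr
      exact hradR v
    linarith
  refine ⟨?_, h2, h2.trans ?_⟩
  · refine rad_le (rad_nonneg _ _) fun a ha h => hsec'.2 a ha ?_
    exact Metric.self_subset_cthickening _ h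
  · have : s * (R / ε) ≤ 1 * (R / ε) := by gcongr; exact hs.2
    linarith [hradR v]

lemma volume_real_eq_integral (hT : IsRegularSystem T) (hn : 1 ≤ n) {s : ℝ}
    (hs : s ∈ Icc (0 : ℝ) 1) : volume.real (Metric.cthickening s (cell T 0)) =
      ∫ v, rad (Metric.cthickening s (cell T 0)) v ^ n / n
        ∂(volume : Measure (Euc n)).toSphere := by
  obtain ⟨R, hR⟩ := hT.bounded_cell hs.1
  have hstar : StarConvex ℝ 0 (Metric.cthickening s (cell T 0)) :=
    ((convex_cell T 0).cthickening s).starConvex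
      (Metric.self_subset_cthickening _ (hT.zero_mem_cell le_rfl))
  have hm := Metric.isClosed_cthickening (δ := s) (E := cell T 0) |>.measurableSet
  rw [measureReal_def, volume_eq_lintegral_rad hn hm hstar
    (fun x hx => hR x (cthickening_cell_subset T hs.1 hx)), integral_eq_lintegral_of_nonneg_ae]
  · exact Eventually.of_forall fun v => div_nonneg (pow_nonneg (rad_nonneg _ _) _) n.cast_nonneg
  · exact (((measurable_rad hm).pow_const n).div_const _).aestronglyMeasurable

/-- The difference quotient is taken inside the polar formula for the volume. It converges in almost
every direction, where the radius is eventually affine in s, and is dominated thanks to the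
Lipschitz bound of `exists_rad_cthickening_bound`. -/
theorem hasDerivWithinAt_volume_cthickening (hT : IsRegularSystem T) (hn : 1 ≤ n) :
    HasDerivWithinAt (fun s : ℝ => volume.real (Metric.cthickening s (cell T 0)))
      (∫ v, rad (cell T 0) v ^ (n - 1) * growthRate T v ∂(volume : Measure (Euc n)).toSphere)
      (Ici 0) 0 := by
  have hn0 : (0 : ℝ) < n := by exact_mod_cast hn
  obtain ⟨R, C, hR0, hC0, hb⟩ := hT.exists_rad_cthickening_bound
  have hm : ∀ s : ℝ, Measurable (rad (Metric.cthickening s (cell T 0))) := fun s =>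
    measurable_rad Metric.isClosed_cthickening.measurableSet
  have h01 : ∀ᶠ s in 𝓝[>] (0 : ℝ), s ∈ Ioc (0 : ℝ) 1 := Ioc_mem_nhdsGT one_pos
  have hK0 : Metric.cthickening 0 (cell T 0) = cell T 0 := by
    rw [Metric.cthickening_zero, (isClosed_cell T 0).closure_eq]
  have hint : ∀ s ∈ Icc (0 : ℝ) 1, Integrable (fun v =>
      rad (Metric.cthickening s (cell T 0)) v ^ n / n) (volume : Measure (Euc n)).toSphere := by
    intro s hs
    refine Integrable.of_bound (((hm s).pow_const n).div_const _).aestronglyMeasurable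
      (R ^ n / n) (Eventually.of_forall fun v => ?_)
    have h0 := rad_nonneg (Metric.cthickening s (cell T 0)) v
    rw [Real.norm_of_nonneg (by positivity)]
    have := (hb v s hs).2.2
    gcongr
  rw [hasDerivWithinAt_iff_tendsto_slope, Ici_sdiff_left]
  have hlim : Tendsto (fun s : ℝ => ∫ v, s⁻¹ * (rad (Metric.cthickening s (cell T 0)) v ^ n / n -
      rad (cell T 0) v ^ n / n) ∂(volume : Measure (Euc n)).toSphere) (𝓝[>] 0)
      (𝓝 (∫ v, rad (cell T 0) v ^ (n - 1) * growthRate T v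
        ∂(volume : Measure (Euc n)).toSphere)) := by
    refine tendsto_integral_filter_of_dominated_convergence (fun _ => C * R ^ (n - 1)) ?_ ?_
      (integrable_const _) ?_
    · refine Eventually.of_forall fun s => Measurable.aestronglyMeasurable ?_
      have h0 := hm 0
      rw [hK0] at h0
      exact ((((hm s).pow_const n).div_const _).sub ((h0.pow_const n).div_const _)).const_mul _
    · filter_upwards [h01] with s hs
      refine Eventually.of_forall fun v => ?_
      obtain ⟨h1, h2, h3⟩ := hb v s ⟨hs.1.le, hs.2⟩
      have h0 := rad_nonneg (cell T 0) v
      have h0' := rad_nonneg (Metric.cthickening s (cell T 0)) v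
      have hp := abs_pow_sub_pow_le (rad (Metric.cthickening s (cell T 0)) v) (rad (cell T 0) v) n
      rw [abs_of_nonneg h0, abs_of_nonneg h0', max_eq_left h1] at hp
      have h4 : |rad (Metric.cthickening s (cell T 0)) v - rad (cell T 0) v| ≤ s * C := by
        rw [abs_of_nonneg (by linarith)]; linarith
      rw [← sub_div, norm_mul, norm_div, Real.norm_of_nonneg (inv_nonneg.2 hs.1.le),
        Real.norm_of_nonneg hn0.le, Real.norm_eq_abs, inv_mul_le_iff₀ hs.1, div_le_iff₀ hn0]
      have hs0 := hs.1
      calc _ ≤ _ := hp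
        _ ≤ s * C * n * R ^ (n - 1) := by gcongr
        _ = _ := by ring
    · filter_upwards [hT.ae_ratio_ne] with v hv
      have he := hT.rad_cthickening_eventuallyEq hv
      have hd : HasDerivAt (fun s : ℝ => (rad (cell T 0) v + s * growthRate T v) ^ n / n)
          (rad (cell T 0) v ^ (n - 1) * growthRate T v) 0 := by
        have := ((((hasDerivAt_id (0 : ℝ)).mul_const (growthRate T v)).const_add
          (rad (cell T 0) v)).pow n).div_const (n : ℝ)
        convert! this using 1
        simp only [id, zero_mul, add_zero, one_mul]
        field_simp
      have ht := (hasDerivAt_iff_tendsto_slope.1 hd).mono_left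
        (nhdsWithin_mono 0 (fun s (hs : 0 < s) => hs.ne'))
      refine ht.congr' ?_
      filter_upwards [he.filter_mono (nhdsWithin_mono 0 Ioi_subset_Ici_self)] with s hs
      rw [hs, slope_def_field]
      simp only [zero_mul, add_zero, sub_zero]
      field_simp
  refine hlim.congr' ?_
  filter_upwards [h01] with s hs
  rw [slope_def_field, hT.volume_real_eq_integral hn ⟨hs.1.le, hs.2⟩,
    hT.volume_real_eq_integral hn ⟨le_rfl, zero_le_one⟩, integral_const_mul, sub_zero]
  have h0 := hint 0 ⟨le_rfl, zero_le_one⟩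
  rw [hK0] at h0 ⊢
  rw [integral_sub (hint s ⟨hs.1.le, hs.2⟩) h0]
  field_simp

end IsRegularSystem

/-! ### The two top intrinsic volumes as Taylor coefficients -/

lemma kappa_one : kappa 1 = 2 := by
  have h : Real.Gamma (1 / 2 + 1) = 1 / 2 * √Real.pi := by
    rw [Real.Gamma_add_one (by norm_num), Real.Gamma_one_half_eq]
  rw [kappa, h, ← Real.sqrt_eq_rpow]
  have : √Real.pi ≠ 0 := by positivity
  field_simp

lemma kappa_zero : kappa 0 = 1 := by simp [kappa]

lemma intrinsicVolume_top (K : Set (Euc n)) : intrinsicVolume n K = volume.real (closure K) := by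
  rw [intrinsicVolume, Nat.sub_self, iteratedDerivWithin_zero]
  simp [kappa_zero]

lemma intrinsicVolume_pred (hn : 1 ≤ n) {K : Set (Euc n)} {d : ℝ}
    (h : HasDerivWithinAt (fun s : ℝ => volume.real (Metric.cthickening s K)) d (Ici 0) 0) :
    intrinsicVolume (n - 1) K = d / 2 := by
  have e : n - (n - 1) = 1 := by omega
  rw [intrinsicVolume, e, iteratedDerivWithin_one,
    h.derivWithin (uniqueDiffOn_Ici 0 0 self_mem_Ici)]
  simp [kappa_one]

end PoissonPolyhedra

/-! ## Poisson processes of hyperplanes in terms of parameters -/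

namespace PoissonPolyhedra

variable {n : ℕ} {Ω : Type*} [MeasurableSpace Ω]

/-- The parameters `(u, t)` with `t > 0` of the hyperplanes of a system. -/
def posParam (S : Set (Hyperplane n)) : Set (Metric.sphere (0 : Euc n) 1 × ℝ) :=
  {p | 0 < p.2 ∧ hyperplane p.1 p.2 ∈ S}

lemma mem_of_hyperplane_eq {u u' : Metric.sphere (0 : Euc n) 1} {t t' : ℝ}
    (h : hyperplane u t = hyperplane u' t') {x : Euc n} (hx : inner ℝ x (u : Euc n) = t) :
    inner ℝ x (u' : Euc n) = t' := by
  have h1 : {x : Euc n | inner ℝ x (u : Euc n) = t} = {x : Euc n | inner ℝ x (u' : Euc n) = t'} :=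
    congrArg Subtype.val h
  exact (h1 ▸ hx : x ∈ {x : Euc n | inner ℝ x (u' : Euc n) = t'})

lemma sphere_inner_self (u : Metric.sphere (0 : Euc n) 1) :
    inner ℝ (u : Euc n) (u : Euc n) = 1 := by
  rw [real_inner_self_eq_norm_sq, norm_eq_of_mem_sphere, one_pow]

/-- The parametrisation of hyperplanes is two-to-one. -/
lemma hyperplane_eq {u u' : Metric.sphere (0 : Euc n) 1} {t t' : ℝ}
    (h : hyperplane u t = hyperplane u' t') : (u' = u ∧ t' = t) ∨ (u' = -u ∧ t' = -t) := by
  set c := inner ℝ (u : Euc n) (u' : Euc n) with hc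
  have ht : t' = t * c := by
    have := mem_of_hyperplane_eq h (x := t • (u : Euc n))
      (by rw [real_inner_smul_left, sphere_inner_self, mul_one])
    rw [← this, real_inner_smul_left]
  -- The foot point t • u gives t' = t c. This second point, displaced within the hyperplane by the
  -- part of u' orthogonal to u, gives t c + 1 - c² = t', hence c² = 1.
  have hw := mem_of_hyperplane_eq h (x := t • (u : Euc n) + ((u' : Euc n) - c • (u : Euc n)))
    (by
      rw [inner_add_left, inner_sub_left, real_inner_smul_left, real_inner_smul_left,
        sphere_inner_self, real_inner_comm]
      ring)
  rw [inner_add_left, inner_sub_left, real_inner_smul_left, real_inner_smul_left,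
    sphere_inner_self, ← hc] at hw
  have hc2 : c ^ 2 = 1 := by rw [ht] at hw; linarith
  have huu : ‖(u' : Euc n) - c • (u : Euc n)‖ ^ 2 = 0 := by
    rw [norm_sub_sq_real, norm_smul, norm_eq_of_mem_sphere, norm_eq_of_mem_sphere,
      real_inner_smul_right, real_inner_comm, ← hc, Real.norm_eq_abs, mul_one, sq_abs]
    linarith
  have hu : (u' : Euc n) = c • (u : Euc n) := by
    have := pow_eq_zero_iff (two_ne_zero) |>.1 huu
    exact sub_eq_zero.1 (norm_eq_zero.1 this)
  rcases sq_eq_one_iff.1 hc2 with h1 | h1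
  · left
    exact ⟨Subtype.ext (by rw [hu, h1, one_smul]), by rw [ht, h1, mul_one]⟩
  · right
    exact ⟨Subtype.ext (by rw [hu, h1, neg_one_smul]; rfl), by rw [ht, h1, mul_neg_one]⟩

lemma hyperplane_neg (u : Metric.sphere (0 : Euc n) 1) (t : ℝ) :
    hyperplane (-u) (-t) = hyperplane u t := by
  refine Subtype.ext (Set.ext fun x => ?_)
  change inner ℝ x (-(u : Euc n)) = -t ↔ inner ℝ x (u : Euc n) = t
  rw [inner_neg_right, neg_inj]

lemma measurable_hyperplane :
    Measurable fun p : Metric.sphere (0 : Euc n) 1 × ℝ => hyperplane p.1 p.2 := fun _ hs => hs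

lemma measurableSet_hyperplane_iff {A : Set (Hyperplane n)} : MeasurableSet A ↔
    MeasurableSet ((fun p : Metric.sphere (0 : Euc n) 1 × ℝ => hyperplane p.1 p.2) ⁻¹' A) :=
  Iff.rfl

/-- The hyperplanes with a parameter `(u, t) ∈ D`, `t > 0`. -/
def ofParam (D : Set (Metric.sphere (0 : Euc n) 1 × ℝ)) : Set (Hyperplane n) :=
  (fun p : Metric.sphere (0 : Euc n) 1 × ℝ => hyperplane p.1 p.2) '' (D ∩ {p | 0 < p.2})

lemma preimage_ofParam (D : Set (Metric.sphere (0 : Euc n) 1 × ℝ)) :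
    (fun p : Metric.sphere (0 : Euc n) 1 × ℝ => hyperplane p.1 p.2) ⁻¹' ofParam D =
      (D ∩ {p | 0 < p.2}) ∪ (fun p => -p) ⁻¹' (D ∩ {p | 0 < p.2}) := by
  ext p
  constructor
  · rintro ⟨q, hq, hqp⟩
    rcases hyperplane_eq hqp with h | h
    · left
      rwa [show p = q from Prod.ext h.1 h.2]
    · right
      rw [mem_preimage, show -p = q from Prod.ext (by simp [h.1]) (by simp [h.2])]
      exact hq
  · rintro (h | h)
    · exact ⟨p, h, rfl⟩
    · exact ⟨-p, h, hyperplane_neg p.1 p.2⟩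

/-- Restricted to t > 0 the two-to-one parametrisation is injective, so counts of hyperplanes become
counts of parameters. -/
lemma encard_inter_ofParam (S : Set (Hyperplane n))
    (D : Set (Metric.sphere (0 : Euc n) 1 × ℝ)) :
    (S ∩ ofParam D).encard = (posParam S ∩ D).encard := by
  have e : S ∩ ofParam D =
      (fun p : Metric.sphere (0 : Euc n) 1 × ℝ => hyperplane p.1 p.2) '' (posParam S ∩ D) := by
    ext H
    constructor
    · rintro ⟨hH, p, hp, rfl⟩
      exact ⟨p, ⟨⟨hp.2, hH⟩, hp.1⟩, rfl⟩
    · rintro ⟨p, hp, rfl⟩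
      exact ⟨hp.1.2, p, ⟨hp.2, hp.1.1⟩, rfl⟩
  rw [e]
  refine InjOn.encard_image fun p hp q hq h => ?_
  rcases hyperplane_eq h with h' | h'
  · exact (Prod.ext h'.1 h'.2).symm
  · have h1 : 0 < p.2 := hp.1.1
    have h2 : 0 < q.2 := hq.1.1
    linarith [h'.2]

/-- The intensity measure in terms of the parameters `(u, t)` with `t > 0`. -/
noncomputable def paramIntensity (n : ℕ) (r γ : ℝ) : Measure (Metric.sphere (0 : Euc n) 1 × ℝ) :=
  ENNReal.ofReal (2 * γ / omega n) • (volume : Measure (Euc n)).toSphere.prod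
    ((volume.restrict (Ioi (0 : ℝ))).withDensity fun t => ENNReal.ofReal (t ^ (r - 1)))

/-- The measure `|t|^(r-1) dt`. -/
noncomputable def distMeasure (r : ℝ) : Measure ℝ :=
  (volume : Measure ℝ).withDensity fun t => ENNReal.ofReal (|t| ^ (r - 1))

lemma measurable_abs_rpow (r : ℝ) : Measurable fun t : ℝ => ENNReal.ofReal (|t| ^ (r - 1)) := by
  have : Measurable fun t : ℝ => |t| ^ (r - 1) :=
    (continuous_abs.measurable).pow_const _
  exact this.ennreal_ofReal

instance sigmaFinite_distMeasure (r : ℝ) : SigmaFinite (distMeasure r) :=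
  SigmaFinite.withDensity_of_ne_top'
    fun _ => ENNReal.ofReal_ne_top

lemma measurePreserving_neg_distMeasure (r : ℝ) :
    MeasurePreserving (fun t : ℝ => -t) (distMeasure r) (distMeasure r) := by
  refine ⟨measurable_neg, Measure.ext fun s hs => ?_⟩
  rw [Measure.map_apply measurable_neg hs, distMeasure, withDensity_apply _ (measurable_neg hs),
    withDensity_apply _ hs]
  have h := (Measure.measurePreserving_neg (volume : Measure ℝ)).setLIntegral_comp_preimage hs
    (measurable_abs_rpow r)
  rw [← h]
  simp

open scoped Pointwise in
lemma measurePreserving_neg_toSphere : MeasurePreserving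
    (fun u : Metric.sphere (0 : Euc n) 1 => -u) (volume : Measure (Euc n)).toSphere
    (volume : Measure (Euc n)).toSphere := by
  have hm : Measurable fun u : Metric.sphere (0 : Euc n) 1 => -u := continuous_neg.measurable
  refine ⟨hm, Measure.ext fun s hs => ?_⟩
  rw [Measure.map_apply hm hs, Measure.toSphere_apply' _ (hm hs), Measure.toSphere_apply' _ hs]
  congr 1
  rw [← Measure.measure_neg]
  congr 1
  ext x
  simp only [Set.mem_neg, Set.mem_smul, mem_image, mem_preimage]
  constructor
  · rintro ⟨a, ha, _, ⟨u, hu, rfl⟩, hx⟩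
    exact ⟨a, ha, _, ⟨-u, hu, rfl⟩, by simpa using congrArg Neg.neg hx⟩
  · rintro ⟨a, ha, _, ⟨u, hu, rfl⟩, rfl⟩
    exact ⟨a, ha, _, ⟨-u, by simpa using hu, rfl⟩, by simp⟩

lemma Theta_eq (n : ℕ) (r γ : ℝ) : Theta n r γ = ENNReal.ofReal (γ / omega n) •
    Measure.map (fun p : Metric.sphere (0 : Euc n) 1 × ℝ => hyperplane p.1 p.2)
      ((volume : Measure (Euc n)).toSphere.prod (distMeasure r)) := rfl

lemma measurableSet_pos :
    MeasurableSet {p : Metric.sphere (0 : Euc n) 1 × ℝ | 0 < p.2} :=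
  measurableSet_lt measurable_const measurable_snd

lemma measurable_neg_param :
    Measurable fun p : Metric.sphere (0 : Euc n) 1 × ℝ => -p := continuous_neg.measurable

lemma measurableSet_ofParam {D : Set (Metric.sphere (0 : Euc n) 1 × ℝ)} (hD : MeasurableSet D) :
    MeasurableSet (ofParam D) := by
  rw [measurableSet_hyperplane_iff, preimage_ofParam]
  exact (hD.inter measurableSet_pos).union (measurable_neg_param (hD.inter measurableSet_pos))

/-- The preimage consists of two disjoint antipodal copies of the part of D with t > 0, of equal
measure; hence the factor 2 in `paramIntensity`. -/
lemma Theta_ofParam (r γ : ℝ) {D : Set (Metric.sphere (0 : Euc n) 1 × ℝ)}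
    (hD : MeasurableSet D) : Theta n r γ (ofParam D) = paramIntensity n r γ D := by
  have hD' := hD.inter (measurableSet_pos (n := n))
  have hneg : MeasurePreserving (fun p : Metric.sphere (0 : Euc n) 1 × ℝ => -p)
      ((volume : Measure (Euc n)).toSphere.prod (distMeasure r))
      ((volume : Measure (Euc n)).toSphere.prod (distMeasure r)) :=
    measurePreserving_neg_toSphere.prod (measurePreserving_neg_distMeasure r)
  have hdisj : Disjoint (D ∩ {p | 0 < p.2}) ((fun p => -p) ⁻¹' (D ∩ {p | 0 < p.2})) := by
    rw [Set.disjoint_left]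
    intro p h1 h2
    have h3 : 0 < p.2 := h1.2
    have h4 : 0 < -p.2 := h2.2
    linarith
  have hden : (volume.restrict (Ioi (0 : ℝ))).withDensity (fun t => ENNReal.ofReal (t ^ (r - 1))) =
      (distMeasure r).restrict (Ioi 0) := by
    rw [distMeasure, restrict_withDensity measurableSet_Ioi]
    refine withDensity_congr_ae ?_
    filter_upwards [ae_restrict_mem measurableSet_Ioi] with t ht
    rw [abs_of_pos ht]
  have hpos : {p : Metric.sphere (0 : Euc n) 1 × ℝ | 0 < p.2} = univ ×ˢ Ioi 0 := by
    ext p; simp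
  rw [Theta_eq, Measure.smul_apply, Measure.map_apply measurable_hyperplane
    (measurableSet_ofParam hD), preimage_ofParam,
    measure_union hdisj (measurable_neg_param hD'), hneg.measure_preimage hD'.nullMeasurableSet,
    paramIntensity, hden, Measure.smul_apply,
    ← Measure.restrict_univ (μ := (volume : Measure (Euc n)).toSphere),
    Measure.prod_restrict, Measure.restrict_apply hD, Measure.restrict_univ, ← hpos, ← two_mul,
    smul_eq_mul, smul_eq_mul, ← mul_assoc]
  congr 1
  rw [mul_comm, mul_div_assoc, ENNReal.ofReal_mul two_pos.le]
  simp

/-- The properties of a Poisson process of parameters that are used below. -/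
structure IsPoissonParam (P : Measure Ω) (T : Ω → Set (Metric.sphere (0 : Euc n) 1 × ℝ))
    (μ : Measure (Metric.sphere (0 : Euc n) 1 × ℝ)) : Prop where
  pos : ∀ ω, ∀ p ∈ T ω, 0 < p.2
  measurableSet_avoid : ∀ D, MeasurableSet D → MeasurableSet {ω | T ω ∩ D = ∅}
  measure_avoid : ∀ D, MeasurableSet D → μ D ≠ ⊤ →
    P {ω | T ω ∩ D = ∅} = ENNReal.ofReal (Real.exp (-(μ D).toReal))
  ae_finite : ∀ D, MeasurableSet D → μ D ≠ ⊤ → ∀ᵐ ω ∂P, (T ω ∩ D).Finite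

namespace IsPoissonHyperplaneProcess

variable {P : Measure Ω} {X : Ω → Set (Hyperplane n)} {Λ : Measure (Hyperplane n)}

lemma measure_encard_eq (hX : IsPoissonHyperplaneProcess P X Λ) {A : Set (Hyperplane n)}
    (hA : MeasurableSet A) (hΛ : Λ A ≠ ⊤) (k : ℕ∞) : P {ω | (X ω ∩ A).encard = k} =
      poissonMeasure (Λ A).toNNReal {m : ℕ | (m : ℕ∞) = k} := by
  have h := congrArg (fun ν => ν {k}) (hX.law_count A hA hΛ)
  rw [Measure.map_apply (hX.measurable_count A hA) (measurableSet_singleton k),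
    Measure.map_apply (measurable_of_countable _) (measurableSet_singleton k)] at h
  exact h

lemma measure_inter_eq_empty (hX : IsPoissonHyperplaneProcess P X Λ) {A : Set (Hyperplane n)}
    (hA : MeasurableSet A) (hΛ : Λ A ≠ ⊤) :
    P {ω | X ω ∩ A = ∅} = ENNReal.ofReal (Real.exp (-(Λ A).toReal)) := by
  have h := hX.measure_encard_eq hA hΛ 0
  simp only [encard_eq_zero, Nat.cast_eq_zero] at h
  rw [h, show {m : ℕ | m = 0} = {0} from rfl, poissonMeasure_singleton]
  simp [ENNReal.coe_toNNReal_eq_toReal]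

lemma ae_finite_inter (hX : IsPoissonHyperplaneProcess P X Λ) {A : Set (Hyperplane n)}
    (hA : MeasurableSet A) (hΛ : Λ A ≠ ⊤) : ∀ᵐ ω ∂P, (X ω ∩ A).Finite := by
  have h := hX.measure_encard_eq hA hΛ ⊤
  simp only [ENat.natCast_ne_top, encard_eq_top_iff, ofPred_false, measure_empty] at h
  rw [ae_iff]
  exact h

lemma isPoissonParam {r γ : ℝ} (hX : IsPoissonHyperplaneProcess P X (Theta n r γ)) :
    IsPoissonParam P (fun ω => posParam (X ω)) (paramIntensity n r γ) where
  pos := fun _ _ h => h.1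
  measurableSet_avoid := fun D hD => by
    have h := hX.measurable_count _ (measurableSet_ofParam hD) (measurableSet_singleton 0)
    have e : {ω | posParam (X ω) ∩ D = ∅} =
        (fun ω => (X ω ∩ ofParam D).encard) ⁻¹' {0} := by
      ext ω
      simp [encard_inter_ofParam]
    rw [e]
    exact h
  measure_avoid := fun D hD h => by
    rw [← Theta_ofParam r γ hD] at h ⊢
    rw [← hX.measure_inter_eq_empty (measurableSet_ofParam hD) h]
    congr 1
    ext ω
    simp only [mem_ofPred_eq]
    rw [← encard_eq_zero, ← encard_inter_ofParam, encard_eq_zero]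
  ae_finite := fun D hD h => by
    rw [← Theta_ofParam r γ hD] at h
    filter_upwards [hX.ae_finite_inter (measurableSet_ofParam hD) h] with ω hω
    rw [← encard_lt_top_iff] at hω ⊢
    rwa [← encard_inter_ofParam]

/-- Almost surely, the zero cell is determined by the hyperplanes not containing the origin. -/
lemma ae_zeroCell_eq {r γ : ℝ} (hX : IsPoissonHyperplaneProcess P X (Theta n r γ)) :
    ∀ᵐ ω ∂P, zeroCell (X ω) = cell (posParam (X ω)) 0 := by
  set A : Set (Hyperplane n) := {H | (0 : Euc n) ∈ H.1} with hA
  have hpre : (fun p : Metric.sphere (0 : Euc n) 1 × ℝ => hyperplane p.1 p.2) ⁻¹' A =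
      univ ×ˢ {0} := by
    ext p
    rw [mem_preimage, hA, mem_ofPred_eq]
    change inner ℝ (0 : Euc n) (p.1 : Euc n) = p.2 ↔ _
    rw [inner_zero_left, Set.mem_prod]
    simp [eq_comm]
  have hAm : MeasurableSet A := by
    rw [measurableSet_hyperplane_iff, hpre]
    exact MeasurableSet.univ.prod (measurableSet_singleton 0)
  have h0 : Theta n r γ A = 0 := by
    rw [Theta_eq, Measure.smul_apply, Measure.map_apply measurable_hyperplane hAm, hpre,
      Measure.prod_prod]
    have : distMeasure r {0} = 0 := withDensity_absolutelyContinuous _ _ (by simp)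
    rw [this, mul_zero, smul_zero]
  have h2 := hX.measure_inter_eq_empty hAm (by rw [h0]; exact ENNReal.zero_ne_top)
  have hms : MeasurableSet {ω | X ω ∩ A = ∅} := by
    have e : {ω | X ω ∩ A = ∅} = (fun ω => (X ω ∩ A).encard) ⁻¹' {0} := by
      ext ω; simp
    rw [e]
    exact hX.measurable_count A hAm (measurableSet_singleton 0)
  -- The law of a count has the total mass of P and is the image of a Poisson distribution.
  have hP : IsProbabilityMeasure P := by
    have := hX.law_count A hAm (by rw [h0]; exact ENNReal.zero_ne_top)
    have hu := congrArg (fun ν => ν univ) this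
    rw [Measure.map_apply (hX.measurable_count A hAm) MeasurableSet.univ,
      Measure.map_apply (measurable_of_countable _) MeasurableSet.univ] at hu
    exact ⟨by simpa using hu⟩
  have h3 : ∀ᵐ ω ∂P, X ω ∩ A = ∅ := by
    rw [h0] at h2
    simp only [ENNReal.toReal_zero, neg_zero, Real.exp_zero, ENNReal.ofReal_one] at h2
    exact (prob_compl_eq_zero_iff hms).2 h2
  filter_upwards [h3] with ω hω
  ext x
  simp only [zeroCell, halfspace, mem_iInter, mem_ofPred_eq, cell, posParam, add_zero]
  constructor
  · intro h p hp
    exact h _ hp.2 p.1 p.2 hp.1.le rfl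
  · rintro h H hH u t ht rfl
    rcases ht.eq_or_lt with rfl | ht
    · have : hyperplane u 0 ∈ X ω ∩ A := ⟨hH, inner_zero_left _⟩
      rw [hω] at this
      exact absurd this (notMem_empty _)
    · exact h (u, t) ⟨ht, hH⟩

end IsPoissonHyperplaneProcess

end PoissonPolyhedra

/-! ## Avoidance probabilities and regularity of the zero cell -/

namespace PoissonPolyhedra

variable {n : ℕ} {Ω : Type*} [MeasurableSpace Ω]

lemma omega_pos {s : ℝ} (hs : 0 < s) : 0 < omega s := by
  have := Real.Gamma_pos_of_pos (half_pos hs)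
  unfold omega
  positivity

lemma withDensity_rpow_Iio {r : ℝ} (hr : 0 < r) (x : ℝ) :
    (volume.restrict (Ioi (0 : ℝ))).withDensity (fun t => ENNReal.ofReal (t ^ (r - 1))) (Iio x) =
      ENNReal.ofReal (1 / r) * posRpow r x := by
  rw [withDensity_apply _ measurableSet_Iio, Measure.restrict_restrict measurableSet_Iio]
  rcases lt_or_ge 0 x with hx | hx
  · have hI : IntervalIntegrable (fun t : ℝ => t ^ (r - 1)) volume 0 x :=
      intervalIntegral.intervalIntegrable_rpow' (by linarith)
    rw [inter_comm, Ioi_inter_Iio, Measure.restrict_congr_set Ioo_ae_eq_Ioc,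
      ← ofReal_integral_eq_lintegral_ofReal hI.1, ← intervalIntegral.integral_of_le hx.le,
      integral_rpow (Or.inl (by linarith)), posRpow_of_pos r hx,
      ← ENNReal.ofReal_mul (by positivity)]
    · congr 1
      rw [sub_add_cancel, Real.zero_rpow hr.ne']
      field_simp
      ring
    · filter_upwards [ae_restrict_mem measurableSet_Ioc] with t ht
      exact Real.rpow_nonneg ht.1.le _
  · have : Iio x ∩ Ioi (0 : ℝ) = ∅ := by
      ext t
      simp only [mem_inter_iff, mem_Iio, mem_Ioi, mem_empty_iff_false, iff_false, not_and, not_lt]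
      intro h; linarith
    rw [this, posRpow_of_nonpos r hx]
    simp

/-- For fixed u the density t^(r-1) on (0, g(u)) integrates to g(u)₊^r / r. The void probabilities
below concern such subgraphs. -/
lemma paramIntensity_lt (hn : 1 ≤ n) {r γ : ℝ} (hr : 0 < r) (hγ : 0 < γ)
    {g : Metric.sphere (0 : Euc n) 1 → ℝ} (hg : Measurable g) :
    paramIntensity n r γ {p | p.2 < g p.1} = ENNReal.ofReal (2 * γ / (omega n * r)) *
      ∫⁻ u, posRpow r (g u) ∂(volume : Measure (Euc n)).toSphere := by
  have hm : MeasurableSet {p : Metric.sphere (0 : Euc n) 1 × ℝ | p.2 < g p.1} :=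
    measurableSet_lt measurable_snd (hg.comp measurable_fst)
  have ho : 0 < omega n := omega_pos (by exact_mod_cast hn)
  have hpm : Measurable fun u => posRpow r (g u) := (measurable_posRpow r).comp hg
  have e : ∀ u, (volume.restrict (Ioi (0 : ℝ))).withDensity
      (fun t => ENNReal.ofReal (t ^ (r - 1))) (Prod.mk u ⁻¹' {p | p.2 < g p.1}) =
      ENNReal.ofReal (1 / r) * posRpow r (g u) := fun u => withDensity_rpow_Iio hr (g u)
  rw [paramIntensity, Measure.smul_apply, Measure.prod_apply hm, smul_eq_mul,
    lintegral_congr e, lintegral_const_mul _ hpm, ← mul_assoc,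
    ← ENNReal.ofReal_mul (by positivity)]
  congr 2
  field_simp

/-- The rate at which a ray in direction `v` meets half-spaces with normal direction in `C`. -/
noncomputable def hitRate (r γ : ℝ) (v : Metric.sphere (0 : Euc n) 1)
    (C : Set (Metric.sphere (0 : Euc n) 1)) : ℝ :=
  2 * γ / (omega n * r) * (∫⁻ u in C, posRpow r (inner ℝ (u : Euc n) (v : Euc n))
    ∂(volume : Measure (Euc n)).toSphere).toReal

lemma measurable_posRpow_inner (p : ℝ) (v : Metric.sphere (0 : Euc n) 1) :
    Measurable fun u : Metric.sphere (0 : Euc n) 1 =>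
      posRpow p (inner ℝ (u : Euc n) (v : Euc n)) :=
  (measurable_posRpow p).comp (by fun_prop)

lemma setLIntegral_posRpow_ne_top (hn : 1 ≤ n) {r : ℝ} (hr : -1 < r)
    (v : Metric.sphere (0 : Euc n) 1) (C : Set (Metric.sphere (0 : Euc n) 1)) :
    ∫⁻ u in C, posRpow r (inner ℝ (u : Euc n) (v : Euc n))
      ∂(volume : Measure (Euc n)).toSphere ≠ ⊤ := by
  refine ne_top_of_le_ne_top ?_ (setLIntegral_le_lintegral C _)
  rw [lintegral_sphere_posRpow hn v hr]
  exact ENNReal.ofReal_ne_top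

lemma hitRate_nonneg (hn : 1 ≤ n) {r γ : ℝ} (hr : 0 < r) (hγ : 0 < γ)
    (v : Metric.sphere (0 : Euc n) 1) (C : Set (Metric.sphere (0 : Euc n) 1)) :
    0 ≤ hitRate r γ v C := by
  have ho : 0 < omega n := omega_pos (by exact_mod_cast hn)
  unfold hitRate
  positivity

/-- The total rate. -/
noncomputable def totalRate (n : ℕ) (r γ : ℝ) : ℝ := 2 * γ / (omega n * r) * sphereMoment n r

lemma totalRate_pos (hn : 1 ≤ n) {r γ : ℝ} (hr : 0 < r) (hγ : 0 < γ) : 0 < totalRate n r γ := by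
  have ho : 0 < omega n := omega_pos (by exact_mod_cast hn)
  have := sphereMoment_pos hn (show -1 < r by linarith)
  unfold totalRate
  positivity

lemma hitRate_add_compl (hn : 1 ≤ n) {r γ : ℝ} (hr : 0 < r) (v : Metric.sphere (0 : Euc n) 1)
    {C : Set (Metric.sphere (0 : Euc n) 1)} (hC : MeasurableSet C) :
    hitRate r γ v C + hitRate r γ v Cᶜ = totalRate n r γ := by
  rw [hitRate, hitRate, totalRate, ← mul_add, ← ENNReal.toReal_add
    (setLIntegral_posRpow_ne_top hn (by linarith) v _)
    (setLIntegral_posRpow_ne_top hn (by linarith) v _), lintegral_add_compl _ hC,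
    lintegral_sphere_posRpow hn v (by linarith),
    ENNReal.toReal_ofReal (sphereMoment_pos hn (by linarith)).le]

open Classical in
/-- The half-spaces that the ray in direction `v` leaves before `a` if the normal direction is in
`C`, and before `b` otherwise. -/
def exitSet (v : Metric.sphere (0 : Euc n) 1) (C : Set (Metric.sphere (0 : Euc n) 1)) (a b : ℝ) :
    Set (Metric.sphere (0 : Euc n) 1 × ℝ) :=
  {p | p.2 < (if p.1 ∈ C then a else b) * inner ℝ (p.1 : Euc n) (v : Euc n)}

open Classical in
lemma measurable_exit_bound (v : Metric.sphere (0 : Euc n) 1)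
    {C : Set (Metric.sphere (0 : Euc n) 1)} (hC : MeasurableSet C) (a b : ℝ) :
    Measurable fun u : Metric.sphere (0 : Euc n) 1 =>
      (if u ∈ C then a else b) * inner ℝ (u : Euc n) (v : Euc n) :=
  (Measurable.ite hC measurable_const measurable_const).mul (by fun_prop)

lemma measurableSet_exitSet (v : Metric.sphere (0 : Euc n) 1)
    {C : Set (Metric.sphere (0 : Euc n) 1)} (hC : MeasurableSet C) (a b : ℝ) :
    MeasurableSet (exitSet v C a b) :=
  measurableSet_lt measurable_snd ((measurable_exit_bound v hC a b).comp measurable_fst)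

lemma posRpow_mul_of_nonneg {p : ℝ} (hp : 0 < p) {a : ℝ} (ha : 0 ≤ a) (x : ℝ) :
    posRpow p (a * x) = ENNReal.ofReal (a ^ p) * posRpow p x := by
  rcases ha.eq_or_lt with rfl | ha
  · rw [zero_mul, posRpow_of_nonpos p le_rfl, Real.zero_rpow hp.ne', ENNReal.ofReal_zero, zero_mul]
  · exact posRpow_mul p ha x

open Classical in
lemma paramIntensity_exitSet (hn : 1 ≤ n) {r γ : ℝ} (hr : 0 < r) (hγ : 0 < γ)
    (v : Metric.sphere (0 : Euc n) 1) {C : Set (Metric.sphere (0 : Euc n) 1)}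
    (hC : MeasurableSet C) {a b : ℝ} (ha : 0 ≤ a) (hb : 0 ≤ b) :
    paramIntensity n r γ (exitSet v C a b) =
      ENNReal.ofReal (a ^ r * hitRate r γ v C + b ^ r * hitRate r γ v Cᶜ) := by
  have ho : 0 < omega n := omega_pos (by exact_mod_cast hn)
  rw [exitSet, paramIntensity_lt hn hr hγ (measurable_exit_bound v hC a b),
    ← lintegral_add_compl _ hC]
  have e1 : ∫⁻ u in C, posRpow r ((if u ∈ C then a else b) * inner ℝ (u : Euc n) (v : Euc n))
      ∂(volume : Measure (Euc n)).toSphere = ENNReal.ofReal (a ^ r) *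
        ∫⁻ u in C, posRpow r (inner ℝ (u : Euc n) (v : Euc n))
          ∂(volume : Measure (Euc n)).toSphere := by
    rw [← lintegral_const_mul _ (measurable_posRpow_inner r v)]
    refine setLIntegral_congr_fun hC fun u hu => ?_
    rw [if_pos hu, posRpow_mul_of_nonneg hr ha]
  have e2 : ∫⁻ u in Cᶜ, posRpow r ((if u ∈ C then a else b) * inner ℝ (u : Euc n) (v : Euc n))
      ∂(volume : Measure (Euc n)).toSphere = ENNReal.ofReal (b ^ r) *
        ∫⁻ u in Cᶜ, posRpow r (inner ℝ (u : Euc n) (v : Euc n))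
          ∂(volume : Measure (Euc n)).toSphere := by
    rw [← lintegral_const_mul _ (measurable_posRpow_inner r v)]
    refine setLIntegral_congr_fun hC.compl fun u hu => ?_
    rw [if_neg hu, posRpow_mul_of_nonneg hr hb]
  have hap := Real.rpow_nonneg ha r
  have hbp := Real.rpow_nonneg hb r
  rw [e1, e2,
    ← ENNReal.ofReal_toReal (setLIntegral_posRpow_ne_top hn (show -1 < r by linarith) v C),
    ← ENNReal.ofReal_toReal (setLIntegral_posRpow_ne_top hn (show -1 < r by linarith) v Cᶜ),
    ← ENNReal.ofReal_mul hap, ← ENNReal.ofReal_mul hbp,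
    ← ENNReal.ofReal_add (by positivity) (by positivity), ← ENNReal.ofReal_mul (by positivity),
    hitRate, hitRate]
  congr 1
  ring

namespace IsPoissonParam

variable {P : Measure Ω}
  {T : Ω → Set (Metric.sphere (0 : Euc n) 1 × ℝ)} {r γ : ℝ}

lemma measureReal_avoid_exitSet (hT : IsPoissonParam P T (paramIntensity n r γ)) (hn : 1 ≤ n)
    (hr : 0 < r) (hγ : 0 < γ) (v : Metric.sphere (0 : Euc n) 1)
    {C : Set (Metric.sphere (0 : Euc n) 1)} (hC : MeasurableSet C) {a b : ℝ} (ha : 0 ≤ a)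
    (hb : 0 ≤ b) : P.real {ω | T ω ∩ exitSet v C a b = ∅} =
      Real.exp (-(a ^ r * hitRate r γ v C + b ^ r * hitRate r γ v Cᶜ)) := by
  have h := paramIntensity_exitSet hn hr hγ v hC ha hb
  rw [measureReal_def, hT.measure_avoid _ (measurableSet_exitSet v hC a b)
    (by rw [h]; exact ENNReal.ofReal_ne_top), h, ENNReal.toReal_ofReal (Real.exp_pos _).le,
    ENNReal.toReal_ofReal]
  have h1 := hitRate_nonneg hn hr hγ v C
  have h2 := hitRate_nonneg hn hr hγ v Cᶜ
  have := Real.rpow_nonneg ha r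
  have := Real.rpow_nonneg hb r
  positivity

lemma ae_locally_finite (hT : IsPoissonParam P T (paramIntensity n r γ)) (hn : 1 ≤ n)
    (hr : 0 < r) (hγ : 0 < γ) : ∀ᵐ ω ∂P, ∀ R : ℝ, {p ∈ T ω | p.2 ≤ R}.Finite := by
  have h : ∀ k : ℕ, ∀ᵐ ω ∂P, (T ω ∩ {p | p.2 < k}).Finite := by
    intro k
    refine hT.ae_finite _ (measurableSet_lt measurable_snd measurable_const) ?_
    rw [paramIntensity_lt hn hr hγ measurable_const, lintegral_const]
    refine ENNReal.mul_ne_top ENNReal.ofReal_ne_top (ENNReal.mul_ne_top ?_ (measure_ne_top _ _))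
    rcases lt_or_ge 0 (k : ℝ) with hk | hk
    · rw [posRpow_of_pos r hk]; exact ENNReal.ofReal_ne_top
    · rw [posRpow_of_nonpos r hk]; exact ENNReal.zero_ne_top
  filter_upwards [ae_all_iff.2 h] with ω hω R
  obtain ⟨k, hk⟩ := exists_nat_gt R
  exact (hω k).subset fun p hp => ⟨hp.1, hp.2.trans_lt hk⟩

/-- Every nonempty open set of directions occurs almost surely. -/
lemma ae_exists_direction_mem (hT : IsPoissonParam P T (paramIntensity n r γ)) (hn : 1 ≤ n)
    (hr : 0 < r) (hγ : 0 < γ) {U : Set (Metric.sphere (0 : Euc n) 1)} (hU : IsOpen U)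
    (hne : U.Nonempty) : ∀ᵐ ω ∂P, ∃ p ∈ T ω, p.1 ∈ U := by
  have ho : 0 < omega n := omega_pos (by exact_mod_cast hn)
  set σU := ((volume : Measure (Euc n)).toSphere U).toReal with hσ
  have hσpos : 0 < σU :=
    ENNReal.toReal_pos (hU.measure_pos _ hne).ne' (measure_ne_top _ _)
  set c := 2 * γ / (omega n * r) * σU with hc
  have hcpos : 0 < c := by positivity
  -- The void probability of the parameters with u ∈ U and 0 < t < R. Its exponent c R^r is
  -- unbounded in R, because nonempty open sets of directions have positive measure.
  have hbound : ∀ R : ℝ, 0 < R → P {ω | ¬ ∃ p ∈ T ω, p.1 ∈ U} ≤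
      ENNReal.ofReal (Real.exp (-(c * R ^ r))) := by
    intro R hR
    have hg : Measurable (U.indicator fun _ : Metric.sphere (0 : Euc n) 1 => R) :=
      measurable_const.indicator hU.measurableSet
    have hI : paramIntensity n r γ {p | p.2 < U.indicator (fun _ => R) p.1} =
        ENNReal.ofReal (c * R ^ r) := by
      rw [paramIntensity_lt hn hr hγ hg]
      have e : ∀ u, posRpow r (U.indicator (fun _ => R) u) =
          U.indicator (fun _ => ENNReal.ofReal (R ^ r)) u := by
        intro u
        by_cases hu : u ∈ U
        · rw [indicator_of_mem hu, indicator_of_mem hu, posRpow_of_pos r hR]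
        · rw [indicator_of_notMem hu, indicator_of_notMem hu, posRpow_of_nonpos r le_rfl]
      rw [lintegral_congr e, lintegral_indicator hU.measurableSet, setLIntegral_const,
        ← ENNReal.ofReal_toReal (measure_ne_top (volume : Measure (Euc n)).toSphere U),
        ← ENNReal.ofReal_mul (by positivity), ← ENNReal.ofReal_mul (by positivity), hc]
      congr 1
      ring
    have := hT.measure_avoid {p | p.2 < U.indicator (fun _ => R) p.1}
      (measurableSet_lt measurable_snd (hg.comp measurable_fst))
      (by rw [hI]; exact ENNReal.ofReal_ne_top)
    rw [hI, ENNReal.toReal_ofReal (by positivity)] at this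
    rw [← this]
    refine measure_mono fun ω hω => ?_
    simp only [mem_ofPred_eq, not_exists, not_and] at hω
    rw [mem_ofPred_eq, eq_empty_iff_forall_notMem]
    rintro p ⟨hp, hp'⟩
    rw [mem_ofPred_eq, indicator_of_notMem (hω p hp)] at hp'
    exact lt_asymm (hT.pos ω p hp) hp'
  have hlim : Tendsto (fun R : ℝ => ENNReal.ofReal (Real.exp (-(c * R ^ r)))) atTop (𝓝 0) := by
    rw [← ENNReal.ofReal_zero]
    exact ENNReal.tendsto_ofReal (Real.tendsto_exp_neg_atTop_nhds_zero.comp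
      ((tendsto_rpow_atTop hr).const_mul_atTop hcpos))
  rw [ae_iff]
  exact le_antisymm (ge_of_tendsto hlim ((eventually_gt_atTop 0).mono hbound)) zero_le

/-- For boundedness, finitely many balls of radius 1/2 cover the sphere, and almost surely each
contains a normal u. Every direction v is then within distance 1 of such a u, so ⟨v, u⟩ ≥ 1/2 and
the ray leaves the cell by 2t. -/
lemma ae_isRegularSystem (hT : IsPoissonParam P T (paramIntensity n r γ)) (hn : 1 ≤ n)
    (hr : 0 < r) (hγ : 0 < γ) : ∀ᵐ ω ∂P, IsRegularSystem (T ω) := by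
  obtain ⟨F, -, hFfin, hF⟩ := (isCompact_univ (X := Metric.sphere (0 : Euc n) 1)).finite_cover_balls
    (show (0 : ℝ) < 1 / 2 by norm_num)
  have hF' : ∀ᵐ ω ∂P, ∀ u ∈ F, ∃ p ∈ T ω, p.1 ∈ Metric.ball u (1 / 2) :=
    (ae_ball_iff hFfin.countable).2 fun u _ => hT.ae_exists_direction_mem hn hr hγ
      Metric.isOpen_ball ⟨u, Metric.mem_ball_self (by norm_num)⟩
  filter_upwards [hF', hT.ae_locally_finite hn hr hγ] with ω h1 h2
  refine ⟨hT.pos ω, h2, ?_⟩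
  choose! p hp hpu using h1
  refine ⟨∑ u ∈ hFfin.toFinset, 2 * (p u).2, fun x hx => ?_⟩
  have hsum : ∀ u ∈ F, 2 * (p u).2 ≤ ∑ u ∈ hFfin.toFinset, 2 * (p u).2 := fun u hu =>
    Finset.single_le_sum (f := fun u => 2 * (p u).2)
      (fun u hu => by have := hT.pos ω _ (hp u (hFfin.mem_toFinset.1 hu)); positivity)
      (hFfin.mem_toFinset.2 hu)
  rcases eq_or_ne x 0 with rfl | hx0
  · rw [norm_zero]
    exact Finset.sum_nonneg fun u hu => by
      have := hT.pos ω _ (hp u (hFfin.mem_toFinset.1 hu)); positivity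
  have hxn : 0 < ‖x‖ := norm_pos_iff.2 hx0
  let v : Metric.sphere (0 : Euc n) 1 := ⟨‖x‖⁻¹ • x, by simp [norm_smul, hxn.ne']⟩
  obtain ⟨u, hu, hvu⟩ := mem_iUnion₂.1 (hF (mem_univ v))
  have hxv : x = ‖x‖ • (v : Euc n) := by simp [v, smul_smul, hxn.ne']
  have hd : ‖(v : Euc n) - (p u).1‖ < 1 := by
    have h3 : dist v (p u).1 < 1 / 2 + 1 / 2 := (dist_triangle_right v (p u).1 u).trans_lt
      (add_lt_add hvu (hpu u hu))
    rw [Subtype.dist_eq, dist_eq_norm] at h3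
    linarith
  have hin : 1 / 2 ≤ inner ℝ (v : Euc n) ((p u).1 : Euc n) := by
    have h4 := norm_sub_sq_real (v : Euc n) ((p u).1 : Euc n)
    rw [norm_eq_of_mem_sphere, norm_eq_of_mem_sphere] at h4
    have h5 : ‖(v : Euc n) - (p u).1‖ ^ 2 ≤ 1 := pow_le_one₀ (norm_nonneg _) hd.le
    linarith
  have h6 := hx _ (hp u hu)
  rw [hxv, real_inner_smul_left, add_zero] at h6
  have h7 := mul_le_mul_of_nonneg_left hin hxn.le
  linarith [hsum u hu]

/-! ### Measurability -/

lemma measurableSet_mem_cell {μ : Measure (Metric.sphere (0 : Euc n) 1 × ℝ)}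
    (hT : IsPoissonParam P T μ) (s : ℝ) (x : Euc n) :
    MeasurableSet {ω | x ∈ cell (T ω) s} := by
  have hD : MeasurableSet {p : Metric.sphere (0 : Euc n) 1 × ℝ |
      p.2 + s < inner ℝ x (p.1 : Euc n)} := measurableSet_lt (by fun_prop) (by fun_prop)
  convert hT.measurableSet_avoid _ hD using 1
  ext ω
  simp only [cell, mem_ofPred_eq, eq_empty_iff_forall_notMem, mem_inter_iff, not_and, not_lt]

/-- Joint measurability in (ω, x) follows from the events at fixed points: a basic open set lies in
the closed cell as soon as its points of a dense sequence do. Passing to the interior makes this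
countable description possible. -/
lemma measurableSet_interior_cell {μ : Measure (Metric.sphere (0 : Euc n) 1 × ℝ)}
    (hT : IsPoissonParam P T μ) (s : ℝ) :
    MeasurableSet {q : Ω × Euc n | q.2 ∈ interior (cell (T q.1) s)} := by
  have e : {q : Ω × Euc n | q.2 ∈ interior (cell (T q.1) s)} =
      ⋃ U ∈ TopologicalSpace.countableBasis (Euc n),
        {ω | ∀ j, TopologicalSpace.denseSeq (Euc n) j ∈ U →
          TopologicalSpace.denseSeq (Euc n) j ∈ cell (T ω) s} ×ˢ U := by
    ext ⟨ω, x⟩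
    simp only [mem_ofPred_eq, mem_iUnion, mem_prod, exists_prop]
    constructor
    · intro hx
      obtain ⟨U, hU, hxU, hsub⟩ := (TopologicalSpace.isBasis_countableBasis
        (Euc n)).exists_subset_of_mem_open hx isOpen_interior
      exact ⟨U, hU, fun j hj => interior_subset (hsub hj), hxU⟩
    · rintro ⟨U, hU, hj, hxU⟩
      have hUo := TopologicalSpace.isOpen_of_mem_countableBasis hU
      refine mem_interior.2 ⟨U, ?_, hUo, hxU⟩
      have hd := (TopologicalSpace.denseRange_denseSeq (Euc n)).open_subset_closure_inter hUo
      refine hd.trans ((isClosed_cell (T ω) s).closure_subset_iff.2 ?_)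
      rintro _ ⟨hy, j, rfl⟩
      exact hj j hy
  rw [e]
  refine MeasurableSet.biUnion (TopologicalSpace.countable_countableBasis _) fun U hU =>
    MeasurableSet.prod ?_ (TopologicalSpace.isOpen_of_mem_countableBasis hU).measurableSet
  rw [ofPred_forall]
  refine MeasurableSet.iInter fun j => ?_
  by_cases h : TopologicalSpace.denseSeq (Euc n) j ∈ U
  · simpa [h] using hT.measurableSet_mem_cell s _
  · simp [h]

lemma measurable_rad_interior_cell {μ : Measure (Metric.sphere (0 : Euc n) 1 × ℝ)}
    (hT : IsPoissonParam P T μ) (s : ℝ) :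
    Measurable fun q : Ω × Metric.sphere (0 : Euc n) 1 =>
      rad (interior (cell (T q.1) s)) q.2 := by
  refine ENNReal.measurable_toReal.comp ?_
  have hs : MeasurableSet {p : (Ω × Metric.sphere (0 : Euc n) 1) × ℝ | 0 < p.2 ∧
      p.2 • (p.1.2 : Euc n) ∈ interior (cell (T p.1.1) s)} :=
    (measurableSet_lt measurable_const measurable_snd).inter
      ((show Measurable fun p : (Ω × Metric.sphere (0 : Euc n) 1) × ℝ =>
        (p.1.1, p.2 • (p.1.2 : Euc n)) by fun_prop) (hT.measurableSet_interior_cell s))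
  exact measurable_measure_prodMk_left hs

end IsPoissonParam

/-- The origin is interior, so by convexity the open segment from it to any point of the cell is
too. -/
lemma IsRegularSystem.rad_interior_cell {T : Set (Metric.sphere (0 : Euc n) 1 × ℝ)}
    (hT : IsRegularSystem T) {s : ℝ} (hs : 0 ≤ s) (v : Metric.sphere (0 : Euc n) 1) :
    rad (interior (cell T s)) v = rad (cell T s) v := by
  obtain ⟨ε, hε, hε'⟩ := hT.exists_pos_le
  obtain ⟨R, hR⟩ := hT.bounded_cell hs
  obtain ⟨h1, h2⟩ := rad_section (hT.starConvex_cell hs) hR v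
  have h0 : (0 : Euc n) ∈ interior (cell T s) := by
    refine mem_interior.2 ⟨Metric.ball 0 ε, fun x hx p hp => ?_, Metric.isOpen_ball,
      Metric.mem_ball_self hε⟩
    have := inner_le_norm_of_sphere x p.1
    rw [mem_ball_zero_iff] at hx
    linarith [hε' p hp]
  refine rad_eq_of_subset (rad_nonneg _ _) (fun a ha har => ?_)
    fun a ha h => h2 a ha (interior_subset h)
  obtain ⟨b, hab, hbr⟩ := exists_between har
  have hb := h1 b (ha.trans hab) hbr
  have hb0 : 0 < b := ha.trans hab
  refine (convex_cell T s).openSegment_interior_self_subset_interior h0 hb ?_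
  refine ⟨1 - a / b, a / b, by rw [sub_pos, div_lt_one hb0]; exact hab, by positivity, by ring, ?_⟩
  rw [smul_zero, zero_add, smul_smul, div_mul_cancel₀ _ hb0.ne']

end PoissonPolyhedra

/-! ## The joint law of radius and growth rate -/

namespace PoissonPolyhedra

variable {n : ℕ} {Ω : Type*} [MeasurableSpace Ω]

/-- A function on `[0, ∞)` whose increments are quadratically small is constant. -/
lemma eq_of_abs_sub_le_sq {f : ℝ → ℝ} {C : ℝ}
    (h : ∀ x y, 0 ≤ x → x ≤ y → |f x - f y| ≤ C * (y - x) ^ 2) {x y : ℝ} (hx : 0 ≤ x)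
    (hxy : x ≤ y) : f x = f y := by
  have key : ∀ (δ : ℝ), 0 ≤ δ → ∀ k : ℕ, |f x - f (x + k * δ)| ≤ k * (C * δ ^ 2) := by
    intro δ hδ k
    induction k with
    | zero => simp
    | succ k ih =>
      have h1 := h (x + k * δ) (x + (k + 1 : ℕ) * δ) (by positivity) (by push_cast; nlinarith)
      have h2 : x + ((k + 1 : ℕ) : ℝ) * δ - (x + k * δ) = δ := by push_cast; ring
      rw [h2] at h1
      calc |f x - f (x + (k + 1 : ℕ) * δ)|
          ≤ |f x - f (x + k * δ)| + |f (x + k * δ) - f (x + (k + 1 : ℕ) * δ)| := abs_sub_le _ _ _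
        _ ≤ k * (C * δ ^ 2) + C * δ ^ 2 := add_le_add ih h1
        _ = _ := by push_cast; ring
  -- Summing over N + 1 equal steps divides the quadratic bound by N + 1.
  have hle : ∀ N : ℕ, |f x - f y| ≤ C * (y - x) ^ 2 * (1 / ((N : ℝ) + 1)) := by
    intro N
    have hN : (0 : ℝ) < (N : ℝ) + 1 := by positivity
    have h1 := key ((y - x) / ((N : ℝ) + 1)) (div_nonneg (by linarith) hN.le) (N + 1)
    have h2 : x + ((N + 1 : ℕ) : ℝ) * ((y - x) / ((N : ℝ) + 1)) = y := by
      push_cast; field_simp; ring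
    rw [h2] at h1
    refine h1.trans_eq ?_
    push_cast
    field_simp
  have h0 : |f x - f y| ≤ 0 := by
    have ht := (tendsto_one_div_add_atTop_nhds_zero_nat (𝕜 := ℝ)).const_mul (C * (y - x) ^ 2)
    rw [mul_zero] at ht
    exact ge_of_tendsto' ht hle
  exact sub_eq_zero.1 (abs_nonpos_iff.1 h0)

/-- The competing risks computation: a function with the increments of the probability that the
first exponential clock, of rate `l₁`, rings after `τ` and before the second one, of rate `l₂`. -/
lemma eq_of_competing_risks {q : ℝ → ℝ} {l₁ l₂ : ℝ} (h₁ : 0 ≤ l₁)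
    (hl : 0 < l₁ + l₂) (hq : Tendsto q atTop (𝓝 0))
    (hup : ∀ x y, 0 ≤ x → x ≤ y →
      q x - q y ≤ Real.exp (-((l₁ + l₂) * x)) - Real.exp (-(l₁ * y + l₂ * x)))
    (hlow : ∀ x y, 0 ≤ x → x ≤ y →
      Real.exp (-(l₁ * x + l₂ * y)) - Real.exp (-((l₁ + l₂) * y)) ≤ q x - q y) {x : ℝ}
    (hx : 0 ≤ x) : q x = l₁ / (l₁ + l₂) * Real.exp (-((l₁ + l₂) * x)) := by
  set l := l₁ + l₂ with hl'
  -- The increments of q and of the claimed solution both lie between l₁(y-x)e^(-ly) and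
  -- l₁(y-x)e^(-lx), which differ by O((y-x)²). So F is constant, and its limit at infinity is 0.
  let F : ℝ → ℝ := fun x => q x - l₁ / l * Real.exp (-(l * x))
  have hF : ∀ x y, 0 ≤ x → x ≤ y → |F x - F y| ≤ (l₁ * l) * (y - x) ^ 2 := by
    intro x y hx hxy
    have hd : 0 ≤ y - x := by linarith
    have hx1 : Real.exp (-(l * x)) ≤ 1 := Real.exp_le_one_iff.2 (by
      have := mul_nonneg hl.le hx; linarith)
    have hy0 := Real.exp_pos (-(l * y))
    have hx0 := Real.exp_pos (-(l * x))
    have e1 : Real.exp (-(l₁ * y + l₂ * x)) = Real.exp (-(l * x)) * Real.exp (-(l₁ * (y - x))) := by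
      rw [← Real.exp_add]; congr 1; rw [hl']; ring
    have e2 : Real.exp (-(l₁ * x + l₂ * y)) = Real.exp (-(l * y)) * Real.exp (l₁ * (y - x)) := by
      rw [← Real.exp_add]; congr 1; rw [hl']; ring
    have e3 : Real.exp (-(l * x)) = Real.exp (-(l * y)) * Real.exp (l * (y - x)) := by
      rw [← Real.exp_add]; congr 1; ring
    have e4 : Real.exp (-(l * y)) = Real.exp (-(l * x)) * Real.exp (-(l * (y - x))) := by
      rw [← Real.exp_add]; congr 1; ring
    have b1 := Real.add_one_le_exp (-(l₁ * (y - x)))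
    have b2 := Real.add_one_le_exp (l₁ * (y - x))
    have b3 := Real.add_one_le_exp (l * (y - x))
    have b4 := Real.add_one_le_exp (-(l * (y - x)))
    have u := hup x y hx hxy
    have w := hlow x y hx hxy
    rw [e1] at u
    rw [e2] at w
    have u1 : q x - q y ≤ l₁ * (y - x) * Real.exp (-(l * x)) := by nlinarith
    have w1 : l₁ * (y - x) * Real.exp (-(l * y)) ≤ q x - q y := by nlinarith
    have gu : Real.exp (-(l * x)) - Real.exp (-(l * y)) ≤ l * (y - x) * Real.exp (-(l * x)) := by
      nlinarith
    have gw : l * (y - x) * Real.exp (-(l * y)) ≤ Real.exp (-(l * x)) - Real.exp (-(l * y)) := by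
      nlinarith
    have hr : 0 ≤ l₁ / l := by positivity
    have gu' := mul_le_mul_of_nonneg_left gu hr
    have gw' := mul_le_mul_of_nonneg_left gw hr
    have c1 : l₁ / l * (l * (y - x) * Real.exp (-(l * x))) =
        l₁ * (y - x) * Real.exp (-(l * x)) := by
      field_simp
    have c2 : l₁ / l * (l * (y - x) * Real.exp (-(l * y))) =
        l₁ * (y - x) * Real.exp (-(l * y)) := by
      field_simp
    rw [c1] at gu'
    rw [c2] at gw'
    have hdiff : l₁ * (y - x) * Real.exp (-(l * x)) - l₁ * (y - x) * Real.exp (-(l * y)) ≤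
        l₁ * l * (y - x) ^ 2 := by
      have : Real.exp (-(l * x)) - Real.exp (-(l * y)) ≤ l * (y - x) :=
        gu.trans (mul_le_of_le_one_right (by positivity) hx1)
      have := mul_le_mul_of_nonneg_left this (show 0 ≤ l₁ * (y - x) by positivity)
      linarith
    have e5 : F x - F y = (q x - q y) -
        l₁ / l * (Real.exp (-(l * x)) - Real.exp (-(l * y))) := by simp only [F]; ring
    rw [e5, abs_le]
    constructor <;> linarith
  have hconst : ∀ y, x ≤ y → F y = F x := fun y hy => (eq_of_abs_sub_le_sq hF hx hy).symm
  have hlim : Tendsto F atTop (𝓝 0) := by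
    have h1 : Tendsto (fun x => Real.exp (-(l * x))) atTop (𝓝 0) :=
      Real.tendsto_exp_neg_atTop_nhds_zero.comp (tendsto_id.const_mul_atTop hl)
    simpa [F] using hq.sub (h1.const_mul (l₁ / l))
  have hFx : F x = 0 := tendsto_nhds_unique (tendsto_const_nhds.congr'
    ((eventually_ge_atTop x).mono fun y hy => (hconst y hy).symm)) hlim
  exact sub_eq_zero.1 hFx

/-! ### The first exit of a ray in terms of avoided sets -/

/-- The directions for which a shift by one moves the exit point by more than `y`. -/
def steepSet (v : Metric.sphere (0 : Euc n) 1) (y : ℝ) : Set (Metric.sphere (0 : Euc n) 1) :=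
  {u | y * inner ℝ (u : Euc n) (v : Euc n) < 1}

lemma measurableSet_steepSet (v : Metric.sphere (0 : Euc n) 1) (y : ℝ) :
    MeasurableSet (steepSet v y) :=
  measurableSet_lt (by fun_prop) measurable_const

open Classical in
-- Positive distances matter: a point of the smaller set then has a positive inner product with v,
-- and only for those do larger thresholds help.
lemma inter_exitSet_mono {T : Set (Metric.sphere (0 : Euc n) 1 × ℝ)} (hT : ∀ p ∈ T, 0 < p.2)
    (v : Metric.sphere (0 : Euc n) 1) (C : Set (Metric.sphere (0 : Euc n) 1)) {a a' b b' : ℝ}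
    (ha : 0 ≤ a) (haa : a ≤ a') (hb : 0 ≤ b) (hbb : b ≤ b') :
    T ∩ exitSet v C a b ⊆ T ∩ exitSet v C a' b' := by
  rintro p ⟨hp, h⟩
  refine ⟨hp, ?_⟩
  have hp0 := hT p hp
  rw [exitSet, mem_ofPred_eq] at h ⊢
  have hi : 0 < inner ℝ (p.1 : Euc n) (v : Euc n) := by
    by_contra hneg
    have h1 : 0 ≤ if p.1 ∈ C then a else b := by split_ifs <;> assumption
    have := mul_nonpos_of_nonneg_of_nonpos h1 (not_lt.1 hneg)
    linarith
  refine h.trans_le (mul_le_mul_of_nonneg_right ?_ hi.le)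
  split_ifs <;> assumption

namespace IsRegularSystem

variable {T : Set (Metric.sphere (0 : Euc n) 1 × ℝ)}

lemma le_rad_iff (hT : IsRegularSystem T) (v : Metric.sphere (0 : Euc n) 1)
    (C : Set (Metric.sphere (0 : Euc n) 1)) {a : ℝ} (ha : 0 ≤ a) :
    a ≤ rad (cell T 0) v ↔ T ∩ exitSet v C a a = ∅ := by
  obtain ⟨p, hp, hv, hmin, h0, -, -⟩ := hT.exists_rad_growthRate v
  rw [h0, le_div_iff₀ hv, eq_empty_iff_forall_notMem]
  simp only [exitSet, mem_inter_iff, mem_ofPred_eq, not_and, not_lt, ite_self]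
  constructor
  · intro h q hq
    rw [real_inner_comm]
    rcases lt_or_ge 0 (inner ℝ (v : Euc n) (q.1 : Euc n)) with h' | h'
    · rw [← le_div_iff₀ h']
      rw [← le_div_iff₀ hv] at h
      rcases hmin q hq h' with h1 | h1
      · exact h.trans h1.le
      · exact h.trans h1.1.le
    · exact (mul_nonpos_of_nonneg_of_nonpos ha h').trans (hT.pos q hq).le
  · intro h
    rw [real_inner_comm]
    exact h p hp

/-- The half-space left first has a steep normal and is left before b. The conclusion is a
difference of two nested void events and bounds the probability of the premise from above. -/
lemma exit_of_lt_growthRate (hT : IsRegularSystem T) (v : Metric.sphere (0 : Euc n) 1) {y a b : ℝ}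
    (ha : 0 ≤ a) (hy : y < growthRate T v) (har : a ≤ rad (cell T 0) v)
    (hrb : rad (cell T 0) v < b) :
    T ∩ exitSet v (steepSet v y) a a = ∅ ∧ T ∩ exitSet v (steepSet v y) b a ≠ ∅ := by
  refine ⟨(hT.le_rad_iff v _ ha).1 har, ?_⟩
  obtain ⟨p, hp, hv, hmin, h0, hg, -⟩ := hT.exists_rad_growthRate v
  rw [hg, lt_div_iff₀ hv, real_inner_comm] at hy
  rw [h0, div_lt_iff₀ hv, real_inner_comm] at hrb
  refine Nonempty.ne_empty ⟨p, hp, ?_⟩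
  rw [exitSet, mem_ofPred_eq, if_pos (show p.1 ∈ steepSet v y from hy)]
  exact hrb

/-- Something is left before b, but no half-space outside the steep set is, so the first exit is
steep. This bounds the probability from below; with `exit_of_lt_growthRate` it squeezes the joint
law. -/
lemma lt_growthRate_of_exit (hT : IsRegularSystem T) (v : Metric.sphere (0 : Euc n) 1) {y a b : ℝ}
    (ha : 0 ≤ a) (hab : a ≤ b) (h1 : T ∩ exitSet v (steepSet v y) a b = ∅)
    (h2 : T ∩ exitSet v (steepSet v y) b b ≠ ∅) :
    y < growthRate T v ∧ a ≤ rad (cell T 0) v ∧ rad (cell T 0) v < b := by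
  have hb : rad (cell T 0) v < b := by
    rw [ne_eq, ← hT.le_rad_iff v _ (ha.trans hab), not_le] at h2
    exact h2
  have ha' : a ≤ rad (cell T 0) v := by
    rw [hT.le_rad_iff v (steepSet v y) ha]
    exact subset_eq_empty (inter_exitSet_mono hT.pos v _ ha le_rfl ha hab) h1
  refine ⟨?_, ha', hb⟩
  obtain ⟨p, hp, hv, hmin, h0, hg, -⟩ := hT.exists_rad_growthRate v
  rw [hg, lt_div_iff₀ hv, real_inner_comm]
  by_contra hC
  rw [h0, div_lt_iff₀ hv, real_inner_comm] at hb
  have : p ∈ T ∩ exitSet v (steepSet v y) a b := by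
    refine ⟨hp, ?_⟩
    rw [exitSet, mem_ofPred_eq, if_neg (show p.1 ∉ steepSet v y from hC)]
    exact hb
  rw [h1] at this
  exact this

lemma tendsto_growthRate (hT : IsRegularSystem T) (v : Metric.sphere (0 : Euc n) 1) :
    Tendsto (fun k : ℕ => ((k : ℝ) + 1) * (rad (cell T (1 / ((k : ℝ) + 1))) v - rad (cell T 0) v))
      atTop (𝓝 (growthRate T v)) := by
  obtain ⟨p, hp, hv, hmin, h0, hg, he⟩ := hT.exists_rad_growthRate v
  have ht : Tendsto (fun k : ℕ => 1 / ((k : ℝ) + 1)) atTop (𝓝[≥] 0) :=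
    tendsto_nhdsWithin_iff.2 ⟨tendsto_one_div_add_atTop_nhds_zero_nat,
      Eventually.of_forall fun k => mem_Ici.2 (by positivity)⟩
  refine tendsto_const_nhds.congr' ?_
  filter_upwards [ht.eventually he] with k hk
  rw [hk]
  have : (k : ℝ) + 1 ≠ 0 := by positivity
  field_simp
  ring

lemma measurable_growthRate (hT : IsRegularSystem T) : Measurable (growthRate T) := by
  refine measurable_of_tendsto_metrizable (f := fun k : ℕ => fun v => ((k : ℝ) + 1) *
    (rad (cell T (1 / ((k : ℝ) + 1))) v - rad (cell T 0) v)) (fun k => ?_)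
    (tendsto_pi_nhds.2 fun v => hT.tendsto_growthRate v)
  exact ((measurable_rad (isClosed_cell T _).measurableSet).sub
    (measurable_rad (isClosed_cell T _).measurableSet)).const_mul _

end IsRegularSystem

namespace IsPoissonParam

variable {P : Measure Ω}
  {T : Ω → Set (Metric.sphere (0 : Euc n) 1 × ℝ)} {r γ : ℝ}

/-- The map f serves two uses: a fixed direction, and the product of the probability space with the
sphere. -/
lemma aemeasurable_rad_cell {μ : Measure (Metric.sphere (0 : Euc n) 1 × ℝ)}
    (hT : IsPoissonParam P T μ) {β : Type*} [MeasurableSpace β] {ν : Measure β}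
    {f : β → Ω × Metric.sphere (0 : Euc n) 1} (hf : Measurable f)
    (hreg : ∀ᵐ x ∂ν, IsRegularSystem (T (f x).1)) {s : ℝ} (hs : 0 ≤ s) :
    AEMeasurable (fun x => rad (cell (T (f x).1) s) (f x).2) ν := by
  refine ⟨_, (hT.measurable_rad_interior_cell s).comp hf, ?_⟩
  filter_upwards [hreg] with x hx
  exact (hx.rad_interior_cell hs _).symm

lemma aemeasurable_growthRate {μ : Measure (Metric.sphere (0 : Euc n) 1 × ℝ)}
    (hT : IsPoissonParam P T μ) {β : Type*} [MeasurableSpace β] {ν : Measure β}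
    {f : β → Ω × Metric.sphere (0 : Euc n) 1} (hf : Measurable f)
    (hreg : ∀ᵐ x ∂ν, IsRegularSystem (T (f x).1)) :
    AEMeasurable (fun x => growthRate (T (f x).1) (f x).2) ν := by
  refine aemeasurable_of_tendsto_metrizable_ae atTop (f := fun k : ℕ => fun x => ((k : ℝ) + 1) *
    (rad (cell (T (f x).1) (1 / ((k : ℝ) + 1))) (f x).2 - rad (cell (T (f x).1) 0) (f x).2))
    (fun k => ?_) ?_
  · exact ((hT.aemeasurable_rad_cell hf hreg (by positivity)).sub
      (hT.aemeasurable_rad_cell hf hreg le_rfl)).const_mul _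
  · filter_upwards [hreg] with x hx
    exact hx.tendsto_growthRate _

lemma measureReal_le_rad (hT : IsPoissonParam P T (paramIntensity n r γ)) (hn : 1 ≤ n)
    (hr : 0 < r) (hγ : 0 < γ) (v : Metric.sphere (0 : Euc n) 1) {a : ℝ} (ha : 0 ≤ a) :
    P.real {ω | a ≤ rad (cell (T ω) 0) v} = Real.exp (-(totalRate n r γ * a ^ r)) := by
  have h := hT.measureReal_avoid_exitSet hn hr hγ v MeasurableSet.univ ha ha
  rw [← mul_add, hitRate_add_compl hn hr v MeasurableSet.univ, mul_comm] at h
  rw [← h]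
  refine measureReal_congr ?_
  filter_upwards [hT.ae_isRegularSystem hn hr hγ] with ω hω
  exact propext (hω.le_rad_iff v univ ha)

lemma aemeasurable_rad (hT : IsPoissonParam P T (paramIntensity n r γ)) (hn : 1 ≤ n)
    (hr : 0 < r) (hγ : 0 < γ) (v : Metric.sphere (0 : Euc n) 1) :
    AEMeasurable (fun ω => rad (cell (T ω) 0) v) P :=
  hT.aemeasurable_rad_cell (f := fun ω => (ω, v)) measurable_prodMk_right
    (hT.ae_isRegularSystem hn hr hγ) le_rfl

lemma aemeasurable_rate (hT : IsPoissonParam P T (paramIntensity n r γ)) (hn : 1 ≤ n)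
    (hr : 0 < r) (hγ : 0 < γ) (v : Metric.sphere (0 : Euc n) 1) :
    AEMeasurable (fun ω => growthRate (T ω) v) P :=
  hT.aemeasurable_growthRate (f := fun ω => (ω, v)) measurable_prodMk_right
    (hT.ae_isRegularSystem hn hr hγ)

lemma measureReal_exit_le [IsFiniteMeasure P] (hT : IsPoissonParam P T (paramIntensity n r γ))
    (hn : 1 ≤ n) (hr : 0 < r) (hγ : 0 < γ) (v : Metric.sphere (0 : Euc n) 1) (y : ℝ) {a b : ℝ}
    (ha : 0 ≤ a) (hab : a ≤ b) :
    P.real {ω | y < growthRate (T ω) v ∧ a ≤ rad (cell (T ω) 0) v ∧ rad (cell (T ω) 0) v < b} ≤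
      Real.exp (-(totalRate n r γ * a ^ r)) - Real.exp (-(hitRate r γ v (steepSet v y) * b ^ r +
        hitRate r γ v (steepSet v y)ᶜ * a ^ r)) := by
  have hCm := measurableSet_steepSet v y
  have hE := hT.measurableSet_avoid _ (measurableSet_exitSet v hCm b a)
  have h1 := hT.measureReal_avoid_exitSet hn hr hγ v hCm ha ha
  have h2 := hT.measureReal_avoid_exitSet hn hr hγ v hCm (ha.trans hab) ha
  rw [← mul_add, hitRate_add_compl hn hr v hCm, mul_comm] at h1
  rw [mul_comm (b ^ r), mul_comm (a ^ r)] at h2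
  have hsub : {ω | T ω ∩ exitSet v (steepSet v y) b a = ∅} ⊆
      {ω | T ω ∩ exitSet v (steepSet v y) a a = ∅} := fun ω h => subset_eq_empty
    (inter_exitSet_mono (hT.pos ω) v _ ha hab ha le_rfl) h
  rw [← h1, ← h2, ← measureReal_sdiff hsub hE]
  refine ENNReal.toReal_mono (measure_ne_top _ _) (measure_mono_ae ?_)
  filter_upwards [hT.ae_isRegularSystem hn hr hγ] with ω hω h
  exact hω.exit_of_lt_growthRate v ha h.1 h.2.1 h.2.2

lemma le_measureReal_exit [IsFiniteMeasure P] (hT : IsPoissonParam P T (paramIntensity n r γ))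
    (hn : 1 ≤ n) (hr : 0 < r) (hγ : 0 < γ) (v : Metric.sphere (0 : Euc n) 1) (y : ℝ) {a b : ℝ}
    (ha : 0 ≤ a) (hab : a ≤ b) :
    Real.exp (-(hitRate r γ v (steepSet v y) * a ^ r +
        hitRate r γ v (steepSet v y)ᶜ * b ^ r)) - Real.exp (-(totalRate n r γ * b ^ r)) ≤
    P.real {ω | y < growthRate (T ω) v ∧ a ≤ rad (cell (T ω) 0) v ∧
      rad (cell (T ω) 0) v < b} := by
  have hCm := measurableSet_steepSet v y
  have hE := hT.measurableSet_avoid _ (measurableSet_exitSet v hCm b b)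
  have h1 := hT.measureReal_avoid_exitSet hn hr hγ v hCm ha (ha.trans hab)
  have h2 := hT.measureReal_avoid_exitSet hn hr hγ v hCm (ha.trans hab) (ha.trans hab)
  rw [← mul_add, hitRate_add_compl hn hr v hCm, mul_comm] at h2
  rw [mul_comm (b ^ r), mul_comm (a ^ r)] at h1
  have hsub : {ω | T ω ∩ exitSet v (steepSet v y) b b = ∅} ⊆
      {ω | T ω ∩ exitSet v (steepSet v y) a b = ∅} := fun ω h => subset_eq_empty
    (inter_exitSet_mono (hT.pos ω) v _ ha hab (ha.trans hab) le_rfl) h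
  rw [← h1, ← h2, ← measureReal_sdiff hsub hE]
  refine ENNReal.toReal_mono (measure_ne_top _ _) (measure_mono_ae ?_)
  filter_upwards [hT.ae_isRegularSystem hn hr hγ] with ω hω h
  exact hω.lt_growthRate_of_exit v ha hab h.1 h.2

lemma measureReal_sub_eq [IsFiniteMeasure P] {ρ g : Ω → ℝ} (hρ : AEMeasurable ρ P)
    (hg : AEMeasurable g P) (y : ℝ) {a b : ℝ} (hab : a ≤ b) :
    P.real {ω | y < g ω ∧ a ≤ ρ ω} - P.real {ω | y < g ω ∧ b ≤ ρ ω} =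
      P.real {ω | y < g ω ∧ a ≤ ρ ω ∧ ρ ω < b} := by
  have hnm : NullMeasurableSet {ω | y < g ω ∧ b ≤ ρ ω} P :=
    (nullMeasurableSet_lt aemeasurable_const hg).inter (nullMeasurableSet_le aemeasurable_const hρ)
  have hu := measureReal_union₀ (μ := P) (s := {ω | y < g ω ∧ a ≤ ρ ω ∧ ρ ω < b}) hnm
    (Disjoint.aedisjoint (Set.disjoint_left.2 fun ω h1 h2 => absurd h1.2.2 (not_lt.2 h2.2)))
  have e : {ω | y < g ω ∧ a ≤ ρ ω ∧ ρ ω < b} ∪ {ω | y < g ω ∧ b ≤ ρ ω} =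
      {ω | y < g ω ∧ a ≤ ρ ω} := by
    ext ω
    simp only [mem_union, mem_ofPred_eq]
    constructor
    · rintro (h | h)
      · exact ⟨h.1, h.2.1⟩
      · exact ⟨h.1, hab.trans h.2⟩
    · rintro h
      rcases lt_or_ge (ρ ω) b with h' | h'
      · exact Or.inl ⟨h.1, h.2, h'⟩
      · exact Or.inr ⟨h.1, h'⟩
  rw [e] at hu
  rw [hu]
  ring

/-- The joint law of radius and growth rate in a given direction. -/
lemma measureReal_lt_growthRate_le_rad [IsFiniteMeasure P]
    (hT : IsPoissonParam P T (paramIntensity n r γ))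
    (hn : 1 ≤ n) (hr : 0 < r) (hγ : 0 < γ) (v : Metric.sphere (0 : Euc n) 1) (y : ℝ) {a : ℝ}
    (ha : 0 ≤ a) : P.real {ω | y < growthRate (T ω) v ∧ a ≤ rad (cell (T ω) 0) v} =
      hitRate r γ v (steepSet v y) / totalRate n r γ *
        Real.exp (-(totalRate n r γ * a ^ r)) := by
  have hsum := hitRate_add_compl (γ := γ) hn hr v (measurableSet_steepSet v y)
  have htot := totalRate_pos hn hr hγ
  have hpow : ∀ x : ℝ, 0 ≤ x → (x ^ (1 / r)) ^ r = x := fun x hx => by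
    rw [← Real.rpow_mul hx, one_div_mul_cancel hr.ne', Real.rpow_one]
  have hb : (a ^ r) ^ (1 / r) = a := by
    rw [← Real.rpow_mul ha, mul_one_div_cancel hr.ne', Real.rpow_one]
  -- The substitution x = a^r turns the Weibull tails into exponential ones, with the rates of the
  -- steep and the other half-spaces as l₁ and l₂.
  have hmain := eq_of_competing_risks
    (q := fun x => P.real {ω | y < growthRate (T ω) v ∧ x ^ (1 / r) ≤ rad (cell (T ω) 0) v})
    (hitRate_nonneg hn hr hγ v (steepSet v y)) (by rw [hsum]; exact htot) ?_ ?_ ?_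
    (x := a ^ r) (by positivity)
  · rwa [hsum, hb] at hmain
  · have h1 : Tendsto (fun x => Real.exp (-(totalRate n r γ * x))) atTop (𝓝 0) :=
      Real.tendsto_exp_neg_atTop_nhds_zero.comp (tendsto_id.const_mul_atTop htot)
    refine squeeze_zero' (Eventually.of_forall fun x => measureReal_nonneg) ?_ h1
    filter_upwards [eventually_ge_atTop 0] with x hx
    have := hT.measureReal_le_rad hn hr hγ v (a := x ^ (1 / r)) (by positivity)
    rw [hpow x hx] at this
    rw [← this]
    exact measureReal_mono fun ω h => h.2
  · intro x z hx hxz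
    have hz : x ^ (1 / r) ≤ z ^ (1 / r) := Real.rpow_le_rpow hx hxz (by positivity)
    have := hT.measureReal_exit_le hn hr hγ v y (Real.rpow_nonneg hx _) hz
    rw [hpow x hx, hpow z (hx.trans hxz)] at this
    rwa [measureReal_sub_eq (hT.aemeasurable_rad hn hr hγ v) (hT.aemeasurable_rate hn hr hγ v) y hz,
      hsum]
  · intro x z hx hxz
    have hz : x ^ (1 / r) ≤ z ^ (1 / r) := Real.rpow_le_rpow hx hxz (by positivity)
    have := hT.le_measureReal_exit hn hr hγ v y (Real.rpow_nonneg hx _) hz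
    rw [hpow x hx, hpow z (hx.trans hxz)] at this
    rwa [measureReal_sub_eq (hT.aemeasurable_rad hn hr hγ v) (hT.aemeasurable_rate hn hr hγ v) y hz,
      hsum]

end IsPoissonParam

end PoissonPolyhedra

/-! ## Moments of radius and growth rate -/

namespace PoissonPolyhedra

variable {n : ℕ} {Ω : Type*} [MeasurableSpace Ω]

/-- Moments of a function with Weibull tails. -/
lemma lintegral_pow_of_tail {μ : Measure Ω} {ρ : Ω → ℝ} (hρ : AEMeasurable ρ μ)
    (h0 : ∀ ω, 0 ≤ ρ ω) {l r κ : ℝ} (hl : 0 < l) (hr : 0 < r) (hκ : 0 ≤ κ) {m : ℕ} (hm : 1 ≤ m)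
    (h : ∀ t, 0 < t → μ {ω | t ≤ ρ ω} = ENNReal.ofReal (κ * Real.exp (-(l * t ^ r)))) :
    ∫⁻ ω, ENNReal.ofReal (ρ ω ^ m) ∂μ =
      ENNReal.ofReal (κ * (l ^ (-(m : ℝ) / r) * Real.Gamma (m / r + 1))) := by
  have hm' : (0 : ℝ) < m := by exact_mod_cast hm
  have e := lintegral_rpow_eq_lintegral_meas_le_mul μ (Eventually.of_forall h0) hρ hm'
  simp only [Real.rpow_natCast] at e
  have e2 : ∫⁻ t in Ioi (0 : ℝ), μ {ω | t ≤ ρ ω} * ENNReal.ofReal (t ^ ((m : ℝ) - 1)) =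
      ENNReal.ofReal κ * ∫⁻ t in Ioi (0 : ℝ),
        ENNReal.ofReal (t ^ ((m : ℝ) - 1) * Real.exp (-l * t ^ r)) := by
    rw [← lintegral_const_mul _ (by fun_prop)]
    refine setLIntegral_congr_fun measurableSet_Ioi fun t ht => ?_
    have ht' : (0 : ℝ) < t := ht
    rw [h t ht', ENNReal.ofReal_mul hκ, ENNReal.ofReal_mul (by positivity), neg_mul]
    ring
  rw [e, e2, lintegral_rpow_mul_exp_neg_mul_rpow hr (by linarith) hl,
    ← ENNReal.ofReal_mul hκ, ← ENNReal.ofReal_mul hm'.le, sub_add_cancel,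
    Real.Gamma_add_one (by positivity)]
  congr 1
  field_simp

lemma ofReal_hitRate (hn : 1 ≤ n) {r γ : ℝ} (hr : 0 < r) (hγ : 0 < γ)
    (v : Metric.sphere (0 : Euc n) 1) (C : Set (Metric.sphere (0 : Euc n) 1)) :
    ENNReal.ofReal (hitRate r γ v C) = ENNReal.ofReal (2 * γ / (omega n * r)) *
      ∫⁻ u in C, posRpow r (inner ℝ (u : Euc n) (v : Euc n))
        ∂(volume : Measure (Euc n)).toSphere := by
  have ho : 0 < omega n := omega_pos (by exact_mod_cast hn)
  rw [hitRate, ENNReal.ofReal_mul (by positivity),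
    ENNReal.ofReal_toReal (setLIntegral_posRpow_ne_top hn (by linarith) v C)]

/-- The y-interval has length 1/x, which lowers the exponent by one; this is how the moment of order
r - 1 enters the expected growth rate. -/
lemma posRpow_mul_volume (r x : ℝ) :
    posRpow r x * volume ({y : ℝ | y * x < 1} ∩ Ioi 0) = posRpow (r - 1) x := by
  rcases lt_or_ge 0 x with hx | hx
  · have : {y : ℝ | y * x < 1} ∩ Ioi 0 = Ioo 0 (1 / x) := by
      ext y
      simp only [mem_inter_iff, mem_ofPred_eq, mem_Ioi, mem_Ioo, lt_div_iff₀ hx]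
      exact and_comm
    rw [this, Real.volume_Ioo, posRpow_of_pos r hx, posRpow_of_pos _ hx,
      ← ENNReal.ofReal_mul (by positivity), Real.rpow_sub_one hx.ne']
    congr 1
    ring
  · rw [posRpow_of_nonpos r hx, posRpow_of_nonpos _ hx, zero_mul]

/-- Integration of the hitting rates over the steepness. -/
lemma lintegral_hitRate_steepSet (hn : 1 ≤ n) {r γ : ℝ} (hr : 0 < r) (hγ : 0 < γ)
    (v : Metric.sphere (0 : Euc n) 1) :
    ∫⁻ y in Ioi (0 : ℝ), ENNReal.ofReal (hitRate r γ v (steepSet v y)) =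
      ENNReal.ofReal (2 * γ / (omega n * r) * sphereMoment n (r - 1)) := by
  have ho : 0 < omega n := omega_pos (by exact_mod_cast hn)
  have hset : MeasurableSet {q : ℝ × Metric.sphere (0 : Euc n) 1 |
      q.1 * inner ℝ (q.2 : Euc n) (v : Euc n) < 1} :=
    measurableSet_lt (by fun_prop) measurable_const
  have hm : Measurable fun q : ℝ × Metric.sphere (0 : Euc n) 1 =>
      {q : ℝ × Metric.sphere (0 : Euc n) 1 | q.1 * inner ℝ (q.2 : Euc n) (v : Euc n) < 1}.indicator
        (fun q => posRpow r (inner ℝ (q.2 : Euc n) (v : Euc n))) q :=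
    ((measurable_posRpow_inner r v).comp measurable_snd).indicator hset
  have e1 : ∀ y : ℝ, ENNReal.ofReal (hitRate r γ v (steepSet v y)) =
      ENNReal.ofReal (2 * γ / (omega n * r)) * ∫⁻ u : Metric.sphere (0 : Euc n) 1,
        {q : ℝ × Metric.sphere (0 : Euc n) 1 |
          q.1 * inner ℝ (q.2 : Euc n) (v : Euc n) < 1}.indicator
        (fun q => posRpow r (inner ℝ (q.2 : Euc n) (v : Euc n))) (y, u)
        ∂(volume : Measure (Euc n)).toSphere := by
    intro y
    rw [ofReal_hitRate hn hr hγ, ← lintegral_indicator (measurableSet_steepSet v y)]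
    rfl
  rw [lintegral_congr e1, lintegral_const_mul _ hm.lintegral_prod_right',
    ENNReal.ofReal_mul (by positivity), ← lintegral_sphere_posRpow hn v (by linarith),
    lintegral_lintegral_swap hm.aemeasurable]
  congr 1
  refine lintegral_congr fun u => ?_
  rw [← posRpow_mul_volume r]
  have hy : MeasurableSet {y : ℝ | y * inner ℝ (u : Euc n) (v : Euc n) < 1} :=
    measurableSet_lt (by fun_prop) measurable_const
  have e2 : ∀ y : ℝ, {q : ℝ × Metric.sphere (0 : Euc n) 1 |
      q.1 * inner ℝ (q.2 : Euc n) (v : Euc n) < 1}.indicator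
      (fun q => posRpow r (inner ℝ (q.2 : Euc n) (v : Euc n))) (y, u) =
      {y : ℝ | y * inner ℝ (u : Euc n) (v : Euc n) < 1}.indicator
        (fun _ => posRpow r (inner ℝ (u : Euc n) (v : Euc n))) y := fun y => rfl
  rw [lintegral_congr e2, lintegral_indicator hy, setLIntegral_const,
    Measure.restrict_apply hy]

namespace IsPoissonParam

variable {P : Measure Ω} [IsProbabilityMeasure P]
  {T : Ω → Set (Metric.sphere (0 : Euc n) 1 × ℝ)} {r γ : ℝ}

lemma lintegral_rad_pow (hT : IsPoissonParam P T (paramIntensity n r γ)) (hn : 1 ≤ n)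
    (hr : 0 < r) (hγ : 0 < γ) (v : Metric.sphere (0 : Euc n) 1) {m : ℕ} (hm : 1 ≤ m) :
    ∫⁻ ω, ENNReal.ofReal (rad (cell (T ω) 0) v ^ m) ∂P =
      ENNReal.ofReal (totalRate n r γ ^ (-(m : ℝ) / r) * Real.Gamma (m / r + 1)) := by
  have := lintegral_pow_of_tail (μ := P) (κ := 1) (hT.aemeasurable_rad hn hr hγ v)
    (fun ω => rad_nonneg _ _) (totalRate_pos hn hr hγ) hr zero_le_one hm fun t ht => by
      rw [one_mul, ← hT.measureReal_le_rad hn hr hγ v ht.le, ofReal_measureReal]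
  rwa [one_mul] at this

/-- Radius and growth rate in a given direction are uncorrelated. -/
lemma lintegral_rad_pow_mul_growthRate (hT : IsPoissonParam P T (paramIntensity n r γ))
    (hn : 1 ≤ n) (hr : 0 < r) (hγ : 0 < γ) (v : Metric.sphere (0 : Euc n) 1) {m : ℕ}
    (hm : 1 ≤ m) :
    ∫⁻ ω, ENNReal.ofReal (rad (cell (T ω) 0) v ^ m) * ENNReal.ofReal (growthRate (T ω) v) ∂P =
      ENNReal.ofReal (totalRate n r γ ^ (-(m : ℝ) / r) * Real.Gamma (m / r + 1) *
        (sphereMoment n (r - 1) / sphereMoment n r)) := by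
  have ho : 0 < omega n := omega_pos (by exact_mod_cast hn)
  have htot := totalRate_pos hn hr hγ
  have hG := Real.Gamma_pos_of_pos (show 0 < (m : ℝ) / r + 1 by positivity)
  have hs := sphereMoment_pos hn (show -1 < r by linarith)
  have hmr := hT.aemeasurable_rad hn hr hγ v
  have hmg := hT.aemeasurable_rate hn hr hγ v
  have hf : AEMeasurable (fun ω => ENNReal.ofReal (rad (cell (T ω) 0) v ^ m)) P :=
    (hmr.pow_const m).ennreal_ofReal
  -- The mixed moment is the integral of the growth rate against ν, hence ∫ ν(g > y) dy by the
  -- layer-cake formula, and the joint law determines each ν(g > y).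
  set ν := P.withDensity fun ω => ENNReal.ofReal (rad (cell (T ω) 0) v ^ m) with hν
  have hνP : ν ≪ P := withDensity_absolutelyContinuous _ _
  have hpos : 0 ≤ᵐ[ν] fun ω => growthRate (T ω) v := by
    filter_upwards [hνP.ae_le (hT.ae_isRegularSystem hn hr hγ)] with ω hω
    exact (hω.growthRate_pos v).le
  have hslice : ∀ y : ℝ, ν {ω | y < growthRate (T ω) v} =
      ENNReal.ofReal (totalRate n r γ ^ (-(m : ℝ) / r) * Real.Gamma (m / r + 1) /
        totalRate n r γ) * ENNReal.ofReal (hitRate r γ v (steepSet v y)) := by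
    intro y
    have hnm : NullMeasurableSet {ω | y < growthRate (T ω) v} P :=
      nullMeasurableSet_lt aemeasurable_const hmg
    have hh := hitRate_nonneg hn hr hγ v (steepSet v y)
    rw [hν, withDensity_apply₀ _ hnm, lintegral_pow_of_tail hmr.restrict (fun ω => rad_nonneg _ _)
      htot hr (div_nonneg hh htot.le) hm, ← ENNReal.ofReal_mul (by positivity)]
    · congr 1
      ring
    · intro t ht
      rw [Measure.restrict_apply₀
        ((nullMeasurableSet_le aemeasurable_const hmr).mono Measure.restrict_le_self),
        ← hT.measureReal_lt_growthRate_le_rad hn hr hγ v y ht.le, ofReal_measureReal, inter_comm]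
      rfl
  have h1 := lintegral_eq_lintegral_meas_lt ν hpos (hmg.mono_ac hνP)
  -- Measurability in y comes from monotonicity: up to a positive constant this is the tail ν(g >
  -- y).
  have hmh : Measurable fun y : ℝ => ENNReal.ofReal (hitRate r γ v (steepSet v y)) := by
    have : Antitone fun y : ℝ => ν {ω | y < growthRate (T ω) v} := fun y z hyz =>
      measure_mono fun ω h => lt_of_le_of_lt hyz h
    have hc : ENNReal.ofReal (totalRate n r γ ^ (-(m : ℝ) / r) * Real.Gamma (m / r + 1) /
        totalRate n r γ) ≠ 0 := by
      rw [ne_eq, ENNReal.ofReal_eq_zero, not_le]; positivity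
    have h2 := this.measurable.const_mul (ENNReal.ofReal (totalRate n r γ ^ (-(m : ℝ) / r) *
      Real.Gamma (m / r + 1) / totalRate n r γ))⁻¹
    convert h2 using 1
    funext y
    rw [hslice, ← mul_assoc, ENNReal.inv_mul_cancel hc ENNReal.ofReal_ne_top, one_mul]
  rw [hν, lintegral_withDensity_eq_lintegral_mul₀ hf hmg.ennreal_ofReal, ← hν,
    lintegral_congr hslice, lintegral_const_mul _ hmh,
    lintegral_hitRate_steepSet hn hr hγ, ← ENNReal.ofReal_mul (by positivity)] at h1
  rw [show (fun ω => ENNReal.ofReal (rad (cell (T ω) 0) v ^ m) *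
    ENNReal.ofReal (growthRate (T ω) v)) = (fun ω => ENNReal.ofReal (rad (cell (T ω) 0) v ^ m)) *
    fun ω => ENNReal.ofReal (growthRate (T ω) v) from rfl, h1]
  congr 1
  generalize totalRate n r γ ^ (-(m : ℝ) / r) * Real.Gamma (m / r + 1) = A
  rw [totalRate]
  field_simp

end IsPoissonParam

end PoissonPolyhedra

/-! ## Expected intrinsic volumes of the zero cell -/

namespace PoissonPolyhedra

variable {n : ℕ}

lemma volume_real_ball_one (hn : 1 ≤ n) :
    (volume : Measure (Euc n)).real (Metric.ball 0 1) = kappa n := by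
  have : Nonempty (Fin n) := ⟨⟨0, hn⟩⟩
  rw [measureReal_def, EuclideanSpace.volume_ball, Fintype.card_fin, ENNReal.ofReal_one, one_pow,
    one_mul, ENNReal.toReal_ofReal, kappa]
  · rw [Real.sqrt_eq_rpow, ← Real.rpow_natCast, ← Real.rpow_mul Real.pi_pos.le]
    congr 2
    ring
  · have := Real.Gamma_pos_of_pos (show (0 : ℝ) < n / 2 + 1 by positivity)
    positivity

lemma toSphere_univ (hn : 1 ≤ n) :
    (volume : Measure (Euc n)).toSphere univ = ENNReal.ofReal (n * kappa n) := by
  rw [← ofReal_measureReal, Measure.toSphere_real_apply_univ, volume_real_ball_one hn,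
    finrank_euclideanSpace, Fintype.card_fin]

lemma sphereMoment_sub_one_div {r : ℝ} (hn : 1 ≤ n) (hr : 0 < r) :
    sphereMoment n (r - 1) / sphereMoment n r =
      Real.Gamma (r / 2) * Real.Gamma ((n + r) / 2) /
        (Real.Gamma ((r + 1) / 2) * Real.Gamma ((n + r - 1) / 2)) := by
  have hn' : (1 : ℝ) ≤ n := by exact_mod_cast hn
  have h1 := Real.Gamma_pos_of_pos (show 0 < (r + 1) / 2 by positivity)
  have h2 := Real.Gamma_pos_of_pos (show 0 < (n + r) / 2 by positivity)
  have h3 := Real.Gamma_pos_of_pos (show 0 < (n + r - 1) / 2 by linarith)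
  have h4 : 0 < Real.pi ^ (((n : ℝ) - 1) / 2) := Real.rpow_pos_of_pos Real.pi_pos _
  rw [sphereMoment, sphereMoment, sub_add_cancel, ← add_sub_assoc]
  field_simp

/-! ### The unit ball -/

lemma volume_real_cthickening_closedBall (hn : 1 ≤ n) {s : ℝ} (hs : 0 ≤ s) :
    (volume : Measure (Euc n)).real (Metric.cthickening s (Metric.closedBall 0 1)) =
      (1 + s) ^ n * kappa n := by
  rw [cthickening_closedBall hs zero_le_one, measureReal_def,
    Measure.addHaar_closedBall _ _ (by positivity), ENNReal.toReal_mul,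
    ENNReal.toReal_ofReal (by positivity), finrank_euclideanSpace, Fintype.card_fin,
    ← measureReal_def, volume_real_ball_one hn, add_comm]

lemma intrinsicVolume_top_closedBall (hn : 1 ≤ n) :
    intrinsicVolume n (Metric.closedBall (0 : Euc n) 1) = kappa n := by
  rw [intrinsicVolume_top, ← Metric.cthickening_zero,
    volume_real_cthickening_closedBall hn le_rfl]
  simp

lemma intrinsicVolume_pred_closedBall (hn : 1 ≤ n) :
    intrinsicVolume (n - 1) (Metric.closedBall (0 : Euc n) 1) = n * kappa n / 2 := by
  refine intrinsicVolume_pred hn ?_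
  have h : HasDerivAt (fun s : ℝ => (1 + s) ^ n * kappa n) (n * kappa n) 0 := by
    simpa using (((hasDerivAt_id (0 : ℝ)).const_add 1).pow n).mul_const (kappa n)
  exact h.hasDerivWithinAt.congr (fun s hs => volume_real_cthickening_closedBall hn hs)
    (volume_real_cthickening_closedBall hn le_rfl)

lemma isoperimetricRatio_closedBall {Ω : Type*} [MeasurableSpace Ω] (P : Measure Ω)
    [IsProbabilityMeasure P] (hn : 1 ≤ n) :
    isoperimetricRatio P (fun _ => Metric.closedBall (0 : Euc n) 1) =
      (n * kappa n / 2) ^ ((n : ℝ) / ((n : ℝ) - 1)) / kappa n := by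
  simp [isoperimetricRatio, intrinsicVolume_top_closedBall hn, intrinsicVolume_pred_closedBall hn]

/-! ### Intrinsic volumes of the zero cell -/

section

variable {T : Set (Metric.sphere (0 : Euc n) 1 × ℝ)}

lemma IsRegularSystem.intrinsicVolume_top_cell (hT : IsRegularSystem T) (hn : 1 ≤ n) :
    intrinsicVolume n (cell T 0) =
      (∫⁻ v, ENNReal.ofReal (rad (cell T 0) v ^ n) ∂(volume : Measure (Euc n)).toSphere).toReal /
        n := by
  obtain ⟨R, hR⟩ := hT.bounded
  have hn' : (0 : ℝ) < n := by exact_mod_cast hn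
  have e : ∀ v : Metric.sphere (0 : Euc n) 1, ENNReal.ofReal (rad (cell T 0) v ^ n / n) =
      ENNReal.ofReal (1 / n) * ENNReal.ofReal (rad (cell T 0) v ^ n) := fun v => by
    rw [← ENNReal.ofReal_mul (by positivity)]
    congr 1
    ring
  rw [intrinsicVolume_top, (isClosed_cell T 0).closure_eq, measureReal_def,
    volume_eq_lintegral_rad hn (isClosed_cell T 0).measurableSet (hT.starConvex_cell le_rfl) hR,
    lintegral_congr e, lintegral_const_mul', ENNReal.toReal_mul,
    ENNReal.toReal_ofReal (by positivity)]
  · ring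
  · exact ENNReal.ofReal_ne_top

lemma IsRegularSystem.intrinsicVolume_pred_cell (hT : IsRegularSystem T) (hn : 1 ≤ n) :
    intrinsicVolume (n - 1) (cell T 0) =
      (∫⁻ v, ENNReal.ofReal (rad (cell T 0) v ^ (n - 1)) * ENNReal.ofReal (growthRate T v)
        ∂(volume : Measure (Euc n)).toSphere).toReal / 2 := by
  have h0 : ∀ v, 0 ≤ rad (cell T 0) v ^ (n - 1) := fun v => pow_nonneg (rad_nonneg _ _) _
  rw [intrinsicVolume_pred hn (hT.hasDerivWithinAt_volume_cthickening hn),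
    integral_eq_lintegral_of_nonneg_ae]
  · simp_rw [ENNReal.ofReal_mul (h0 _)]
  · exact Eventually.of_forall fun v => mul_nonneg (h0 v) (hT.growthRate_pos v).le
  · exact (((measurable_rad (isClosed_cell T 0).measurableSet).pow_const _).mul
      hT.measurable_growthRate).aestronglyMeasurable

end

/-- A random variable that is almost surely `c⁻¹` times the integral over the sphere of a
nonnegative random function with constant expectation. -/
lemma integrable_and_integral_of_lintegral_sphere {Ω : Type*} [MeasurableSpace Ω] {P : Measure Ω}
    [IsProbabilityMeasure P] (hn : 1 ≤ n) {F : Ω → Metric.sphere (0 : Euc n) 1 → ENNReal}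
    (hF : AEMeasurable (Function.uncurry F) (P.prod (volume : Measure (Euc n)).toSphere))
    {a c : ℝ} (ha : 0 ≤ a) (hv : ∀ v, ∫⁻ ω, F ω v ∂P = ENNReal.ofReal a) {V : Ω → ℝ}
    (hV : ∀ᵐ ω ∂P, V ω = (∫⁻ v, F ω v ∂(volume : Measure (Euc n)).toSphere).toReal / c) :
    Integrable V P ∧ ∫ ω, V ω ∂P = a * (n * kappa n) / c := by
  have hk : 0 < kappa n := kappa_pos n.cast_nonneg
  have hI : ∫⁻ ω, ∫⁻ v, F ω v ∂(volume : Measure (Euc n)).toSphere ∂P =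
      ENNReal.ofReal (a * (n * kappa n)) := by
    rw [lintegral_lintegral_swap hF, lintegral_congr hv, lintegral_const, toSphere_univ hn,
      ← ENNReal.ofReal_mul ha]
  have hm : AEMeasurable (fun ω => ∫⁻ v, F ω v ∂(volume : Measure (Euc n)).toSphere) P :=
    hF.lintegral_prod_right'
  have hfin : ∫⁻ ω, ∫⁻ v, F ω v ∂(volume : Measure (Euc n)).toSphere ∂P ≠ ⊤ :=
    hI ▸ ENNReal.ofReal_ne_top
  refine ⟨((integrable_toReal_of_lintegral_ne_top hm hfin).div_const c).congr
    (hV.mono fun ω h => h.symm), ?_⟩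
  rw [integral_congr_ae hV, integral_div, integral_toReal hm (ae_lt_top' hm hfin), hI,
    ENNReal.toReal_ofReal (by positivity)]

namespace IsPoissonHyperplaneProcess

variable {Ω : Type*} [MeasurableSpace Ω] {P : Measure Ω} [IsProbabilityMeasure P]
  {X : Ω → Set (Hyperplane n)} {r γ : ℝ}

lemma integral_intrinsicVolume_top (hX : IsPoissonHyperplaneProcess P X (Theta n r γ))
    (hn : 1 ≤ n) (hr : 0 < r) (hγ : 0 < γ) :
    Integrable (fun ω => intrinsicVolume n (zeroCell (X ω))) P ∧
      ∫ ω, intrinsicVolume n (zeroCell (X ω)) ∂P =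
        kappa n * Real.Gamma (n / r + 1) * totalRate n r γ ^ (-(n : ℝ) / r) := by
  have hT := hX.isPoissonParam
  have hreg := hT.ae_isRegularSystem hn hr hγ
  have hreg' := (Measure.quasiMeasurePreserving_fst (μ := P)
    (ν := (volume : Measure (Euc n)).toSphere)).ae hreg
  have hΓ := Real.Gamma_pos_of_pos (show 0 < n / r + 1 by positivity)
  have hl := totalRate_pos hn hr hγ
  have hn' : (0 : ℝ) < n := by exact_mod_cast hn
  obtain ⟨h1, h2⟩ := integrable_and_integral_of_lintegral_sphere hn
    (F := fun ω v => ENNReal.ofReal (rad (cell (posParam (X ω)) 0) v ^ n)) (c := n)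
    ((hT.aemeasurable_rad_cell measurable_id hreg' le_rfl).pow_const n).ennreal_ofReal
    (by positivity) (fun v => hT.lintegral_rad_pow hn hr hγ v hn)
    (V := fun ω => intrinsicVolume n (zeroCell (X ω))) (by
      filter_upwards [hreg, hX.ae_zeroCell_eq] with ω h h'
      rw [h', h.intrinsicVolume_top_cell hn])
  refine ⟨h1, h2.trans ?_⟩
  field_simp

lemma integral_intrinsicVolume_pred (hX : IsPoissonHyperplaneProcess P X (Theta n r γ))
    (hn : 2 ≤ n) (hr : 0 < r) (hγ : 0 < γ) :
    Integrable (fun ω => intrinsicVolume (n - 1) (zeroCell (X ω))) P ∧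
      ∫ ω, intrinsicVolume (n - 1) (zeroCell (X ω)) ∂P =
        n * kappa n / 2 * Real.Gamma (((n : ℝ) - 1) / r + 1) *
          (sphereMoment n (r - 1) / sphereMoment n r) *
            totalRate n r γ ^ (-((n : ℝ) - 1) / r) := by
  have hn1 : 1 ≤ n := by omega
  have hT := hX.isPoissonParam
  have hreg := hT.ae_isRegularSystem hn1 hr hγ
  have hreg' := (Measure.quasiMeasurePreserving_fst (μ := P)
    (ν := (volume : Measure (Euc n)).toSphere)).ae hreg
  have hΓ := Real.Gamma_pos_of_pos (show 0 < ((n - 1 : ℕ) : ℝ) / r + 1 by positivity)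
  have hl := totalRate_pos hn1 hr hγ
  have hs1 := sphereMoment_pos hn1 (show -1 < r - 1 by linarith)
  have hs2 := sphereMoment_pos hn1 (show -1 < r by linarith)
  obtain ⟨h1, h2⟩ := integrable_and_integral_of_lintegral_sphere hn1
    (F := fun ω v => ENNReal.ofReal (rad (cell (posParam (X ω)) 0) v ^ (n - 1)) *
      ENNReal.ofReal (growthRate (posParam (X ω)) v)) (c := 2)
    (((hT.aemeasurable_rad_cell measurable_id hreg' le_rfl).pow_const (n - 1)).ennreal_ofReal.mul
      (hT.aemeasurable_growthRate measurable_id hreg').ennreal_ofReal)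
    (by positivity)
    -- The moment has order n - 1, which is positive because n ≥ 2.
    (fun v => hT.lintegral_rad_pow_mul_growthRate hn1 hr hγ v (show 1 ≤ n - 1 by omega))
    (V := fun ω => intrinsicVolume (n - 1) (zeroCell (X ω))) (by
      filter_upwards [hreg, hX.ae_zeroCell_eq] with ω h h'
      rw [h', h.intrinsicVolume_pred_cell hn1])
  refine ⟨h1, h2.trans ?_⟩
  rw [Nat.cast_sub hn1, Nat.cast_one]
  ring

/-- Because (n-1)/r · n/(n-1) = n/r, numerator and denominator carry the same power of `totalRate`.
The intensity enters through this factor alone, so the ratio is free of γ. -/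
theorem isoperimetricRatio_zeroCell (hX : IsPoissonHyperplaneProcess P X (Theta n r γ))
    (hn : 2 ≤ n) (hr : 0 < r) (hγ : 0 < γ) :
    isoperimetricRatio P (fun ω => zeroCell (X ω)) = zeroCellRatio n r := by
  have hn1 : 1 ≤ n := by omega
  have hn' : (2 : ℝ) ≤ n := by exact_mod_cast hn
  have hk : 0 < kappa n := kappa_pos n.cast_nonneg
  have hΓ := Real.Gamma_pos_of_pos (show 0 < ((n : ℝ) - 1) / r + 1 by
    have := div_nonneg (show 0 ≤ (n : ℝ) - 1 by linarith) hr.le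
    linarith)
  have hl := totalRate_pos hn1 hr hγ
  have hs1 := sphereMoment_pos hn1 (show -1 < r - 1 by linarith)
  have hs2 := sphereMoment_pos hn1 (show -1 < r by linarith)
  rw [isoperimetricRatio, (hX.integral_intrinsicVolume_pred hn hr hγ).2,
    (hX.integral_intrinsicVolume_top hn1 hr hγ).2, Real.mul_rpow (by positivity) (by positivity),
    ← Real.rpow_mul hl.le,
    show -((n : ℝ) - 1) / r * ((n : ℝ) / ((n : ℝ) - 1)) = -(n : ℝ) / r by
      have : (n : ℝ) - 1 ≠ 0 := by linarith
      field_simp,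
    mul_div_mul_right _ _ (Real.rpow_pos_of_pos hl _).ne', sphereMoment_sub_one_div hn1 hr,
    zeroCellRatio]

end IsPoissonHyperplaneProcess

end PoissonPolyhedra

/-! ### The main theorem -/

theorem theorem3p17 (b : ℝ) (hb : 0 < b) (α : ℝ) (γ : ℕ → ℝ) (hγ : ∀ n, 2 ≤ n → 0 < γ n)
    {Ω : ℕ → Type*} [∀ n, MeasurableSpace (Ω n)] (P : ∀ n, Measure (Ω n))
    [∀ n, IsProbabilityMeasure (P n)]
    (X : ∀ n, Ω n → Set (PoissonPolyhedra.Hyperplane n))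
    (hX : ∀ n, 2 ≤ n → PoissonPolyhedra.IsPoissonHyperplaneProcess (P n) (X n)
      (PoissonPolyhedra.Theta n (b * (n : ℝ) ^ α) (γ n))) :
    -- the two expectations in the isoperimetric ratio exist and are finite
    (∀ n, 2 ≤ n →
      Integrable (fun ω => PoissonPolyhedra.intrinsicVolume (n - 1)
        (PoissonPolyhedra.zeroCell (X n ω))) (P n) ∧
      Integrable (fun ω => PoissonPolyhedra.intrinsicVolume n
        (PoissonPolyhedra.zeroCell (X n ω))) (P n)) ∧
    PoissonPolyhedra.IsGaugeFunction P (fun n ω => PoissonPolyhedra.zeroCell (X n ω))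
      (PoissonPolyhedra.gauge b α) ∧
    -- the gauge function grows only for `α < 0`
    (α < 0 → Tendsto (PoissonPolyhedra.gauge b α) atTop atTop) ∧
    (0 ≤ α → Tendsto (PoissonPolyhedra.gauge b α) atTop (𝓝 0)) ∧
    -- comparison with the Euclidean ball
    PoissonPolyhedra.IsGaugeFunction P
      (fun n _ => Metric.closedBall (0 : PoissonPolyhedra.Euc n) 1) PoissonPolyhedra.ballGauge ∧
    (1 < α → PoissonPolyhedra.gauge b α = PoissonPolyhedra.ballGauge) := by
  have hr : ∀ n : ℕ, 2 ≤ n → 0 < b * (n : ℝ) ^ α := fun n hn =>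
    mul_pos hb (Real.rpow_pos_of_pos (by positivity) _)
  refine ⟨fun n hn => ⟨((hX n hn).integral_intrinsicVolume_pred hn (hr n hn) (hγ n hn)).1,
      ((hX n hn).integral_intrinsicVolume_top (by omega) (hr n hn) (hγ n hn)).1⟩, ?_,
    PoissonPolyhedra.tendsto_gauge_atTop hb, PoissonPolyhedra.tendsto_gauge_zero b, ?_,
    PoissonPolyhedra.gauge_eq_ballGauge b⟩
  · refine (PoissonPolyhedra.tendsto_gauge_mul_zeroCellRatio hb α).congr' ?_
    filter_upwards [eventually_ge_atTop 2] with n hn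
    rw [(hX n hn).isoperimetricRatio_zeroCell hn (hr n hn) (hγ n hn)]
  · refine PoissonPolyhedra.tendsto_ballGauge_mul.congr' ?_
    filter_upwards [eventually_ge_atTop 1] with n hn
    rw [PoissonPolyhedra.isoperimetricRatio_closedBall (P n) hn]
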